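/- Let $N\ge 3$, let $\mathbb S^{N-1}\subset\mathbb R^N$ be the unit sphere with the round metric and $\mathbb S^{N-1}_+=\mathbb S^{N-1}\cap\{x_N>0\}$ the open upper hemisphere. For a smooth domain $D\subset\mathbb S^{N-1}$ (a nonempty connected open set with $C^\infty$ boundary, lying locally on one side of it), let $\lambda_1(D)$ be the first nonzero eigenvalue of the Laplace–Beltrami operator $-\Delta_{\mathbb S^{N-1}}$ on $D$ with homogeneous Neumann boundary condition, i.e. the least $\mu>0$ for which there is $u\in H^1(D)$, $u\ne0$, with $\int_D\langle\nabla u,\nabla v\rangle=\mu\int_D uv$ for all $v\in H^1(D)$. In polar coordinates $(r,\omega)$ around the north pole ($r$ the geodesic distance from the north pole, $\omega\in\mathbb S^{N-2}$) put $\phi_\alpha(r,\omega)=(\alpha r,\omega)$ on $\mathbb S^{N-1}_+$ for $\alpha\in(0,2)$, and $D_\alpha=\phi_\alpha(D)$ for $D\subset \mathbb S^{N-1}_+$. Let $D\subset\mathbb S^{N-1}_+$ be a smooth domain and let $\alpha\in(0,2)$ be such that $D_\alpha\subset\mathbb S^{N-1}_+$ and $\lambda_1(D_\alpha)<N-1$.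 Then there exists $\bar\alpha\in(0,\alpha)$ such that $$\lambda_1(D_{\bar\alpha})=N-1.$$ Moreover one may assume $\bar\alpha=1$ after redefining the parameter: $\tilde D=D_{\bar\alpha}$ is again a smooth domain contained in $\mathbb S^{N-1}_+$, and $\tilde D_\gamma=D_{\bar\alpha\gamma}$ for all $\gamma\in(0,2)$ with $\bar\alpha\gamma<2$. -/

import Mathlib

open Real Set Filter Topology MeasureTheory
open scoped ContDiff InnerProductSpace

namespace SphericalNeumann

/-- The ambient Euclidean space `ℝ^N`. -/
abbrev Amb (N : ℕ) : Type := EuclideanSpace ℝ (Fin N)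

/-- The unit sphere `S^{N-1}` of `ℝ^N`. -/
abbrev Sph (N : ℕ) : Type := Metric.sphere (0 : Amb N) 1

/-- The surface measure of `S^{N-1}` (the Riemannian measure of the round metric). -/
noncomputable abbrev surf (N : ℕ) : Measure (Sph N) := (volume : Measure (Amb N)).toSphere

/-- The north pole `e_N = (0, …, 0, 1)`. -/
noncomputable def northPole (N : ℕ) : Amb N :=
  WithLp.toLp 2 (fun i : Fin N => if (i : ℕ) + 1 = N then (1 : ℝ) else 0)

/-- The open upper hemisphere `S^{N-1} ∩ {x_N > 0}`. -/
def upperHemisphere (N : ℕ) : Set (Sph N) := {p | 0 < ⟪northPole N, (p : Amb N)⟫_ℝ}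

/-! ### Smooth domains of the sphere -/

/-- A smooth domain of `S^{N-1}`: a nonempty connected open subset such that near each boundary
point `p` it is the sublevel set `{f < 0}` of a `C^∞` function `f` with `f p = 0` whose
differential does not vanish on the tangent space `p^⊥` of the sphere at `p`. -/
structure IsSmoothDomain {N : ℕ} (D : Set (Sph N)) : Prop where
  isOpen : IsOpen D
  isConnected : IsConnected D
  smooth_boundary : ∀ p ∈ frontier D, ∃ (U : Set (Amb N)) (f : Amb N → ℝ),
    IsOpen U ∧ (p : Amb N) ∈ U ∧ ContDiffOn ℝ ∞ f U ∧ f p = 0 ∧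
    (∃ v : Amb N, ⟪(p : Amb N), v⟫_ℝ = 0 ∧ fderiv ℝ f p v ≠ 0) ∧
    ∀ q : Sph N, (q : Amb N) ∈ U → (q ∈ D ↔ f q < 0)

/-! ### Polar coordinates around the north pole and the maps `φ_α` -/

/-- The geodesic distance `r ∈ [0, π]` of `p` from the north pole. -/
noncomputable def polarRadius {N : ℕ} (p : Sph N) : ℝ :=
  arccos ⟪northPole N, (p : Amb N)⟫_ℝ

/-- The polar direction `ω ∈ S^{N-2} ⊆ e_N^⊥` of a point `p ≠ ± e_N`
(at the poles, where the direction is irrelevant, the formula returns `0`). -/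
noncomputable def polarDirection {N : ℕ} (p : Sph N) : Amb N :=
  (sin (polarRadius p))⁻¹ • ((p : Amb N) - cos (polarRadius p) • northPole N)

/-- The point with polar coordinates `(r, w)`. -/
noncomputable def fromPolar {N : ℕ} (r : ℝ) (w : Amb N) : Amb N :=
  cos r • northPole N + sin r • w

/-- The map `φ_α (r, ω) = (α r, ω)`. -/
noncomputable def dilation {N : ℕ} (α : ℝ) (p : Sph N) : Amb N :=
  fromPolar (α * polarRadius p) (polarDirection p)

/-- The image domain `D_α = φ_α (D)`. -/
def dilatedDomain {N : ℕ} (α : ℝ) (D : Set (Sph N)) : Set (Sph N) :=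
  {q | ∃ p ∈ D, (q : Amb N) = dilation α p}

/-! ### The Sobolev space `H¹(D)` and Neumann eigenvalues -/

/-- The divergence on the sphere, at `p`, of a vector field `X` that is tangent to the sphere: the
trace of `dX_p` over the tangent space `p^⊥`. -/
noncomputable def sphDiv {N : ℕ} (X : Amb N → Amb N) (p : Sph N) : ℝ :=
  LinearMap.trace ℝ (Amb N) (fderiv ℝ X p : Amb N →ₗ[ℝ] Amb N)
    - ⟪fderiv ℝ X p p, (p : Amb N)⟫_ℝ

/-- Smooth tangent vector fields on the sphere (written through a smooth extension to `ℝ^N`)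
with compact support in `D`. -/
structure IsTestField {N : ℕ} (D : Set (Sph N)) (X : Amb N → Amb N) : Prop where
  smooth : ContDiff ℝ ∞ X
  tangent : ∀ p : Sph N, ⟪(p : Amb N), X p⟫_ℝ = 0
  compact_support : ∃ K : Set (Sph N), IsCompact K ∧ K ⊆ D ∧ ∀ p : Sph N, p ∉ K → X p = 0

/-- `u ∈ H¹(D)` with weak (Riemannian) gradient `G`: `u` and the tangent vector field `G` are
square integrable on `D` and `∫_D u div X = - ∫_D ⟨G, X⟩` for all test fields `X`. -/
structure HasSobolevGradient {N : ℕ} (D : Set (Sph N)) (u : Sph N → ℝ) (G : Sph N → Amb N) :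
    Prop where
  memLp : MemLp u 2 ((surf N).restrict D)
  memLp_grad : MemLp G 2 ((surf N).restrict D)
  tangent : ∀ᵐ (p : Sph N) ∂((surf N).restrict D), ⟪(p : Amb N), G p⟫_ℝ = 0
  weak_gradient : ∀ X : Amb N → Amb N, IsTestField D X →
    ∫ (p : Sph N) in D, u p * sphDiv X p ∂(surf N) = - ∫ (p : Sph N) in D, ⟪G p, X p⟫_ℝ ∂(surf N)

/-- `μ` is an eigenvalue of `-Δ` on `D` with homogeneous Neumann boundary conditions: the problem
`-Δ u = μ u` in `D`, `∂_ν u = 0` on `∂D` has a nonzero weak solution, that is, a nonzero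
`u ∈ H¹(D)` with `∫_D ⟨∇u, ∇v⟩ = μ ∫_D u v` for all `v ∈ H¹(D)`. -/
def IsNeumannEigenvalue {N : ℕ} (D : Set (Sph N)) (μ : ℝ) : Prop :=
  ∃ (u : Sph N → ℝ) (G : Sph N → Amb N), HasSobolevGradient D u G ∧
    ¬ (u =ᵐ[(surf N).restrict D] 0) ∧
    ∀ (v : Sph N → ℝ) (H : Sph N → Amb N), HasSobolevGradient D v H →
      ∫ (p : Sph N) in D, ⟪G p, H p⟫_ℝ ∂(surf N) = μ * ∫ (p : Sph N) in D, u p * v p ∂(surf N)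

/-- `λ₁(D)`, the first positive (equivalently, nonzero) Neumann eigenvalue of `-Δ` on `D`. -/
noncomputable def lambdaOne {N : ℕ} (D : Set (Sph N)) : ℝ :=
  sInf {μ : ℝ | 0 < μ ∧ IsNeumannEigenvalue D μ}

end SphericalNeumann

open SphericalNeumann

/-! The function t ↦ λ₁(D_{αt}) on (0,1] is below N - 1 at t = 1, is continuous, and exceeds every
bound at some small t; the intermediate value theorem then gives β = αt.

The analysis enters through `IsSmoothDomain.spectral_gap`: for a smooth domain λ₁ is positive, is
attained, and is the largest l such that every u in H¹ satisfies l ∫ (u - c)² ≤ ∫ |∇u|² for some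
constant c. Hence a diffeomorphism that distorts lengths and volumes by controlled factors changes
λ₁ by a controlled factor (`IsConeDiffeo.poincareBound`, `IsConeDiffeo.lambdaOne_le`). For γ ≤ 1 the
chord formula `norm_dilation_sub_sq` shows that φ_γ does not increase distances on the hemisphere
and that its inverse is γ⁻¹-Lipschitz, so λ₁(D) γ^N ≤ λ₁(D_γ) ≤ γ^{-(N+2)} λ₁(D). These bounds give
continuity. For the growth, φ_{1/2} multiplies squared chords by at most 1/2, while only the
oscillation of its Jacobian is lost in the comparison. Near the pole this oscillation is small, so
each halving multiplies λ₁ by at least 3/2.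

The spectral gap follows from minimizing the Rayleigh quotient in an abstract Hilbert setting
(`exists_first_eigenpair`), given compactness of H¹(D) in L² and the fact that a vanishing gradient
forces a constant on a connected domain. Both are obtained in ℝ^N: u is extended to the cone over D
homogeneously of degree 0 and its gradient of degree -1, and weak gradients on sphere and cone
correspond in both directions (`HasSobolevGradient.hasWeakGradient`,
`hasSobolevGradient_of_hasWeakGradient`). Compactness comes from the L² translation estimate. In the
interior u is compared with its averages over small balls; at the boundary, sliding inwards shows
that no mass concentrates in a thin collar (`IsRegularBoundaryPoint.exists_collar`). The chain rule
is also proved on cones, where φ_γ becomes a map homogeneous of degree one; it is smooth across the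
pole because arccos² is smooth near 1 and cos √z is entire. -/

set_option linter.unusedSectionVars false

namespace SphericalNeumann

/-! ### Square integrable functions -/

section SquareIntegrable

variable {X F : Type*} [MeasurableSpace X] {μ : Measure X} [NormedAddCommGroup F]
  [InnerProductSpace ℝ F]

theorem integral_inner_eq_inner_toLp {f g : X → F} (hf : MemLp f 2 μ) (hg : MemLp g 2 μ) :
    ∫ x, ⟪f x, g x⟫_ℝ ∂μ = ⟪hf.toLp f, hg.toLp g⟫_ℝ := by
  rw [L2.inner_def]
  refine integral_congr_ae ?_
  filter_upwards [hf.coeFn_toLp, hg.coeFn_toLp] with x h1 h2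
  rw [h1, h2]

theorem integral_norm_sq_eq_norm_toLp_sq {f : X → F} (hf : MemLp f 2 μ) :
    ∫ x, ‖f x‖ ^ 2 ∂μ = ‖hf.toLp f‖ ^ 2 := by
  rw [← real_inner_self_eq_norm_sq, ← integral_inner_eq_inner_toLp]
  simp_rw [real_inner_self_eq_norm_sq]

theorem eLpNorm_toReal_sq {f : X → F} (hf : MemLp f 2 μ) :
    (eLpNorm f 2 μ).toReal ^ 2 = ∫ x, ‖f x‖ ^ 2 ∂μ := by
  rw [integral_norm_sq_eq_norm_toLp_sq hf, Lp.norm_toLp]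

theorem integrable_inner_of_memLp {f g : X → F} (hf : MemLp f 2 μ) (hg : MemLp g 2 μ) :
    Integrable (fun x => ⟪f x, g x⟫_ℝ) μ := by
  refine (L2.integrable_inner (𝕜 := ℝ) (hf.toLp f) (hg.toLp g)).congr ?_
  filter_upwards [hf.coeFn_toLp, hg.coeFn_toLp] with x h1 h2
  rw [h1, h2]

theorem abs_integral_inner_le {f g : X → F} (hf : MemLp f 2 μ) (hg : MemLp g 2 μ) :
    |∫ x, ⟪f x, g x⟫_ℝ ∂μ| ≤ (eLpNorm f 2 μ).toReal * (eLpNorm g 2 μ).toReal := by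
  rw [integral_inner_eq_inner_toLp hf hg, ← Lp.norm_toLp f hf, ← Lp.norm_toLp g hg]
  exact abs_real_inner_le_norm _ _

theorem abs_integral_mul_le {f g : X → ℝ} (hf : MemLp f 2 μ) (hg : MemLp g 2 μ) :
    |∫ x, f x * g x ∂μ| ≤ (eLpNorm f 2 μ).toReal * (eLpNorm g 2 μ).toReal := by
  have := abs_integral_inner_le hg hf
  simpa [mul_comm] using this

theorem sq_integral_mul_le {f g : X → ℝ} (hf : MemLp f 2 μ) (hg : MemLp g 2 μ) :
    (∫ x, f x * g x ∂μ) ^ 2 ≤ (∫ x, f x ^ 2 ∂μ) * ∫ x, g x ^ 2 ∂μ := by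
  have h := abs_integral_mul_le hf hg
  have h1 := eLpNorm_toReal_sq hf
  have h2 := eLpNorm_toReal_sq hg
  simp only [Real.norm_eq_abs, sq_abs] at h1 h2
  rw [← h1, ← h2, ← mul_pow, ← sq_abs]
  gcongr

end SquareIntegrable

/-! ### Smooth parametric integrals and cut-off functions -/

/-- The integral is the value at 0 of the convolution of the indicator of `Ioc a b` with the
reflected, cut-off integrand, so smoothness in the parameter is that of convolutions. -/
theorem contDiffOn_intervalIntegral_param {P F : Type*} [NormedAddCommGroup P] [NormedSpace ℝ P]
    [NormedAddCommGroup F] [NormedSpace ℝ F] [CompleteSpace F] {s : Set P} (hs : IsOpen s)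
    {g : P → ℝ → F} (hg : ContDiffOn ℝ ∞ ↿g (s ×ˢ univ)) {a b : ℝ} (hab : a ≤ b) :
    ContDiffOn ℝ ∞ (fun p => ∫ t in a..b, g p t) s := by
  -- The centre is minus the midpoint because the convolution at 0 evaluates `g'` at `-t`. The inner
  -- radius exceeds half the length of the interval, so χ is 1 wherever it is needed.
  let χ : ContDiffBump (-((a + b) / 2)) :=
    { rIn := b - a + 1, rOut := b - a + 2, rIn_pos := by linarith, rIn_lt_rOut := by linarith }
  let g' : P → ℝ → F := fun p t => χ t • g p (-t)
  let f : ℝ → ℝ := (Ioc a b).indicator 1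
  have key := contDiffOn_convolution_right_with_param_comp (𝕜 := ℝ) (n := ⊤) (μ := volume)
    (ContinuousLinearMap.lsmul ℝ ℝ : ℝ →L[ℝ] F →L[ℝ] F) (s := s) (v := fun _ => (0 : ℝ))
    contDiffOn_const (f := f) (g := g')
    (k := Metric.closedBall (-((a + b) / 2)) (b - a + 2)) hs (isCompact_closedBall _ _)
    (by
      intro p x _ hx
      have : χ x = 0 := by
        apply χ.zero_of_le_dist
        simp only [Metric.mem_closedBall, not_le] at hx
        exact hx.le
      simp [g', this])
    (by
      refine Integrable.locallyIntegrable ?_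
      exact (integrable_indicator_iff measurableSet_Ioc).2 (integrableOn_const (by simp)))
    (by
      refine ContDiffOn.smul ?_ ?_
      · exact (χ.contDiff.comp contDiff_snd).contDiffOn
      · refine hg.comp (t := s ×ˢ univ) (f := fun q : P × ℝ => (q.1, -q.2)) ?_ ?_
        · exact (contDiff_fst.prodMk contDiff_snd.neg).contDiffOn
        · rintro ⟨p, t⟩ ⟨hp, _⟩
          exact ⟨hp, trivial⟩)
  refine key.congr ?_
  intro p hp
  rw [intervalIntegral.integral_of_le hab, convolution_def, ← integral_indicator measurableSet_Ioc]
  refine integral_congr_ae (ae_of_all _ fun t => ?_)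
  by_cases ht : t ∈ Ioc a b
  · have : χ (-t) = 1 := by
      apply χ.one_of_mem_closedBall
      rw [Metric.mem_closedBall, Real.dist_eq, abs_le]
      constructor <;> simp only [χ] <;> linarith [ht.1, ht.2]
    simp [f, g', ht, this]
  · simp [f, ht]

section Cutoff

variable {E : Type*} [NormedAddCommGroup E] [NormedSpace ℝ E] [FiniteDimensional ℝ E]

theorem exists_contDiff_cutoff {K V : Set E} (hK : IsCompact K) (hV : IsOpen V) (hKV : K ⊆ V) :
    ∃ χ : E → ℝ, ContDiff ℝ ∞ χ ∧ HasCompactSupport χ ∧ tsupport χ ⊆ V ∧ (∀ x ∈ K, χ x = 1) ∧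
      ∀ x, χ x ∈ Icc (0 : ℝ) 1 := by
  obtain ⟨K', hK', h1, h2⟩ := exists_compact_between hK hV hKV
  obtain ⟨f, hf1, hf0, hf⟩ := exists_contMDiffMap_one_nhds_of_subset_interior
    (modelWithCornersSelf ℝ E) (n := ⊤) hK.isClosed h1
  have hs : tsupport f ⊆ K' := by
    refine closure_minimal ?_ hK'.isClosed
    intro x hx
    by_contra h
    exact hx (hf0 x h)
  exact ⟨f, f.contMDiff.contDiff, HasCompactSupport.of_support_subset_isCompact hK'
    ((subset_tsupport _).trans hs), hs.trans h2, fun x hx => hf1.self_of_nhdsSet x hx, hf⟩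

end Cutoff

/-! ### Weak gradients in Euclidean space -/

section Weak

variable {E : Type*} [NormedAddCommGroup E] [InnerProductSpace ℝ E] [FiniteDimensional ℝ E]
  [MeasurableSpace E] [BorelSpace E]

/-- `G` is the weak gradient of `u` in the open set `Ω`. -/
def HasWeakGradient (Ω : Set E) (u : E → ℝ) (G : E → E) : Prop :=
  ∀ φ : E → ℝ, ContDiff ℝ ∞ φ → HasCompactSupport φ → tsupport φ ⊆ Ω → ∀ e : E,
    ∫ x, u x * fderiv ℝ φ x e = - ∫ x, ⟪G x, e⟫_ℝ * φ x

theorem HasWeakGradient.congr {Ω : Set E} {u v : E → ℝ} {G H : E → E} (h : HasWeakGradient Ω u G)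
    (huv : ∀ x ∈ Ω, u x = v x) (hGH : ∀ x ∈ Ω, G x = H x) : HasWeakGradient Ω v H := by
  intro φ hφ hc hs e
  have h1 : ∀ x, v x * fderiv ℝ φ x e = u x * fderiv ℝ φ x e := by
    intro x
    by_cases hx : x ∈ tsupport φ
    · rw [huv x (hs hx)]
    · have : fderiv ℝ φ x = 0 := by
        by_contra h0
        exact hx (support_fderiv_subset ℝ h0)
      simp [this]
  have h2 : ∀ x, ⟪H x, e⟫_ℝ * φ x = ⟪G x, e⟫_ℝ * φ x := by
    intro x
    by_cases hx : x ∈ tsupport φ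
    · rw [hGH x (hs hx)]
    · simp [image_eq_zero_of_notMem_tsupport hx]
  simp_rw [h1, h2]
  exact h φ hφ hc hs e

theorem HasWeakGradient.mono {Ω Ω' : Set E} {u : E → ℝ} {G : E → E} (h : HasWeakGradient Ω u G)
    (hΩ : Ω' ⊆ Ω) : HasWeakGradient Ω' u G :=
  fun φ hφ hc hs e => h φ hφ hc (hs.trans hΩ) e

/-! ### Segment averages: from weak gradients to finite differences. -/

section SegmentAverage

variable {φ : E → ℝ} {z : E}

/-- The average of `φ` over the segment from `x` to `x - z`. -/
noncomputable def segmentAverage (φ : E → ℝ) (z x : E) : ℝ := ∫ s in (0 : ℝ)..1, φ (x - s • z)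

omit [FiniteDimensional ℝ E] [MeasurableSpace E] [BorelSpace E] in
theorem contDiff_segmentAverage (hφ : ContDiff ℝ ∞ φ) : ContDiff ℝ ∞ (segmentAverage φ z) := by
  rw [← contDiffOn_univ]
  refine contDiffOn_intervalIntegral_param (g := fun x s => φ (x - s • z)) isOpen_univ ?_
    zero_le_one
  refine ContDiff.contDiffOn ?_
  exact hφ.comp (contDiff_fst.sub (contDiff_snd.smul contDiff_const))

omit [FiniteDimensional ℝ E] [MeasurableSpace E] [BorelSpace E] in
theorem support_segmentAverage_subset :
    Function.support (segmentAverage φ z) ⊆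
      (fun q : E × ℝ => q.1 + q.2 • z) '' (tsupport φ ×ˢ Icc (0 : ℝ) 1) := by
  intro x hx
  by_contra h
  apply hx
  rw [segmentAverage]
  refine (intervalIntegral.integral_congr (g := fun _ => (0 : ℝ)) ?_).trans (by simp)
  intro s hs
  rw [uIcc_of_le zero_le_one] at hs
  by_contra h0
  exact h ⟨(x - s • z, s), ⟨subset_tsupport _ h0, hs⟩, by simp⟩

omit [FiniteDimensional ℝ E] [MeasurableSpace E] [BorelSpace E] in
theorem tsupport_segmentAverage_subset (hc : HasCompactSupport φ) :
    tsupport (segmentAverage φ z) ⊆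
      (fun q : E × ℝ => q.1 + q.2 • z) '' (tsupport φ ×ˢ Icc (0 : ℝ) 1) := by
  refine closure_minimal support_segmentAverage_subset ?_
  exact ((hc.isCompact.prod isCompact_Icc).image (by fun_prop)).isClosed

omit [FiniteDimensional ℝ E] [MeasurableSpace E] [BorelSpace E] in
theorem hasCompactSupport_segmentAverage (hc : HasCompactSupport φ) :
    HasCompactSupport (segmentAverage φ z) :=
  HasCompactSupport.of_support_subset_isCompact
    ((hc.isCompact.prod isCompact_Icc).image (by fun_prop)) support_segmentAverage_subset

omit [FiniteDimensional ℝ E] [MeasurableSpace E] [BorelSpace E] in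
-- The segment average is a primitive along `z` of a finite difference: as x moves along z, only the
-- two ends of the segment change. Testing a weak gradient against it turns ⟨G, z⟩ into a translate
-- difference.
theorem fderiv_segmentAverage (hφ : ContDiff ℝ ∞ φ) (x : E) :
    fderiv ℝ (segmentAverage φ z) x z = φ x - φ (x - z) := by
  have hd : DifferentiableAt ℝ (segmentAverage φ z) x :=
    (contDiff_segmentAverage hφ).differentiable (by simp) x
  have h1 : HasDerivAt (fun τ : ℝ => segmentAverage φ z (x + τ • z))
      (fderiv ℝ (segmentAverage φ z) x z) 0 := by
    have h0 : HasDerivAt (fun τ : ℝ => x + τ • z) z 0 := by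
      simpa using ((hasDerivAt_id (0 : ℝ)).smul_const z).const_add x
    have := HasFDerivAt.comp_hasDerivAt (x := (0 : ℝ)) (f := fun τ : ℝ => x + τ • z)
      (l := segmentAverage φ z) (l' := fderiv ℝ (segmentAverage φ z) x)
      (by simpa using hd.hasFDerivAt) h0
    exact this
  have hcont : Continuous fun s : ℝ => φ (x - s • z) := by
    have := hφ.continuous
    fun_prop
  have h2 : ∀ τ : ℝ, segmentAverage φ z (x + τ • z) =
      (∫ s in (0 : ℝ)..(1 - τ), φ (x - s • z)) - ∫ s in (0 : ℝ)..(0 - τ), φ (x - s • z) := by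
    intro τ
    rw [segmentAverage, intervalIntegral.integral_interval_sub_left
      (hcont.intervalIntegrable _ _) (hcont.intervalIntegrable _ _)]
    have := intervalIntegral.integral_comp_sub_right (a := 0) (b := 1)
      (fun s => φ (x - s • z)) τ
    rw [← this]
    refine intervalIntegral.integral_congr fun s _ => ?_
    congr 1
    simp only [sub_smul]
    abel
  have h3 : HasDerivAt (fun τ : ℝ => (∫ s in (0 : ℝ)..(1 - τ), φ (x - s • z)) -
      ∫ s in (0 : ℝ)..(0 - τ), φ (x - s • z)) (φ x - φ (x - z)) 0 := by
    have ha := fun c : ℝ => (intervalIntegral.integral_hasDerivAt_right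
      (hcont.intervalIntegrable (μ := volume) 0 (c - 0))
      (hcont.stronglyMeasurableAtFilter _ _) hcont.continuousAt).comp_const_sub c 0
    have := (ha 1).sub (ha 0)
    simp only [sub_zero, one_smul, zero_smul] at this
    refine this.congr_deriv ?_
    simp [sub_eq_add_neg, add_comm]
  simp_rw [h2] at h1
  exact h1.unique h3

/-- Cauchy–Schwarz on the segment, then Fubini and translation invariance. -/
theorem integral_segmentAverage_sq_le (hφ : ContDiff ℝ ∞ φ) (hc : HasCompactSupport φ) :
    ∫ x, segmentAverage φ z x ^ 2 ≤ ∫ x, φ x ^ 2 := by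
  have hcont := hφ.continuous
  have hpt : ∀ x, segmentAverage φ z x ^ 2 ≤ ∫ s in Ioc (0 : ℝ) 1, φ (x - s • z) ^ 2 := by
    intro x
    have hb : MemLp (fun s : ℝ => φ (x - s • z)) 2 (volume.restrict (Ioc (0 : ℝ) 1)) := by
      have hcs : Continuous fun s : ℝ => φ (x - s • z) := by fun_prop
      obtain ⟨C, hC⟩ := hcont.bounded_above_of_compact_support hc
      exact MemLp.of_bound hcs.aestronglyMeasurable C (ae_of_all _ fun s => hC _)
    have h1 : MemLp (fun _ : ℝ => (1 : ℝ)) 2 (volume.restrict (Ioc (0 : ℝ) 1)) := memLp_const 1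
    have := sq_integral_mul_le h1 hb
    rw [segmentAverage, intervalIntegral.integral_of_le zero_le_one]
    simpa using this
  have hint : Integrable (fun x => φ x ^ 2) :=
    (hcont.memLp_of_hasCompactSupport (p := 2) hc).integrable_sq
  have hprod : Integrable (fun q : E × ℝ => φ (q.1 - q.2 • z) ^ 2)
      (volume.prod (volume.restrict (Ioc (0 : ℝ) 1))) := by
    have hcq : Continuous fun q : E × ℝ => φ (q.1 - q.2 • z) ^ 2 := by fun_prop
    refine (integrable_prod_iff' hcq.aestronglyMeasurable).2
      ⟨ae_of_all _ fun s => hint.comp_sub_right (s • z), ?_⟩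
    have : ∀ s : ℝ, ∫ x, ‖φ (x - s • z) ^ 2‖ = ∫ x, ‖φ x ^ 2‖ := fun s =>
      integral_sub_right_eq_self (fun x => ‖φ x ^ 2‖) (s • z)
    simp_rw [this]
    exact integrable_const _
  calc ∫ x, segmentAverage φ z x ^ 2
      ≤ ∫ x, ∫ s in Ioc (0 : ℝ) 1, φ (x - s • z) ^ 2 := by
        refine integral_mono ?_ hprod.integral_prod_left hpt
        exact ((contDiff_segmentAverage hφ).continuous.memLp_of_hasCompactSupport (p := 2)
          (hasCompactSupport_segmentAverage hc)).integrable_sq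
    _ = ∫ s in Ioc (0 : ℝ) 1, ∫ x, φ (x - s • z) ^ 2 := integral_integral_swap hprod
    _ = ∫ x, φ x ^ 2 := by
        have : ∀ s : ℝ, ∫ x, φ (x - s • z) ^ 2 = ∫ x, φ x ^ 2 := fun s =>
          integral_sub_right_eq_self (fun x => φ x ^ 2) (s • z)
        simp_rw [this]
        simp

end SegmentAverage

/-! ### The L² translation estimate. -/

section Translation

variable {Ω : Set E} {u : E → ℝ} {G : E → E}

omit [FiniteDimensional ℝ E] [MeasurableSpace E] [BorelSpace E] in
theorem isOpen_setOf_segment_subset (hΩ : IsOpen Ω) (z : E) :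
    IsOpen {x : E | ∀ s ∈ Icc (0 : ℝ) 1, x + s • z ∈ Ω} := by
  rw [isOpen_iff_mem_nhds]
  intro x hx
  have := isCompact_Icc.eventually_forall_of_forall_eventually (x₀ := x)
    (P := fun (x : E) (s : ℝ) => x + s • z ∈ Ω) (fun s hs => by
      have hc : Continuous fun q : E × ℝ => q.1 + q.2 • z := by fun_prop
      exact hc.continuousAt.eventually (hΩ.mem_nhds (hx s hs)))
  exact this

/-- The translation estimate in dual form. Moving the translation onto φ leaves u paired with a
finite difference of φ, which is the z-derivative of its segment average; the weak gradient then
applies. -/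
theorem HasWeakGradient.abs_integral_translate_sub_mul_le (h : HasWeakGradient Ω u G)
    (hu : MemLp u 2) (hG : MemLp G 2) {z : E} {φ : E → ℝ} (hφ : ContDiff ℝ ∞ φ)
    (hc : HasCompactSupport φ)
    (hs : tsupport φ ⊆ {x : E | ∀ s ∈ Icc (0 : ℝ) 1, x + s • z ∈ Ω}) :
    |∫ x, (u (x + z) - u x) * φ x| ≤
      ‖z‖ * (eLpNorm G 2).toReal * (eLpNorm φ 2).toReal := by
  have hφ2 : MemLp φ 2 := hφ.continuous.memLp_of_hasCompactSupport hc
  have hΦ := contDiff_segmentAverage (z := z) hφ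
  have hΦc := hasCompactSupport_segmentAverage (z := z) hc
  have hΦ2 : MemLp (segmentAverage φ z) 2 := hΦ.continuous.memLp_of_hasCompactSupport hΦc
  have hφz : MemLp (fun x => φ (x - z)) 2 := by
    have h0 : Continuous fun x => φ (x - z) := by
      have := hφ.continuous
      fun_prop
    exact h0.memLp_of_hasCompactSupport (hc.comp_homeomorph (Homeomorph.subRight z))
  have hibp := h _ hΦ hΦc (by
    refine (tsupport_segmentAverage_subset hc).trans ?_
    rintro _ ⟨⟨x, s⟩, ⟨hx, hs'⟩, rfl⟩
    exact hs hx s hs') z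
  have e1 : ∫ x, (u (x + z) - u x) * φ x = - ∫ x, u x * fderiv ℝ (segmentAverage φ z) x z := by
    have huz : MemLp (fun x => u (x + z)) 2 :=
      hu.comp_measurePreserving (measurePreserving_add_right volume z)
    simp_rw [fderiv_segmentAverage hφ, sub_mul, mul_sub]
    have i1 : Integrable fun x => u (x + z) * φ x := huz.integrable_mul hφ2
    have i2 : Integrable fun x => u x * φ x := hu.integrable_mul hφ2
    have i3 : Integrable fun x => u x * φ (x - z) := hu.integrable_mul hφz
    rw [integral_sub i1 i2, integral_sub i2 i3]
    have := integral_add_right_eq_self (μ := volume) (fun x => u x * φ (x - z)) z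
    simp only [add_sub_cancel_right] at this
    rw [this]
    ring
  have hGz : ∫ x, ⟪G x, z⟫_ℝ * segmentAverage φ z x =
      ∫ x, ⟪G x, segmentAverage φ z x • z⟫_ℝ := by
    simp_rw [inner_smul_right, mul_comm]
  rw [e1, hibp, neg_neg, hGz]
  have hΦz : MemLp (fun x => segmentAverage φ z x • z) 2 :=
    (hΦ.continuous.smul continuous_const).memLp_of_hasCompactSupport hΦc.smul_right
  refine (abs_integral_inner_le hG hΦz).trans ?_
  have h1 : (eLpNorm (fun x => segmentAverage φ z x • z) 2).toReal ≤
      ‖z‖ * (eLpNorm φ 2).toReal := by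
    refine le_of_sq_le_sq ?_ (by positivity)
    rw [mul_pow, eLpNorm_toReal_sq hΦz, eLpNorm_toReal_sq hφ2]
    simp_rw [norm_smul, mul_pow, Real.norm_eq_abs, sq_abs]
    rw [integral_mul_const, mul_comm]
    exact mul_le_mul_of_nonneg_left (integral_segmentAverage_sq_le hφ hc) (by positivity)
  calc _ ≤ (eLpNorm G 2).toReal * (‖z‖ * (eLpNorm φ 2).toReal) := by gcongr
    _ = _ := by ring

theorem memLp_indicator_univ_of_restrict {F : Type*} [NormedAddCommGroup F] {f : E → F}
    (hΩ : MeasurableSet Ω) (hf : MemLp f 2 (volume.restrict Ω)) : MemLp (Ω.indicator f) 2 :=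
  (memLp_indicator_iff_restrict hΩ).2 hf

/-- Cutting an L² approximation off by χ cannot increase the error, since χ = 1 on K and f vanishes
elsewhere. -/
theorem exists_test_approx {f : E → ℝ} {K V : Set E} (hf : MemLp f 2) (hK : IsCompact K)
    (hV : IsOpen V) (hKV : K ⊆ V) (hfK : ∀ x ∉ K, f x = 0) {ε : ℝ} (hε : 0 < ε) :
    ∃ φ : E → ℝ, ContDiff ℝ ∞ φ ∧ HasCompactSupport φ ∧ tsupport φ ⊆ V ∧
      (eLpNorm (f - φ) 2).toReal ≤ ε := by
  obtain ⟨χ, hχ, hχc, hχV, hχ1, hχ01⟩ := exists_contDiff_cutoff hK hV hKV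
  obtain ⟨g, hgc, hg, hfg⟩ := hf.exist_eLpNorm_sub_le (by simp) (by norm_num) hε
  refine ⟨fun x => χ x * g x, hχ.mul hg, hχc.mul_right,
    (closure_mono (Function.support_mul_subset_left _ _)).trans hχV, ?_⟩
  refine ENNReal.toReal_le_of_le_ofReal hε.le (le_trans ?_ hfg)
  refine eLpNorm_mono fun x => ?_
  rw [Pi.sub_apply, Pi.sub_apply]
  by_cases hx : x ∈ K
  · simp [hχ1 x hx]
  · rw [hfK x hx, zero_sub, zero_sub, norm_neg, norm_neg, norm_mul, Real.norm_eq_abs (χ x),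
      abs_of_nonneg (hχ01 x).1]
    exact mul_le_of_le_one_left (norm_nonneg _) (hχ01 x).2

/-- Duality: the norm of ψ on K is computed by pairing ψ with its own restriction, and this
restriction is a limit of test functions supported in V. -/
theorem eLpNorm_indicator_le_of_forall_test {ψ : E → ℝ} {K V : Set E} (hψ : MemLp ψ 2)
    (hK : IsCompact K) (hV : IsOpen V) (hKV : K ⊆ V) {M : ℝ} (hM0 : 0 ≤ M)
    (hM : ∀ φ : E → ℝ, ContDiff ℝ ∞ φ → HasCompactSupport φ → tsupport φ ⊆ V →
      |∫ x, ψ x * φ x| ≤ M * (eLpNorm φ 2).toReal) :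
    (eLpNorm (K.indicator ψ) 2).toReal ≤ M := by
  have hf2 : MemLp (K.indicator ψ) 2 := hψ.indicator hK.measurableSet
  have hf0 : ∀ x ∉ K, K.indicator ψ x = 0 := fun x hx => indicator_of_notMem hx _
  have h1 : (eLpNorm (K.indicator ψ) 2).toReal ^ 2 = ∫ x, ψ x * K.indicator ψ x := by
    rw [eLpNorm_toReal_sq hf2]
    refine integral_congr_ae (ae_of_all _ fun x => ?_)
    by_cases hx : x ∈ K
    · simp [hx, sq]
    · simp [hx]
  generalize K.indicator ψ = f at hf2 hf0 h1 ⊢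
  have key : ∀ ε : ℝ, 0 < ε → (eLpNorm f 2).toReal ^ 2 ≤
      M * ((eLpNorm f 2).toReal + ε) + (eLpNorm ψ 2).toReal * ε := by
    intro ε hε
    obtain ⟨φ, hφs, hφc, hφV, hd⟩ := exists_test_approx hf2 hK hV hKV hf0 hε
    have hφ2 : MemLp φ 2 := hφs.continuous.memLp_of_hasCompactSupport hφc
    have hd2 : MemLp (f - φ) 2 := hf2.sub hφ2
    have hφn : (eLpNorm φ 2).toReal ≤ (eLpNorm f 2).toReal + ε := by
      have e1 : φ = f - (f - φ) := by simp
      have e2 : eLpNorm φ 2 ≤ eLpNorm f 2 + eLpNorm (f - φ) 2 := by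
        conv_lhs => rw [e1]
        exact eLpNorm_sub_le hf2.1 hd2.1 (by norm_num)
      have e3 : eLpNorm f 2 + eLpNorm (f - φ) 2 ≠ ⊤ :=
        ENNReal.add_ne_top.2 ⟨hf2.eLpNorm_ne_top, hd2.eLpNorm_ne_top⟩
      refine (ENNReal.toReal_mono e3 e2).trans ?_
      rw [ENNReal.toReal_add hf2.eLpNorm_ne_top hd2.eLpNorm_ne_top]
      exact add_le_add_right hd _
    have i1 : Integrable fun x => ψ x * φ x := hψ.integrable_mul hφ2
    have i2 : Integrable fun x => ψ x * (f - φ) x := hψ.integrable_mul hd2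
    have h2 : ∫ x, ψ x * f x = (∫ x, ψ x * φ x) + ∫ x, ψ x * (f - φ) x := by
      rw [← integral_add i1 i2]
      refine integral_congr_ae (ae_of_all _ fun x => ?_)
      simp only [Pi.sub_apply]
      ring
    have h4 := abs_integral_mul_le hψ hd2
    rw [h1, h2]
    refine add_le_add ((le_abs_self _).trans ((hM φ hφs hφc hφV).trans ?_))
      ((le_abs_self _).trans (h4.trans ?_))
    · exact mul_le_mul_of_nonneg_left hφn hM0
    · exact mul_le_mul_of_nonneg_left hd ENNReal.toReal_nonneg
  have h0 : 0 ≤ (eLpNorm f 2).toReal := ENNReal.toReal_nonneg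
  generalize (eLpNorm f 2).toReal = a at key h0 ⊢
  generalize (eLpNorm ψ 2).toReal = b at key ⊢
  -- Letting ε → 0 gives a² ≤ M a.
  have key2 : a ^ 2 ≤ M * (a + 0) + b * 0 := by
    have ht : Tendsto (fun ε : ℝ => M * (a + ε) + b * ε) (𝓝[>] 0) (𝓝 (M * (a + 0) + b * 0)) := by
      refine Tendsto.mono_left ?_ nhdsWithin_le_nhds
      exact Continuous.tendsto (by fun_prop) 0
    exact ge_of_tendsto ht (eventually_nhdsWithin_of_forall key)
  rcases h0.eq_or_lt with h | h
  · rwa [← h]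
  · refine le_of_mul_le_mul_right ?_ h
    linarith

/-- The `L²` translation estimate for functions with square integrable weak gradient. -/
theorem HasWeakGradient.integral_translate_sub_sq_le (hΩ : IsOpen Ω) (h : HasWeakGradient Ω u G)
    (hu : MemLp u 2 (volume.restrict Ω)) (hG : MemLp G 2 (volume.restrict Ω)) {K : Set E}
    (hK : IsCompact K) {z : E} (hz : ∀ x ∈ K, ∀ s ∈ Icc (0 : ℝ) 1, x + s • z ∈ Ω) :
    ∫ x in K, (u (x + z) - u x) ^ 2 ≤ ‖z‖ ^ 2 * ∫ x in Ω, ‖G x‖ ^ 2 := by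
  set u₀ := Ω.indicator u with hu₀
  set G₀ := Ω.indicator G with hG₀
  have hu2 : MemLp u₀ 2 := memLp_indicator_univ_of_restrict hΩ.measurableSet hu
  have hG2 : MemLp G₀ 2 := memLp_indicator_univ_of_restrict hΩ.measurableSet hG
  have h₀ : HasWeakGradient Ω u₀ G₀ :=
    h.congr (fun x hx => (indicator_of_mem hx _).symm) (fun x hx => (indicator_of_mem hx _).symm)
  set V := {x : E | ∀ s ∈ Icc (0 : ℝ) 1, x + s • z ∈ Ω} with hV
  have hVo : IsOpen V := isOpen_setOf_segment_subset hΩ z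
  have hVΩ : ∀ x ∈ V, x ∈ Ω ∧ x + z ∈ Ω := fun x hx =>
    ⟨by simpa using hx 0 (by simp), by simpa using hx 1 (by simp)⟩
  set ψ : E → ℝ := fun x => u₀ (x + z) - u₀ x with hψ
  have hψ2 : MemLp ψ 2 :=
    (hu2.comp_measurePreserving (measurePreserving_add_right volume z)).sub hu2
  set f : E → ℝ := K.indicator ψ with hf
  have hf2 : MemLp f 2 := hψ2.indicator hK.measurableSet
  have hGe : (eLpNorm G₀ 2).toReal ^ 2 = ∫ x in Ω, ‖G x‖ ^ 2 := by
    rw [eLpNorm_toReal_sq hG2, ← integral_indicator hΩ.measurableSet]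
    refine integral_congr_ae (ae_of_all _ fun x => ?_)
    by_cases hx : x ∈ Ω <;> simp [hG₀, hx]
  have hfe : (eLpNorm f 2).toReal ^ 2 = ∫ x in K, (u (x + z) - u x) ^ 2 := by
    rw [eLpNorm_toReal_sq hf2, ← integral_indicator hK.measurableSet]
    refine integral_congr_ae (ae_of_all _ fun x => ?_)
    by_cases hx : x ∈ K
    · simp [hf, hx, hψ, hu₀, (hVΩ x (hz x hx)).1, (hVΩ x (hz x hx)).2]
    · simp [hf, hx]
  rw [← hfe, ← hGe, ← mul_pow]
  refine pow_le_pow_left₀ ENNReal.toReal_nonneg ?_ 2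
  exact eLpNorm_indicator_le_of_forall_test hψ2 hK hVo hz (by positivity) fun φ hφ hφc hφV =>
    h₀.abs_integral_translate_sub_mul_le hu2 hG2 hφ hφc hφV

end Translation

end Weak

end SphericalNeumann

namespace SphericalNeumann

/-! ### Compactness estimates in Euclidean space -/

section Compactness

variable {E : Type*} [NormedAddCommGroup E] [InnerProductSpace ℝ E] [FiniteDimensional ℝ E]
  [MeasurableSpace E] [BorelSpace E]

/-- A square integrable function with square integrable weak gradient in `Ω`, both extended to the
whole space. -/
structure IsSobolevPair (Ω : Set E) (u : E → ℝ) (G : E → E) : Prop where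
  measurable : Measurable u
  memLp : MemLp u 2
  memLp_grad : MemLp G 2
  weak : HasWeakGradient Ω u G

variable {Ω K : Set E} {u : E → ℝ} {G : E → E} {x : E}

theorem IsSobolevPair.memLp_translate (h : IsSobolevPair Ω u G) (z : E) :
    MemLp (fun x => u (x + z)) 2 :=
  h.memLp.comp_measurePreserving (measurePreserving_add_right volume z)

theorem IsSobolevPair.integrable_translate_sub_sq (h : IsSobolevPair Ω u G) (z : E) :
    Integrable (fun x => (u (x + z) - u x) ^ 2) :=
  ((h.memLp_translate z).sub h.memLp).integrable_sq

theorem IsSobolevPair.integral_translate_sub_sq_le_of_isCompact (h : IsSobolevPair Ω u G)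
    (hΩ : IsOpen Ω) (hK : IsCompact K) {z : E} (hz : ∀ x ∈ K, ∀ s ∈ Icc (0 : ℝ) 1, x + s • z ∈ Ω) :
    ∫ x in K, (u (x + z) - u x) ^ 2 ≤ ‖z‖ ^ 2 * ∫ x, ‖G x‖ ^ 2 := by
  refine (h.weak.integral_translate_sub_sq_le hΩ (h.memLp.restrict _) (h.memLp_grad.restrict _)
    hK hz).trans ?_
  refine mul_le_mul_of_nonneg_left ?_ (sq_nonneg _)
  refine setIntegral_le_integral ?_ (ae_of_all _ fun x => sq_nonneg ‖G x‖)
  exact h.memLp_grad.integrable_norm_pow (by norm_num)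

/-- The open set is exhausted by compact ones. The boundary collars, to which the estimate is
applied below, are open and not compact. -/
theorem IsSobolevPair.integral_translate_sub_sq_le_of_isOpen (h : IsSobolevPair Ω u G)
    (hΩ : IsOpen Ω) {V : Set E} (hV : IsOpen V) {z : E}
    (hz : ∀ x ∈ V, ∀ s ∈ Icc (0 : ℝ) 1, x + s • z ∈ Ω) :
    ∫ x in V, (u (x + z) - u x) ^ 2 ≤ ‖z‖ ^ 2 * ∫ x, ‖G x‖ ^ 2 := by
  obtain ⟨F, hFc, hFV, hFU, hFm⟩ := hV.exists_iUnion_isClosed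
  let L : ℕ → Set E := fun n => F n ∩ Metric.closedBall 0 n
  have hLc : ∀ n, IsCompact (L n) := fun n =>
    (isCompact_closedBall (0 : E) n).inter_left (hFc n)
  have hLm : Monotone L := fun m n hmn =>
    inter_subset_inter (hFm hmn) (Metric.closedBall_subset_closedBall (by exact_mod_cast hmn))
  have hLU : ⋃ n, L n = V := by
    refine Subset.antisymm (iUnion_subset fun n => inter_subset_left.trans (hFV n)) ?_
    intro x hx
    rw [← hFU] at hx
    obtain ⟨n, hn⟩ := mem_iUnion.1 hx
    obtain ⟨m, hm⟩ := exists_nat_ge ‖x‖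
    refine mem_iUnion.2 ⟨max n m, hFm (le_max_left _ _) hn, ?_⟩
    rw [mem_closedBall_zero_iff]
    exact hm.trans (by exact_mod_cast le_max_right _ _)
  have ht := tendsto_setIntegral_of_monotone (μ := volume) (fun n => (hLc n).measurableSet) hLm
    ((h.integrable_translate_sub_sq z).integrableOn (s := ⋃ n, L n))
  rw [hLU] at ht
  refine le_of_tendsto' ht fun n => ?_
  exact h.integral_translate_sub_sq_le_of_isCompact hΩ (hLc n) fun x hx =>
    hz x (hLU ▸ mem_iUnion.2 ⟨n, hx⟩)

theorem segment_mem_of_closedBall_subset {x z : E} {s : ℝ} (hx : Metric.closedBall x s ⊆ Ω)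
    (hz : ‖z‖ ≤ s) {t : ℝ} (ht : t ∈ Icc (0 : ℝ) 1) : x + t • z ∈ Ω := by
  apply hx
  rw [Metric.mem_closedBall, dist_self_add_left, norm_smul, Real.norm_eq_abs, abs_of_nonneg ht.1]
  exact (mul_le_of_le_one_left (norm_nonneg _) ht.2).trans hz

theorem IsSobolevPair.integrable_prod_translate (h : IsSobolevPair Ω u G) (hΩ : IsOpen Ω)
    (hK : IsCompact K) {s : ℝ} (hs : ∀ x ∈ K, Metric.closedBall x s ⊆ Ω) :
    Integrable (fun q : E × E => (u (q.1 + q.2) - u q.1) ^ 2)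
      ((volume.restrict K).prod (volume.restrict (Metric.closedBall (0 : E) s))) := by
  have hm : Measurable fun q : E × E => (u (q.1 + q.2) - u q.1) ^ 2 :=
    ((h.measurable.comp (measurable_fst.add measurable_snd)).sub
      (h.measurable.comp measurable_fst)).pow_const 2
  refine (integrable_prod_iff' hm.aestronglyMeasurable).2
    ⟨ae_of_all _ fun z => (h.integrable_translate_sub_sq z).integrableOn, ?_⟩
  have hfin : IsFiniteMeasure (volume.restrict (Metric.closedBall (0 : E) s)) :=
    ⟨by simpa using (isCompact_closedBall (0 : E) s).measure_lt_top⟩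
  refine Integrable.of_bound (C := s ^ 2 * ∫ x, ‖G x‖ ^ 2)
    hm.aestronglyMeasurable.norm.prod_swap.integral_prod_right' ?_
  filter_upwards [ae_restrict_mem Metric.isClosed_closedBall.measurableSet] with z hz
  rw [mem_closedBall_zero_iff] at hz
  have h1 := h.integral_translate_sub_sq_le_of_isCompact hΩ hK (z := z)
    fun x hx t ht => segment_mem_of_closedBall_subset (hs x hx) hz ht
  rw [Real.norm_eq_abs, abs_of_nonneg (integral_nonneg fun x => norm_nonneg _)]
  simp only [Real.norm_eq_abs, abs_pow, sq_abs]
  refine h1.trans ?_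
  have : 0 ≤ ∫ x, ‖G x‖ ^ 2 := integral_nonneg fun x => by positivity
  gcongr

theorem IsSobolevPair.integral_integral_translate_le (h : IsSobolevPair Ω u G) (hΩ : IsOpen Ω)
    (hK : IsCompact K) {s : ℝ} (hs : ∀ x ∈ K, Metric.closedBall x s ⊆ Ω) :
    ∫ x in K, ∫ z in Metric.closedBall (0 : E) s, (u (x + z) - u x) ^ 2 ≤
      volume.real (Metric.closedBall (0 : E) s) * (s ^ 2 * ∫ x, ‖G x‖ ^ 2) := by
  have hp := h.integrable_prod_translate hΩ hK hs
  rw [integral_integral_swap hp]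
  have : 0 ≤ ∫ x, ‖G x‖ ^ 2 := integral_nonneg fun x => by positivity
  calc _ ≤ ∫ z in Metric.closedBall (0 : E) s, s ^ 2 * ∫ x, ‖G x‖ ^ 2 := by
        refine setIntegral_mono_on hp.swap.integral_prod_left
          (integrableOn_const (isCompact_closedBall (0 : E) s).measure_ne_top)
          Metric.isClosed_closedBall.measurableSet fun z hz => ?_
        rw [mem_closedBall_zero_iff] at hz
        refine (h.integral_translate_sub_sq_le_of_isCompact hΩ hK (z := z)
          fun x hx t ht => segment_mem_of_closedBall_subset (hs x hx) hz ht).trans ?_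
        gcongr
    _ = _ := by rw [setIntegral_const, smul_eq_mul]

/-- Pointwise bound of `u` by an average over a ball and the local oscillation. -/
theorem IsSobolevPair.sq_le_average_add (h : IsSobolevPair Ω u G) {s : ℝ} (hs : 0 < s) {x y : E}
    (hxy : x ∈ Metric.ball y (s / 2)) :
    u x ^ 2 ≤ 2 / volume.real (Metric.ball (0 : E) (s / 2)) *
        (∫ z in Metric.closedBall (0 : E) s, (u (x + z) - u x) ^ 2) +
      2 / volume.real (Metric.ball (0 : E) (s / 2)) ^ 2 *
        (∫ w in Metric.ball y (s / 2), u w) ^ 2 := by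
  set B := Metric.ball y (s / 2)
  have hBm : MeasurableSet B := measurableSet_ball
  have hBfin : volume B ≠ ⊤ := measure_ball_lt_top.ne
  have : IsFiniteMeasure (volume.restrict B) := ⟨by simpa using measure_ball_lt_top⟩
  have : IsFiniteMeasure (volume.restrict (Metric.closedBall x s)) :=
    ⟨by simpa using (isCompact_closedBall x s).measure_lt_top⟩
  have hV : volume.real (Metric.ball (0 : E) (s / 2)) = volume.real B := by
    rw [measureReal_def, measureReal_def, ← Measure.addHaar_ball_center volume y]
  have hVpos : 0 < volume.real B :=
    ENNReal.toReal_pos (Metric.measure_ball_pos volume y (by positivity)).ne' hBfin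
  rw [hV]
  set V := volume.real B
  have huB : MemLp u 2 (volume.restrict B) := h.memLp.restrict B
  have hdB : MemLp (fun w => u w - u x) 2 (volume.restrict B) := huB.sub (memLp_const _)
  have e1 : ∫ w in B, (u w - u x) = (∫ w in B, u w) - V * u x := by
    rw [integral_sub (huB.integrable (by norm_num)) (integrable_const _), setIntegral_const,
      smul_eq_mul]
  have e2 : (∫ w in B, (u w - u x)) ^ 2 ≤ V * ∫ w in B, (u w - u x) ^ 2 := by
    have := sq_integral_mul_le (memLp_const (1 : ℝ)) hdB
    simpa [V] using this
  have e3 : ∫ w in B, (u w - u x) ^ 2 ≤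
      ∫ z in Metric.closedBall (0 : E) s, (u (x + z) - u x) ^ 2 := by
    -- Radius s/2 about y fits into radius s about every x within s/2 of y; hence one finite family
    -- of balls serves all points of K.
    have hsub : B ⊆ Metric.closedBall x s := by
      intro w hw
      rw [Metric.mem_ball] at hxy hw
      rw [Metric.mem_closedBall]
      linarith [dist_triangle_right w x y]
    have hint : IntegrableOn (fun w => (u w - u x) ^ 2) (Metric.closedBall x s) :=
      ((h.memLp.restrict _).sub (memLp_const _)).integrable_sq
    refine (setIntegral_mono_set hint (ae_of_all _ fun w => by positivity)
      (LE.le.eventuallyLE hsub)).trans (le_of_eq ?_)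
    have hpre : (fun z => x + z) ⁻¹' Metric.closedBall x s = Metric.closedBall (0 : E) s := by
      ext z
      simp
    rw [← hpre]
    exact ((measurePreserving_add_left volume x).setIntegral_preimage_emb
      (measurableEmbedding_addLeft x) (fun w => (u w - u x) ^ 2) _).symm
  set I := ∫ z in Metric.closedBall (0 : E) s, (u (x + z) - u x) ^ 2
  set M := ∫ w in B, u w
  rw [e1] at e2
  have e4 : (M - V * u x) ^ 2 ≤ V * I := e2.trans (by gcongr)
  -- The hinted square is (V u(x) - 2M)², which is exactly the difference between 2(M - V u(x))² +
  -- 2M² and V² u(x)².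
  have e5 : V ^ 2 * u x ^ 2 ≤ 2 * V * I + 2 * M ^ 2 := by nlinarith [sq_nonneg (M + (V * u x - M) - 2 * M)]
  have e6 : 2 / V * I + 2 / V ^ 2 * M ^ 2 = (2 * V * I + 2 * M ^ 2) / V ^ 2 := by
    field_simp
  rw [e6, le_div_iff₀ (by positivity)]
  linarith

/-- The interior compactness estimate. -/
theorem exists_interior_estimate (hΩ : IsOpen Ω) (hK : IsCompact K) (hKΩ : K ⊆ Ω) {ε : ℝ}
    (hε : 0 < ε) :
    ∃ (t : Finset E) (r c : ℝ), 0 ≤ c ∧ ∀ (u : E → ℝ) (G : E → E), IsSobolevPair Ω u G →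
      ∫ x in K, u x ^ 2 ≤ ε * (∫ x, ‖G x‖ ^ 2) + c * ∑ y ∈ t, (∫ w in Metric.ball y r, u w) ^ 2 := by
  obtain ⟨δ, hδ, hδK⟩ := hK.exists_cthickening_subset_open hΩ hKΩ
  set N := Module.finrank ℝ E
  -- One factor 2 comes from the pointwise bound by oscillation and average, and 2^N is the volume
  -- ratio of balls of radii s and s/2.
  set A : ℝ := 2 * 2 ^ N with hA
  obtain ⟨s, hs, hsδ, hsε⟩ : ∃ s : ℝ, 0 < s ∧ s ≤ δ ∧ A * s ^ 2 ≤ ε := by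
    have hA0 : 0 < A := by positivity
    refine ⟨min δ (√(ε / A)), by positivity, min_le_left _ _, ?_⟩
    have : (min δ (√(ε / A))) ^ 2 ≤ ε / A := by
      calc _ ≤ (√(ε / A)) ^ 2 := by gcongr; exact min_le_right _ _
        _ = _ := Real.sq_sqrt (by positivity)
    calc _ ≤ A * (ε / A) := by gcongr
      _ = ε := by field_simp
  have hsK : ∀ x ∈ K, Metric.closedBall x s ⊆ Ω := fun x hx =>
    ((Metric.closedBall_subset_closedBall hsδ).trans
      (Metric.closedBall_subset_cthickening hx δ)).trans hδK
  obtain ⟨t, -, htK⟩ := hK.elim_nhds_subcover (fun y => Metric.ball y (s / 2))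
    fun y _ => Metric.ball_mem_nhds y (by positivity)
  set V := volume.real (Metric.ball (0 : E) (s / 2))
  have hVpos : 0 < V :=
    ENNReal.toReal_pos (Metric.measure_ball_pos volume 0 (by positivity)).ne' measure_ball_lt_top.ne
  have hball : volume.real (Metric.closedBall (0 : E) s) = 2 ^ N * V := by
    have h1 : volume.real (Metric.closedBall (0 : E) s) =
        s ^ N * volume.real (Metric.ball (0 : E) 1) :=
      Measure.addHaar_real_closedBall volume 0 hs.le
    have h2 : V = (s / 2) ^ N * volume.real (Metric.ball (0 : E) 1) := by
      simp only [V, measureReal_def, Measure.addHaar_ball_of_pos volume (0 : E) (half_pos hs),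
        ENNReal.toReal_mul]
      rw [ENNReal.toReal_ofReal (by positivity)]
    rw [h1, h2, div_pow]
    field_simp
  refine ⟨t, s / 2, volume.real K * (2 / V ^ 2), by positivity, fun u G h => ?_⟩
  have hfinK : IsFiniteMeasure (volume.restrict K) := ⟨by simpa using hK.measure_lt_top⟩
  have hp := h.integrable_prod_translate hΩ hK hsK
  set S := ∑ y ∈ t, (∫ w in Metric.ball y (s / 2), u w) ^ 2
  have hpt : ∀ x ∈ K, u x ^ 2 ≤ 2 / V *
      (∫ z in Metric.closedBall (0 : E) s, (u (x + z) - u x) ^ 2) + 2 / V ^ 2 * S := by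
    intro x hx
    obtain ⟨y, hy, hxy⟩ := mem_iUnion₂.1 (htK hx)
    refine (h.sq_le_average_add hs hxy).trans ?_
    gcongr
    exact Finset.single_le_sum (f := fun y => (∫ w in Metric.ball y (s / 2), u w) ^ 2)
      (fun i _ => sq_nonneg _) hy
  calc ∫ x in K, u x ^ 2
      ≤ ∫ x in K, (2 / V * (∫ z in Metric.closedBall (0 : E) s, (u (x + z) - u x) ^ 2)
          + 2 / V ^ 2 * S) := by
        refine setIntegral_mono_on h.memLp.integrable_sq.integrableOn ?_ hK.measurableSet hpt
        exact (hp.integral_prod_left.const_mul _).add (integrable_const _)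
    _ = 2 / V * (∫ x in K, ∫ z in Metric.closedBall (0 : E) s, (u (x + z) - u x) ^ 2)
          + volume.real K * (2 / V ^ 2) * S := by
        rw [integral_add (hp.integral_prod_left.const_mul _) (integrable_const _),
          integral_const_mul, setIntegral_const, smul_eq_mul, mul_assoc]
    _ ≤ 2 / V * (2 ^ N * V * (s ^ 2 * ∫ x, ‖G x‖ ^ 2)) + volume.real K * (2 / V ^ 2) * S := by
        gcongr
        rw [← hball]
        exact h.integral_integral_translate_le hΩ hK hsK
    _ = A * s ^ 2 * (∫ x, ‖G x‖ ^ 2) + volume.real K * (2 / V ^ 2) * S := by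
        rw [hA]
        field_simp
    _ ≤ _ := by
        have : 0 ≤ ∫ x, ‖G x‖ ^ 2 := integral_nonneg fun x => by positivity
        gcongr

/-- Near `x` the set `Ω` is the sublevel set of a `C¹` function with nonzero differential. -/
def IsRegularBoundaryPoint (Ω : Set E) (x : E) : Prop :=
  ∃ (U : Set E) (f : E → ℝ) (v : E), IsOpen U ∧ x ∈ U ∧ ContDiffOn ℝ 1 f U ∧ fderiv ℝ f x v ≠ 0 ∧
    ∀ y ∈ U, y ∈ Ω ↔ f y < 0

/-- After a choice of sign the directional derivative along v is bounded below near x, so by the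
mean value inequality f grows at rate at least c along v: `-v` points into Ω uniformly. -/
theorem IsRegularBoundaryPoint.exists_ball (h : IsRegularBoundaryPoint Ω x) :
    ∃ (r c : ℝ) (f : E → ℝ) (v : E), 0 < r ∧ 0 < c ∧ ContinuousOn f (Metric.ball x (2 * r)) ∧
      (∀ y ∈ Metric.ball x (2 * r), y ∈ Ω ↔ f y < 0) ∧
      ∀ y ∈ Metric.ball x (2 * r), ∀ t : ℝ, 0 ≤ t → y + t • v ∈ Metric.ball x (2 * r) →
        f y + c * t ≤ f (y + t • v) := by
  obtain ⟨U, f, v₀, hU, hxU, hf, hv₀, hΩ⟩ := h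
  obtain ⟨v, hv⟩ : ∃ v, 0 < fderiv ℝ f x v := by
    rcases lt_or_gt_of_ne hv₀ with h | h
    · exact ⟨-v₀, by simpa using h⟩
    · exact ⟨v₀, h⟩
  have hcont : ContinuousOn (fun y => fderiv ℝ f y v) U :=
    (hf.continuousOn_fderiv_of_isOpen hU le_rfl).clm_apply continuousOn_const
  have hnear : ∀ᶠ y in 𝓝 x, y ∈ U ∧ fderiv ℝ f x v / 2 < fderiv ℝ f y v :=
    (hU.eventually_mem hxU).and ((hcont.continuousAt (hU.mem_nhds hxU)).eventually
      (lt_mem_nhds (by linarith)))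
  obtain ⟨R, hR, hRsub⟩ := Metric.eventually_nhds_iff_ball.1 hnear
  refine ⟨R / 2, fderiv ℝ f x v / 2, f, v, by positivity, by positivity, ?_, ?_, ?_⟩
  all_goals rw [mul_div_cancel₀ R two_ne_zero]
  · exact hf.continuousOn.mono fun y hy => (hRsub y hy).1
  · exact fun y hy => hΩ y (hRsub y hy).1
  intro y hy t ht hyt
  have hseg : ∀ s ∈ Icc (0 : ℝ) t, y + s • v ∈ Metric.ball x R := by
    intro s hs
    rcases ht.eq_or_lt with rfl | ht'
    · have : s = 0 := le_antisymm hs.2 hs.1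
      simpa [this] using hy
    have hc := (convex_ball x R).add_smul_sub_mem hy hyt (t := s / t)
      ⟨div_nonneg hs.1 ht, div_le_one_of_le₀ hs.2 ht⟩
    rwa [add_sub_cancel_left, smul_smul, div_mul_cancel₀ _ ht'.ne'] at hc
  have hd : ∀ s ∈ Icc (0 : ℝ) t,
      HasDerivAt (fun s : ℝ => f (y + s • v)) (fderiv ℝ f (y + s • v) v) s := by
    intro s hs
    have h1 : DifferentiableAt ℝ f (y + s • v) :=
      (hf.differentiableOn one_ne_zero).differentiableAt (hU.mem_nhds (hRsub _ (hseg s hs)).1)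
    have h2 : HasDerivAt (fun s : ℝ => y + s • v) v s := by
      simpa using ((hasDerivAt_id s).smul_const v).const_add y
    exact h1.hasFDerivAt.comp_hasDerivAt s h2
  have := (convex_Icc (0 : ℝ) t).mul_sub_le_image_sub_of_le_deriv
    (f := fun s : ℝ => f (y + s • v)) (C := fderiv ℝ f x v / 2)
    (fun s hs => (hd s hs).continuousAt.continuousWithinAt)
    (fun s hs => (hd s (interior_subset hs)).differentiableAt.differentiableWithinAt)
    (fun s hs => by
      rw [(hd s (interior_subset hs)).deriv]
      exact (hRsub _ (hseg s (interior_subset hs))).2.le)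
    0 ⟨le_rfl, ht⟩ t ⟨ht, le_rfl⟩ ht
  simp only [sub_zero, zero_smul, add_zero] at this
  linarith

/-- Near a regular boundary point, functions with square integrable weak gradient do not
concentrate at the boundary. -/
theorem IsRegularBoundaryPoint.exists_collar (hx : IsRegularBoundaryPoint Ω x) (hΩ : IsOpen Ω) :
    ∃ W ∈ 𝓝 x, ∀ ε : ℝ, 0 < ε → ∃ O : Set E, IsOpen O ∧ W ∩ frontier Ω ⊆ O ∧
      ∀ (u : E → ℝ) (G : E → E), IsSobolevPair Ω u G →
        ∫ y in O ∩ Ω, u y ^ 2 ≤ ε * ((∫ y, u y ^ 2) + ∫ y, ‖G y‖ ^ 2) := by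
  obtain ⟨r, c, f, v, hr, hc, hfc, hfΩ, hfv⟩ := hx.exists_ball
  refine ⟨Metric.ball x r, Metric.ball_mem_nhds x hr, fun ε hε => ?_⟩
  -- Shifts by at most τ along v stay in the ball where f is controlled, and their translation error
  -- is absorbed by ε.
  obtain ⟨τ, hτ, hτr, hτε⟩ : ∃ τ : ℝ, 0 < τ ∧ τ * ‖v‖ ≤ r ∧ 2 * (τ * ‖v‖) ^ 2 ≤ ε := by
    have h0 : Tendsto (fun τ : ℝ => τ * ‖v‖) (𝓝[>] 0) (𝓝 0) := by
      refine Tendsto.mono_left ?_ nhdsWithin_le_nhds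
      exact Continuous.tendsto' (by fun_prop) _ _ (by simp)
    have h1 : Tendsto (fun τ : ℝ => 2 * (τ * ‖v‖) ^ 2) (𝓝[>] 0) (𝓝 0) := by
      refine Tendsto.mono_left ?_ nhdsWithin_le_nhds
      exact Continuous.tendsto' (by fun_prop) _ _ (by simp)
    obtain ⟨τ, h⟩ := ((eventually_mem_nhdsWithin (a := (0 : ℝ)) (s := Ioi 0)).and
      ((h0.eventually (ge_mem_nhds hr)).and (h1.eventually (ge_mem_nhds hε)))).exists
    exact ⟨τ, h.1, h.2.1, h.2.2⟩
  -- Chosen so that (δ / c) / τ = ε / 2, the fraction of shifts for which a given point can land in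
  -- the collar.
  set δ : ℝ := ε * c * τ / 2 with hδ
  have hδ0 : 0 < δ := by positivity
  have hr2 : Metric.ball x r ⊆ Metric.ball x (2 * r) := Metric.ball_subset_ball (by linarith)
  set O : Set E := Metric.ball x r ∩ f ⁻¹' Ioi (-δ) with hO
  have hOo : IsOpen O := (hfc.mono hr2).isOpen_inter_preimage Metric.isOpen_ball isOpen_Ioi
  refine ⟨O, hOo, ?_, fun u G h => ?_⟩
  · rintro y ⟨hy, hyf⟩
    refine ⟨hy, ?_⟩
    have : y ∉ Ω := fun hyΩ => by
      rw [hΩ.frontier_eq] at hyf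
      exact hyf.2 hyΩ
    rw [hfΩ y (hr2 hy), not_lt] at this
    exact lt_of_lt_of_le (by linarith) this
  set A := O ∩ Ω with hA
  have hAo : IsOpen A := hOo.inter hΩ
  set g : E → ℝ := fun y => u y ^ 2 with hg
  have hgm : Measurable g := h.measurable.pow_const 2
  have hgi : Integrable g := h.memLp.integrable_sq
  have hGn : 0 ≤ ∫ y, ‖G y‖ ^ 2 := integral_nonneg fun y => by positivity
  have hun : 0 ≤ ∫ y, g y := integral_nonneg fun y => sq_nonneg _
  -- Moving against v lowers f, so points of the collar stay in Ω.
  have hin : ∀ y ∈ A, ∀ t : ℝ, 0 ≤ t → t ≤ τ → y - t • v ∈ Ω := by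
    intro y hy t ht htτ
    have h1 : y ∈ Metric.ball x r := hy.1.1
    have h2 : y - t • v ∈ Metric.ball x (2 * r) := by
      rw [Metric.mem_ball, dist_eq_norm] at h1 ⊢
      have : ‖t • v‖ ≤ r := by
        rw [norm_smul, Real.norm_eq_abs, abs_of_nonneg ht]
        exact (mul_le_mul_of_nonneg_right htτ (norm_nonneg _)).trans hτr
      calc ‖y - t • v - x‖ = ‖(y - x) - t • v‖ := by congr 1; abel
        _ ≤ ‖y - x‖ + ‖t • v‖ := norm_sub_le _ _
        _ < 2 * r := by linarith
    rw [hfΩ _ h2]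
    have h3 := hfv _ h2 t ht (by simpa using hr2 h1)
    rw [sub_add_cancel] at h3
    have h4 := (hfΩ y (hr2 h1)).1 hy.2
    have h5 : 0 ≤ c * t := by positivity
    linarith
  -- On A the function f takes values in (-δ, 0) and grows at rate c along v, so a line parallel to
  -- v spends parameter length at most δ / c in A.
  have hmeasT : ∀ y, volume {t : ℝ | t ∈ Icc 0 τ ∧ y + t • v ∈ A} ≤ ENNReal.ofReal (δ / c) := by
    intro y
    refine (Real.volume_le_diam _).trans ?_
    refine Metric.ediam_le_of_forall_dist_le ?_
    have aux : ∀ t₁ ∈ {t : ℝ | t ∈ Icc 0 τ ∧ y + t • v ∈ A},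
        ∀ t₂ ∈ {t : ℝ | t ∈ Icc 0 τ ∧ y + t • v ∈ A}, t₁ ≤ t₂ → t₂ - t₁ ≤ δ / c := by
      rintro t₁ ⟨-, h1⟩ t₂ ⟨-, h2⟩ h12
      have e : y + t₁ • v + (t₂ - t₁) • v = y + t₂ • v := by
        rw [sub_smul]
        abel
      have h3 := hfv _ (hr2 h1.1.1) (t₂ - t₁) (by linarith) (by
        rw [e]
        exact hr2 h2.1.1)
      rw [e] at h3
      have h4 := (hfΩ _ (hr2 h2.1.1)).1 h2.2
      have h5 : -δ < f (y + t₁ • v) := h1.1.2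
      rw [le_div_iff₀ hc]
      linarith
    intro t₁ h1 t₂ h2
    rw [Real.dist_eq]
    rcases le_total t₁ t₂ with h12 | h12
    · rw [abs_sub_comm, abs_of_nonneg (by linarith)]
      exact aux t₁ h1 t₂ h2 h12
    · rw [abs_of_nonneg (by linarith)]
      exact aux t₂ h2 t₁ h1 h12
  -- For every single shift, the mass in the collar is at most the translation error plus twice the
  -- mass of the shifted collar.
  have hstep : ∀ t ∈ Icc (0 : ℝ) τ,
      ∫ y in A, g y ≤ ε * (∫ y, ‖G y‖ ^ 2) + 2 * ∫ y in A, g (y - t • v) := by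
    intro t ht
    have hz := h.integral_translate_sub_sq_le_of_isOpen hΩ hAo (z := -(t • v)) (by
      intro y hy s hs
      have := hin y hy (s * t) (mul_nonneg hs.1 ht.1)
        ((mul_le_of_le_one_left ht.1 hs.2).trans ht.2)
      rwa [smul_neg, smul_smul, ← sub_eq_add_neg])
    have hzn : ‖-(t • v)‖ ^ 2 ≤ (τ * ‖v‖) ^ 2 := by
      rw [norm_neg, norm_smul, Real.norm_eq_abs, abs_of_nonneg ht.1]
      have := ht.1
      have := ht.2
      gcongr
    have i1 : Integrable fun y => (u (y + -(t • v)) - u y) ^ 2 := h.integrable_translate_sub_sq _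
    have i2 : Integrable fun y => g (y - t • v) := hgi.comp_sub_right _
    calc ∫ y in A, g y
        ≤ ∫ y in A, (2 * (u (y + -(t • v)) - u y) ^ 2 + 2 * g (y - t • v)) := by
          refine integral_mono hgi.integrableOn
            ((i1.const_mul 2).add (i2.const_mul 2)).integrableOn fun y => ?_
          simp only [hg, ← sub_eq_add_neg]
          nlinarith [sq_nonneg ((u (y - t • v) - u y) + u (y - t • v))]
      _ = 2 * (∫ y in A, (u (y + -(t • v)) - u y) ^ 2) + 2 * ∫ y in A, g (y - t • v) := by
          rw [integral_add (i1.const_mul 2).integrableOn (i2.const_mul 2).integrableOn,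
            integral_const_mul, integral_const_mul]
      _ ≤ 2 * ((τ * ‖v‖) ^ 2 * ∫ y, ‖G y‖ ^ 2) + 2 * ∫ y in A, g (y - t • v) := by
          gcongr
          exact hz.trans (by gcongr)
      _ ≤ _ := by nlinarith
  -- By Fubini, the shifted masses integrated over t count each point with the length of its line in
  -- A.
  have hlin : ∫⁻ t in Icc 0 τ, ∫⁻ y in A, ENNReal.ofReal (g (y - t • v)) ≤
      ENNReal.ofReal (δ / c * ∫ y, g y) := by
    have e1 : ∀ t : ℝ, ∫⁻ y in A, ENNReal.ofReal (g (y - t • v)) =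
        ∫⁻ y, A.indicator 1 (y + t • v) * ENNReal.ofReal (g y) := by
      intro t
      rw [← lintegral_indicator hAo.measurableSet,
        ← lintegral_sub_right_eq_self (μ := volume)
          (fun y => A.indicator (1 : E → ENNReal) (y + t • v) * ENNReal.ofReal (g y)) (t • v)]
      refine lintegral_congr fun y => ?_
      by_cases hy : y ∈ A <;> simp [hy]
    simp_rw [e1]
    have hA1 : Measurable fun q : ℝ × E => A.indicator (1 : E → ENNReal) (q.2 + q.1 • v) :=
      (measurable_one.indicator hAo.measurableSet).comp (by fun_prop)
    rw [lintegral_lintegral_swap (by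
      refine Measurable.aemeasurable (f := fun q : ℝ × E =>
        A.indicator (1 : E → ENNReal) (q.2 + q.1 • v) * ENNReal.ofReal (g q.2)) ?_
      exact hA1.mul (hgm.comp measurable_snd).ennreal_ofReal)]
    calc _ ≤ ∫⁻ y, ENNReal.ofReal (δ / c) * ENNReal.ofReal (g y) := by
          refine lintegral_mono fun y => ?_
          simp only
          rw [lintegral_mul_const _ (by
            exact hA1.comp (measurable_id.prodMk measurable_const))]
          gcongr
          refine le_trans (le_of_eq ?_) (hmeasT y)
          have hms : MeasurableSet {t : ℝ | t ∈ Icc 0 τ ∧ y + t • v ∈ A} :=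
            measurableSet_Icc.inter (hAo.measurableSet.preimage (by fun_prop))
          rw [← lintegral_indicator_one hms, ← lintegral_indicator measurableSet_Icc]
          refine lintegral_congr fun t => ?_
          by_cases h1 : t ∈ Icc 0 τ
          · by_cases h2 : y + t • v ∈ A <;> simp [h1.1, h1.2, h2, indicator]
          · rw [indicator_of_notMem h1, indicator_of_notMem fun h => h1 h.1]
      _ = _ := by
          rw [lintegral_const_mul _ hgm.ennreal_ofReal, ENNReal.ofReal_mul (by positivity),
            ofReal_integral_eq_lintegral_ofReal hgi (ae_of_all _ fun y => sq_nonneg _)]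
  -- Some shift does no worse than the average over [0, τ].
  have hmean : ∃ t ∈ Icc (0 : ℝ) τ, ∫ y in A, g (y - t • v) ≤ ε / 2 * ∫ y, g y := by
    have hm : Measurable fun t : ℝ => ∫⁻ y in A, ENNReal.ofReal (g (y - t • v)) := by
      refine Measurable.lintegral_prod_right' (f := fun q : ℝ × E =>
        ENNReal.ofReal (g (q.2 - q.1 • v))) ?_
      exact (hgm.comp (by fun_prop)).ennreal_ofReal
    have hτv : volume (Icc 0 τ) = ENNReal.ofReal τ := by simp
    obtain ⟨t, ht, hle⟩ := exists_le_setLAverage (μ := volume) (s := Icc 0 τ)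
      (by rw [hτv]; simpa using hτ) (by rw [hτv]; simp) hm.aemeasurable.restrict
    refine ⟨t, ht, ?_⟩
    rw [setLAverage_eq, hτv] at hle
    have h2 := hle.trans (ENNReal.div_le_div_right hlin _)
    rw [← ENNReal.ofReal_div_of_pos hτ, ← ofReal_integral_eq_lintegral_ofReal
      (hgi.comp_sub_right _).integrableOn (ae_of_all _ fun y => sq_nonneg _),
      ENNReal.ofReal_le_ofReal_iff (by positivity)] at h2
    refine h2.trans (le_of_eq ?_)
    rw [hδ]
    field_simp
  obtain ⟨t, ht, htm⟩ := hmean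
  have := hstep t ht
  nlinarith

/-- Compactness of the embedding of the Sobolev space into `L²`, in quantitative form. -/
theorem exists_compactness_estimate (hΩ : IsOpen Ω) (hK : IsCompact K)
    (hreg : ∀ x ∈ K ∩ frontier Ω, IsRegularBoundaryPoint Ω x) {ε : ℝ} (hε : 0 < ε) :
    ∃ (t : Finset E) (r c : ℝ), 0 ≤ c ∧ ∀ (u : E → ℝ) (G : E → E), IsSobolevPair Ω u G →
      ∫ x in K ∩ Ω, u x ^ 2 ≤ ε * ((∫ x, u x ^ 2) + ∫ x, ‖G x‖ ^ 2) +
        c * ∑ y ∈ t, (∫ w in Metric.ball y r, u w) ^ 2 := by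
  choose! W hW hWε using fun x (hx : x ∈ K ∩ frontier Ω) => (hreg x hx).exists_collar hΩ
  obtain ⟨S, hSK, hSW⟩ := (hK.inter_right isClosed_frontier).elim_nhds_subcover W hW
  -- One share of ε for each collar and one for the interior estimate.
  set ε' : ℝ := ε / (S.card + 1)
  have hε' : 0 < ε' := by positivity
  choose! O hOo hOW hO using fun x (hx : x ∈ K ∩ frontier Ω) => hWε x hx ε' hε'
  -- What the collars leave uncovered is compact and lies inside Ω.
  set K' : Set E := (K ∩ closure Ω) \ ⋃ x ∈ S, O x with hK'
  have hOU : IsOpen (⋃ x ∈ S, O x) := isOpen_biUnion fun x hx => hOo x (hSK x hx)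
  have hK'c : IsCompact K' := (hK.inter_right isClosed_closure).diff hOU
  have hK'Ω : K' ⊆ Ω := by
    rintro x ⟨⟨hxK, hxc⟩, hxO⟩
    by_contra hx
    have hxf : x ∈ frontier Ω := by
      rw [hΩ.frontier_eq]
      exact ⟨hxc, hx⟩
    obtain ⟨y, hy, hxy⟩ := mem_iUnion₂.1 (hSW ⟨hxK, hxf⟩)
    exact hxO (mem_iUnion₂.2 ⟨y, hy, hOW y (hSK y hy) ⟨hxy, hxf⟩⟩)
  obtain ⟨t, r, c, hc, hint⟩ := exists_interior_estimate hΩ hK'c hK'Ω hε'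
  refine ⟨t, r, c, hc, fun u G h => ?_⟩
  have h1 := hint u G h
  set T := ∑ y ∈ t, (∫ w in Metric.ball y r, u w) ^ 2
  set a := ∫ x, u x ^ 2
  set b := ∫ x, ‖G x‖ ^ 2
  have ha : 0 ≤ a := integral_nonneg fun y => sq_nonneg _
  have hgi : Integrable fun x => u x ^ 2 := h.memLp.integrable_sq
  have hOm : ∀ x ∈ S, MeasurableSet (O x ∩ Ω) := fun x hx =>
    ((hOo x (hSK x hx)).inter hΩ).measurableSet
  have hsum : ∫ x in K ∩ Ω, u x ^ 2 ≤ (∫ x in K', u x ^ 2) + ∑ y ∈ S, ∫ x in O y ∩ Ω, u x ^ 2 := by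
    rw [← integral_indicator (hK.measurableSet.inter hΩ.measurableSet),
      ← integral_indicator hK'c.measurableSet]
    have e : ∑ y ∈ S, ∫ x in O y ∩ Ω, u x ^ 2 =
        ∫ x, ∑ y ∈ S, (O y ∩ Ω).indicator (fun x => u x ^ 2) x := by
      rw [integral_finsetSum _ fun y hy => hgi.indicator (hOm y hy)]
      exact Finset.sum_congr rfl fun y hy => (integral_indicator (hOm y hy)).symm
    have hsi : Integrable fun x => ∑ y ∈ S, (O y ∩ Ω).indicator (fun x => u x ^ 2) x :=
      integrable_finsetSum _ fun y hy => hgi.indicator (hOm y hy)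
    rw [e, ← integral_add (hgi.indicator hK'c.measurableSet) hsi]
    refine integral_mono (hgi.indicator (hK.measurableSet.inter hΩ.measurableSet))
      ((hgi.indicator hK'c.measurableSet).add hsi) fun x => ?_
    have hn : ∀ A : Set E, 0 ≤ A.indicator (fun x => u x ^ 2) x := fun A =>
      indicator_nonneg (fun _ _ => sq_nonneg _) x
    by_cases hx : x ∈ K ∩ Ω
    · rw [indicator_of_mem hx]
      by_cases hxO : x ∈ ⋃ y ∈ S, O y
      · obtain ⟨y, hy, hxy⟩ := mem_iUnion₂.1 hxO
        have h2 := Finset.single_le_sum (f := fun y => (O y ∩ Ω).indicator (fun x => u x ^ 2) x)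
          (fun i _ => hn _) hy
        rw [indicator_of_mem (show x ∈ O y ∩ Ω from ⟨hxy, hx.2⟩)] at h2
        exact h2.trans (le_add_of_nonneg_left (hn _))
      · rw [indicator_of_mem (show x ∈ K' from ⟨⟨hx.1, subset_closure hx.2⟩, hxO⟩)]
        exact le_add_of_nonneg_right (Finset.sum_nonneg fun i _ => hn _)
    · rw [indicator_of_notMem hx]
      exact add_nonneg (hn _) (Finset.sum_nonneg fun i _ => hn _)
  have hcol : ∑ y ∈ S, ∫ x in O y ∩ Ω, u x ^ 2 ≤ S.card * (ε' * (a + b)) := by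
    rw [← nsmul_eq_mul]
    exact Finset.sum_le_card_nsmul _ _ _ fun y hy => hO y (hSK y hy) u G h
  have e : ε * (a + b) = S.card * (ε' * (a + b)) + ε' * (a + b) := by
    simp only [ε']
    field_simp
  have : 0 ≤ ε' * a := by positivity
  rw [e]
  linarith

/-- A function whose weak gradient vanishes is locally almost everywhere constant. -/
theorem IsSobolevPair.exists_ae_eq_const (h : IsSobolevPair Ω u G) (hΩ : IsOpen Ω)
    (hG : ∫ x, ‖G x‖ ^ 2 = 0) (hx : x ∈ Ω) :
    ∃ r > 0, ∃ c : ℝ, ∀ᵐ y ∂volume.restrict (Metric.ball x r), u y = c := by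
  obtain ⟨R, hR, hRΩ⟩ := Metric.isOpen_iff.1 hΩ x hx
  set r := R / 4
  have hr : 0 < r := by positivity
  have hsub : ∀ y ∈ Metric.closedBall x r, Metric.closedBall y (2 * r) ⊆ Ω := by
    intro y hy w hw
    apply hRΩ
    rw [Metric.mem_closedBall] at hy hw
    rw [Metric.mem_ball]
    have : r = R / 4 := rfl
    linarith [dist_triangle w y x]
  have hK := isCompact_closedBall x r
  have h1 := h.integral_integral_translate_le hΩ hK hsub
  have hp := h.integrable_prod_translate hΩ hK hsub
  rw [hG, mul_zero, mul_zero] at h1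
  have h2 : ∀ᵐ y ∂volume.restrict (Metric.closedBall x r),
      ∫ z in Metric.closedBall (0 : E) (2 * r), (u (y + z) - u y) ^ 2 = 0 := by
    have hn : 0 ≤ᵐ[volume.restrict (Metric.closedBall x r)] fun y =>
        ∫ z in Metric.closedBall (0 : E) (2 * r), (u (y + z) - u y) ^ 2 :=
      ae_of_all _ fun y => integral_nonneg fun z => sq_nonneg _
    exact (integral_eq_zero_iff_of_nonneg_ae hn hp.integral_prod_left).1
      (le_antisymm h1 (integral_nonneg_of_ae hn))
  have h3 := hp.prod_right_ae
  have hne : volume (Metric.closedBall x r) ≠ 0 :=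
    (Metric.measure_closedBall_pos volume x hr).ne'
  have : (ae (volume.restrict (Metric.closedBall x r))).NeBot := by
    rw [ae_neBot]
    simpa using hne
  -- The double integral of squared differences vanishes, so a single good base point y within r of
  -- x sees u equal to u(y) almost everywhere on a ball of radius 2r, which contains the ball of
  -- radius r about x.
  obtain ⟨y, ⟨hy2, hy3⟩, hyK⟩ := ((h2.and h3).and
    (ae_restrict_mem Metric.isClosed_closedBall.measurableSet)).exists
  refine ⟨r, hr, u y, ?_⟩
  have h4 := (integral_eq_zero_iff_of_nonneg_ae (ae_of_all _ fun z => sq_nonneg _) hy3).1 hy2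
  have h5 : ∀ᵐ w ∂volume.restrict (Metric.closedBall y (2 * r)), u w = u y := by
    have hmp : MeasurePreserving (fun w => w - y) (volume.restrict (Metric.closedBall y (2 * r)))
        (volume.restrict (Metric.closedBall (0 : E) (2 * r))) := by
      have hpre : (fun w => w - y) ⁻¹' Metric.closedBall (0 : E) (2 * r) =
          Metric.closedBall y (2 * r) := by
        ext w
        rw [mem_preimage, mem_closedBall_zero_iff, Metric.mem_closedBall, dist_eq_norm]
      rw [← hpre]
      exact (measurePreserving_sub_right volume y).restrict_preimage
        Metric.isClosed_closedBall.measurableSet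
    filter_upwards [hmp.quasiMeasurePreserving.ae h4] with w hw
    have hw' : (u (y + (w - y)) - u y) ^ 2 = 0 := hw
    rw [add_sub_cancel] at hw'
    exact sub_eq_zero.1 (pow_eq_zero_iff two_ne_zero |>.1 hw')
  refine ae_restrict_of_ae_restrict_of_subset ?_ h5
  intro w hw
  rw [Metric.mem_closedBall] at hyK ⊢
  rw [Metric.mem_ball] at hw
  linarith [dist_triangle_right w y x]

end Compactness

end SphericalNeumann

namespace SphericalNeumann

/-! ### Radial projection and integration in polar coordinates -/

section Polar

variable {N : ℕ} [NeZero N]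

theorem norm_coe_sph (p : Sph N) : ‖(p : Amb N)‖ = 1 := by
  simp

theorem inner_self_sph (p : Sph N) : ⟪(p : Amb N), (p : Amb N)⟫_ℝ = 1 := by
  rw [real_inner_self_eq_norm_sq, norm_coe_sph, one_pow]

theorem coe_sph_ne_zero (p : Sph N) : (p : Amb N) ≠ 0 := by
  rw [← norm_ne_zero_iff, norm_coe_sph]
  exact one_ne_zero

theorem norm_northPole : ‖northPole N‖ = 1 := by
  have hN : 0 < N := Nat.pos_of_ne_zero (NeZero.ne N)
  have : northPole N = EuclideanSpace.single (⟨N - 1, by omega⟩ : Fin N) (1 : ℝ) := by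
    ext i
    simp only [northPole, PiLp.single_apply, Fin.ext_iff]
    congr 1
    exact propext ⟨fun h => by omega, fun h => by omega⟩
  rw [this]
  simp

/-- The north pole as a point of the sphere. -/
noncomputable def poleSph (N : ℕ) [NeZero N] : Sph N :=
  ⟨northPole N, by simp [norm_northPole]⟩

open Classical in
/-- The radial projection to the unit sphere. -/
noncomputable def dir (x : Amb N) : Sph N :=
  if h : x = 0 then poleSph N else ⟨‖x‖⁻¹ • x, by simp [norm_smul, h]⟩

theorem coe_dir {x : Amb N} (hx : x ≠ 0) : (dir x : Amb N) = ‖x‖⁻¹ • x := by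
  simp [dir, hx]

theorem norm_smul_dir (x : Amb N) : ‖x‖ • (dir x : Amb N) = x := by
  rcases eq_or_ne x 0 with rfl | hx
  · simp
  · rw [coe_dir hx, smul_smul, mul_inv_cancel₀ (norm_ne_zero_iff.2 hx), one_smul]

theorem dir_smul_sph {t : ℝ} (ht : 0 < t) (p : Sph N) : dir (t • (p : Amb N)) = p := by
  have h0 : t • (p : Amb N) ≠ 0 := smul_ne_zero ht.ne' (coe_sph_ne_zero p)
  ext1
  rw [coe_dir h0, norm_smul, norm_coe_sph, mul_one, Real.norm_eq_abs, abs_of_pos ht, smul_smul,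
    inv_mul_cancel₀ ht.ne', one_smul]

theorem norm_smul_sph {t : ℝ} (ht : 0 < t) (p : Sph N) : ‖t • (p : Amb N)‖ = t := by
  rw [norm_smul, norm_coe_sph, mul_one, Real.norm_eq_abs, abs_of_pos ht]

theorem dir_coe (p : Sph N) : dir (p : Amb N) = p := by
  simpa using dir_smul_sph one_pos p

theorem dir_smul {t : ℝ} (ht : 0 < t) (x : Amb N) : dir (t • x) = dir x := by
  rcases eq_or_ne x 0 with rfl | hx
  · simp
  · conv_lhs => rw [← norm_smul_dir x, smul_smul]
    exact dir_smul_sph (mul_pos ht (norm_pos_iff.2 hx)) _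

theorem continuousAt_dir {x : Amb N} (hx : x ≠ 0) : ContinuousAt (dir : Amb N → Sph N) x := by
  rw [Topology.IsInducing.subtypeVal.continuousAt_iff]
  have h : (fun y : Amb N => ‖y‖⁻¹ • y) =ᶠ[𝓝 x] Subtype.val ∘ dir := by
    filter_upwards [isOpen_ne.mem_nhds hx] with y hy
    exact (coe_dir hy).symm
  refine ContinuousAt.congr ?_ h
  have : ‖x‖ ≠ 0 := norm_ne_zero_iff.2 hx
  fun_prop (disch := assumption)

theorem measurable_dir : Measurable (dir : Amb N → Sph N) :=
  measurable_of_continuousOn_compl_singleton 0 fun _ hx =>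
    (continuousAt_dir hx).continuousWithinAt

/-- The cone over a subset of the sphere. -/
def cone (D : Set (Sph N)) : Set (Amb N) := {x | x ≠ 0 ∧ dir x ∈ D}

theorem isOpen_cone {D : Set (Sph N)} (hD : IsOpen D) : IsOpen (cone D) := by
  rw [isOpen_iff_mem_nhds]
  rintro x ⟨hx, hxD⟩
  filter_upwards [isOpen_ne.mem_nhds hx, (continuousAt_dir hx).preimage_mem_nhds (hD.mem_nhds hxD)]
    with y h1 h2 using ⟨h1, h2⟩

theorem smul_mem_cone {D : Set (Sph N)} {p : Sph N} (hp : p ∈ D) {t : ℝ} (ht : 0 < t) :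
    t • (p : Amb N) ∈ cone D :=
  ⟨smul_ne_zero ht.ne' (coe_sph_ne_zero p), by rwa [dir_smul_sph ht]⟩

/-- The radial part of the Lebesgue measure. -/
noncomputable def radialMeasure (N : ℕ) : Measure ℝ :=
  (volume.restrict (Ioi 0)).withDensity fun t => ENNReal.ofReal (t ^ (N - 1))

instance : SFinite (radialMeasure N) := by
  unfold radialMeasure
  infer_instance

/-- Replaces a measure on the subtype of positive reals by one on ℝ, so that radial integrals are
ordinary set integrals. -/
theorem map_val_volumeIoiPow :
    (Measure.volumeIoiPow (N - 1)).map (Subtype.val : Ioi (0 : ℝ) → ℝ) = radialMeasure N := by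
  ext s hs
  rw [Measure.map_apply measurable_subtype_coe hs, Measure.volumeIoiPow,
    withDensity_apply _ (measurable_subtype_coe hs), radialMeasure, withDensity_apply _ hs,
    Measure.restrict_restrict hs, ← lintegral_indicator (measurable_subtype_coe hs),
    ← lintegral_indicator (hs.inter measurableSet_Ioi)]
  have := lintegral_subtype_comap (μ := (volume : Measure ℝ)) (measurableSet_Ioi (a := (0 : ℝ)))
    (s.indicator fun t : ℝ => ENNReal.ofReal (t ^ (N - 1)))
  rw [← lintegral_indicator measurableSet_Ioi] at this
  rw [Set.inter_comm, ← Set.indicator_indicator, ← this]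
  rfl

/-- Integration in polar coordinates. -/
theorem measurePreserving_polar :
    MeasurePreserving (fun x : Amb N => (dir x, ‖x‖)) volume
      ((surf N).prod (radialMeasure N)) := by
  have hm : Measurable fun x : Amb N => ((dir x, ‖x‖) : Sph N × ℝ) :=
    measurable_dir.prodMk measurable_norm
  refine ⟨hm, ?_⟩
  have h1 := (volume : Measure (Amb N)).measurePreserving_homeomorphUnitSphereProd
  have h2 : (volume : Measure (Amb N)) =
      ((volume : Measure (Amb N)).comap (Subtype.val : ({0}ᶜ : Set (Amb N)) → Amb N)).map
        Subtype.val := by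
    rw [map_comap_subtype_coe (measurableSet_singleton _).compl]
    exact (restrict_compl_singleton (μ := volume) (0 : Amb N)).symm
  have hdim : Module.finrank ℝ (Amb N) - 1 = N - 1 := by simp
  rw [hdim] at h1
  conv_lhs => rw [h2]
  rw [Measure.map_map hm measurable_subtype_coe, ← map_val_volumeIoiPow]
  have h3 : (fun x : Amb N => ((dir x, ‖x‖) : Sph N × ℝ)) ∘
      (Subtype.val : ({0}ᶜ : Set (Amb N)) → Amb N) =
      Prod.map id Subtype.val ∘ homeomorphUnitSphereProd (Amb N) := by
    funext x
    have hx : (x : Amb N) ≠ 0 := x.2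
    refine Prod.ext (Subtype.ext ?_) ?_
    · simp [coe_dir hx]
    · simp
  have h4 : MeasurePreserving (Subtype.val : Ioi (0 : ℝ) → ℝ) (Measure.volumeIoiPow (N - 1))
      ((Measure.volumeIoiPow (N - 1)).map (Subtype.val : Ioi (0 : ℝ) → ℝ)) :=
    ⟨measurable_subtype_coe, rfl⟩
  rw [h3]
  have : SFinite ((Measure.volumeIoiPow (N - 1)).map (Subtype.val : Ioi (0 : ℝ) → ℝ)) := by
    rw [map_val_volumeIoiPow]
    infer_instance
  exact (((MeasurePreserving.id (surf N)).prod h4).comp h1).map_eq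

theorem integral_radialMeasure {F : Type*} [NormedAddCommGroup F] [NormedSpace ℝ F] (k : ℝ → F) :
    ∫ t, k t ∂radialMeasure N = ∫ t in Ioi (0 : ℝ), t ^ (N - 1) • k t := by
  rw [radialMeasure, integral_withDensity_eq_integral_toReal_smul (by fun_prop) (by simp)]
  refine setIntegral_congr_fun measurableSet_Ioi fun t ht => ?_
  rw [ENNReal.toReal_ofReal (pow_nonneg (le_of_lt ht) _)]

theorem integrable_radialMeasure_iff {k : ℝ → ℝ} :
    Integrable k (radialMeasure N) ↔
      IntegrableOn (fun t => t ^ (N - 1) * k t) (Ioi (0 : ℝ)) := by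
  rw [radialMeasure, integrable_withDensity_iff_integrable_smul' (by fun_prop) (by simp)]
  refine integrableOn_congr_fun (fun t ht => ?_) measurableSet_Ioi
  rw [ENNReal.toReal_ofReal (pow_nonneg (le_of_lt ht) _), smul_eq_mul]

theorem quasiMeasurePreserving_dir :
    Measure.QuasiMeasurePreserving (dir : Amb N → Sph N) volume (surf N) :=
  Measure.quasiMeasurePreserving_fst.comp measurePreserving_polar.quasiMeasurePreserving

/-- A product in polar coordinates integrates to a product; identities for homogeneous functions
thus pass between sphere and cone at the cost of one radial constant. -/
theorem integral_radial_mul {k : ℝ → ℝ} {g : Sph N → ℝ} (hk : Measurable k)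
    (hg : AEStronglyMeasurable g (surf N)) :
    ∫ x : Amb N, k ‖x‖ * g (dir x) =
      (∫ t in Ioi (0 : ℝ), t ^ (N - 1) * k t) * ∫ p, g p ∂surf N := by
  have h := integral_prod_mul (μ := surf N) (ν := radialMeasure N) g k
  rw [← measurePreserving_polar.map_eq, integral_map measurePreserving_polar.aemeasurable] at h
  · simp only [integral_radialMeasure, smul_eq_mul] at h
    rw [mul_comm, ← h]
    exact integral_congr_ae (ae_of_all _ fun x => mul_comm _ _)
  · rw [measurePreserving_polar.map_eq]
    exact hg.comp_fst.mul hk.aestronglyMeasurable.comp_snd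

theorem integrable_radial_mul {k : ℝ → ℝ} {g : Sph N → ℝ}
    (hk : IntegrableOn (fun t => t ^ (N - 1) * k t) (Ioi (0 : ℝ))) (hg : Integrable g (surf N)) :
    Integrable fun x : Amb N => k ‖x‖ * g (dir x) := by
  have h := hg.mul_prod (integrable_radialMeasure_iff.2 hk)
  refine (measurePreserving_polar.integrable_comp_of_integrable h).congr ?_
  exact ae_of_all _ fun x => mul_comm _ _

theorem measurePreserving_smul_sph :
    MeasurePreserving (fun q : Sph N × ℝ => q.2 • (q.1 : Amb N))
      ((surf N).prod (radialMeasure N)) volume := by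
  have hm : Measurable fun q : Sph N × ℝ => q.2 • (q.1 : Amb N) := by fun_prop
  refine ⟨hm, ?_⟩
  rw [← measurePreserving_polar.map_eq, Measure.map_map hm measurePreserving_polar.measurable]
  have : (fun q : Sph N × ℝ => q.2 • (q.1 : Amb N)) ∘ (fun x : Amb N => (dir x, ‖x‖)) = id := by
    funext x
    exact norm_smul_dir x
  rw [this, Measure.map_id]

theorem integral_polar {F : Type*} [NormedAddCommGroup F] [NormedSpace ℝ F] {f : Amb N → F}
    (hf : Integrable f) :
    ∫ x, f x = ∫ p, (∫ t in Ioi (0 : ℝ), t ^ (N - 1) • f (t • (p : Amb N))) ∂surf N := by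
  have h := measurePreserving_smul_sph.integrable_comp_of_integrable hf
  simp_rw [← integral_radialMeasure (N := N)]
  have h2 := integral_prod _ h
  simp only [Function.comp_apply] at h2
  rw [← h2, ← integral_map measurePreserving_smul_sph.aemeasurable, measurePreserving_smul_sph.map_eq]
  rw [measurePreserving_smul_sph.map_eq]
  exact hf.1

end Polar

/-! ### Divergence -/

section Divergence

variable {E : Type*} [NormedAddCommGroup E] [InnerProductSpace ℝ E] [FiniteDimensional ℝ E]

theorem trace_smulRight (ℓ : E →L[ℝ] ℝ) (a : E) :
    LinearMap.trace ℝ E ((ℓ.smulRight a : E →L[ℝ] E) : E →ₗ[ℝ] E) = ℓ a := by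
  have h := LinearMap.trace_eq_sum_inner ((ℓ.smulRight a : E →L[ℝ] E) : E →ₗ[ℝ] E)
    (stdOrthonormalBasis ℝ E)
  rw [h]
  conv_rhs => rw [← (stdOrthonormalBasis ℝ E).sum_repr' a]
  simp [inner_smul_right, mul_comm]

variable [MeasurableSpace E] [BorelSpace E]

theorem integrable_mul_of_locallyIntegrableOn {F : Type*} [NormedAddCommGroup F] [NormedSpace ℝ F]
    {Ω : Set E} {u : E → F} (hu : LocallyIntegrableOn u Ω) {g : E → ℝ} (hg : Continuous g)
    (hc : HasCompactSupport g) (hs : tsupport g ⊆ Ω) : Integrable fun x => g x • u x := by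
  have h1 : IntegrableOn u (tsupport g) := hu.integrableOn_compact_subset hs hc.isCompact
  have h2 : IntegrableOn (fun x => g x • u x) (tsupport g) :=
    h1.continuousOn_smul hg.continuousOn hc.isCompact
  rw [integrableOn_iff_integrable_of_support_subset] at h2
  · exact h2
  · intro x hx
    apply subset_tsupport
    intro h0
    simp [h0] at hx

/-- The scalar identities for the coordinates of X in an orthonormal basis are summed. Local
integrability is the right hypothesis because homogeneous extensions to an infinite cone are not
globally integrable. -/
theorem HasWeakGradient.integral_mul_trace {Ω : Set E} {u : E → ℝ} {G X : E → E}
    (h : HasWeakGradient Ω u G) (hu : LocallyIntegrableOn u Ω) (hG : LocallyIntegrableOn G Ω)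
    (hX : ContDiff ℝ ∞ X) (hc : HasCompactSupport X) (hs : tsupport X ⊆ Ω) :
    ∫ x, u x * LinearMap.trace ℝ E (fderiv ℝ X x : E →ₗ[ℝ] E) = - ∫ x, ⟪G x, X x⟫_ℝ := by
  set b := stdOrthonormalBasis ℝ E
  set φ : Fin (Module.finrank ℝ E) → E → ℝ := fun i x => ⟪b i, X x⟫_ℝ
  have hφ : ∀ i, ContDiff ℝ ∞ (φ i) := fun i => contDiff_const.inner ℝ hX
  have hφs : ∀ i, Function.support (φ i) ⊆ Function.support X := by
    intro i x hx h0
    exact hx (by simp [φ, h0])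
  have hφt : ∀ i, tsupport (φ i) ⊆ tsupport X := fun i => closure_mono (hφs i)
  have hφc : ∀ i, HasCompactSupport (φ i) := fun i => hc.mono (hφs i)
  have hd : ∀ i x, fderiv ℝ (φ i) x (b i) = ⟪b i, fderiv ℝ X x (b i)⟫_ℝ := by
    intro i x
    have := ((hasFDerivAt_const (b i) x).inner ℝ (hX.differentiable (by simp) x).hasFDerivAt).fderiv
    simp only [φ]
    rw [this]
    simp
  have e1 : ∀ x, u x * LinearMap.trace ℝ E (fderiv ℝ X x : E →ₗ[ℝ] E) =
      ∑ i, u x * fderiv ℝ (φ i) x (b i) := by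
    intro x
    rw [LinearMap.trace_eq_sum_inner _ b, Finset.mul_sum]
    refine Finset.sum_congr rfl fun i _ => ?_
    rw [hd]
    rfl
  have e2 : ∀ x, ⟪G x, X x⟫_ℝ = ∑ i, ⟪G x, b i⟫_ℝ * φ i x := by
    intro x
    rw [← b.sum_inner_mul_inner (G x) (X x)]
  have i1 : ∀ i, Integrable fun x => u x * fderiv ℝ (φ i) x (b i) := by
    intro i
    have h0 : ContDiff ℝ ∞ fun x => fderiv ℝ (φ i) x (b i) :=
      ((hφ i).fderiv_right (by simp)).clm_apply contDiff_const
    have h1 : tsupport (fun x => fderiv ℝ (φ i) x (b i)) ⊆ tsupport (φ i) :=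
      tsupport_fderiv_apply_subset ℝ (b i)
    have := integrable_mul_of_locallyIntegrableOn hu h0.continuous
      (HasCompactSupport.fderiv_apply ℝ (hφc i) (b i)) (h1.trans ((hφt i).trans hs))
    refine this.congr (ae_of_all _ fun x => ?_)
    simp [mul_comm]
  have i2 : ∀ i, Integrable fun x => ⟪G x, b i⟫_ℝ * φ i x := by
    intro i
    have := (integrable_mul_of_locallyIntegrableOn hG (hφ i).continuous (hφc i)
      ((hφt i).trans hs)).inner_const (𝕜 := ℝ) (b i)
    refine this.congr (ae_of_all _ fun x => ?_)
    simp [inner_smul_left, mul_comm]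
  simp_rw [e1, e2]
  rw [integral_finsetSum _ fun i _ => i1 i, integral_finsetSum _ fun i _ => i2 i,
    ← Finset.sum_neg_distrib]
  exact Finset.sum_congr rfl fun i _ => h _ (hφ i) (hφc i) ((hφt i).trans hs) (b i)

end Divergence

end SphericalNeumann

namespace SphericalNeumann

/-! ### Sobolev functions on the sphere and homogeneous functions on cones -/

section Cone

variable {N : ℕ} [NeZero N] {D : Set (Sph N)}

theorem integrable_radial_smul {F : Type*} [NormedAddCommGroup F] [NormedSpace ℝ F] {k : ℝ → ℝ}
    {g : Sph N → F} (hkm : Measurable k)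
    (hk : IntegrableOn (fun t => t ^ (N - 1) * k t) (Ioi (0 : ℝ))) (hg : Integrable g (surf N)) :
    Integrable fun x : Amb N => k ‖x‖ • g (dir x) := by
  have hm : AEStronglyMeasurable (fun x : Amb N => k ‖x‖ • g (dir x)) volume :=
    (hkm.comp measurable_norm).aestronglyMeasurable.smul
      (hg.1.comp_quasiMeasurePreserving quasiMeasurePreserving_dir)
  rw [← integrable_norm_iff hm]
  have hk' : IntegrableOn (fun t => t ^ (N - 1) * |k t|) (Ioi (0 : ℝ)) := by
    have hk0 : IntegrableOn (fun t => ‖t ^ (N - 1) * k t‖) (Ioi (0 : ℝ)) := hk.norm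
    refine hk0.congr_fun (fun t ht => ?_) measurableSet_Ioi
    simp only [norm_mul, norm_pow, Real.norm_eq_abs, abs_of_pos (show (0 : ℝ) < t from ht)]
  refine (integrable_radial_mul hk' hg.norm).congr (ae_of_all _ fun x => ?_)
  simp [norm_smul]

theorem integrableOn_pow_mul_indicator_Ioo {a b : ℝ} (n : ℕ) {k : ℝ → ℝ} (hk : ContinuousOn k (Icc a b)) :
    IntegrableOn (fun t => t ^ n * (Ioo a b).indicator k t) (Ioi (0 : ℝ)) := by
  have h1 : IntegrableOn (fun t => t ^ n * k t) (Ioo a b) :=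
    ((by fun_prop : ContinuousOn (fun t => t ^ n * k t) (Icc a b)).integrableOn_compact
      isCompact_Icc).mono_set Ioo_subset_Icc_self
  have h2 := (integrable_indicator_iff measurableSet_Ioo).2 h1
  refine (h2.congr (ae_of_all _ fun t => ?_)).integrableOn
  by_cases ht : t ∈ Ioo a b <;> simp [ht]

theorem measurable_indicator_Ioo_of_continuousOn {a b : ℝ} {k : ℝ → ℝ}
    (hk : ContinuousOn k (Icc a b)) : Measurable ((Ioo a b).indicator k) := by
  refine measurable_of_restrict_of_restrict_compl (s := Ioo a b) measurableSet_Ioo ?_ ?_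
  · have : (Ioo a b).domRestrict ((Ioo a b).indicator k) = (Ioo a b).domRestrict k := by
      funext x
      exact indicator_of_mem x.2 _
    rw [this]
    exact (continuousOn_iff_continuous_domRestrict.1 (hk.mono Ioo_subset_Icc_self)).measurable
  · have : (Ioo a b)ᶜ.domRestrict ((Ioo a b).indicator k) = fun _ => 0 := by
      funext x
      exact indicator_of_notMem x.2 _
    rw [this]
    exact measurable_const

/-- Near a point of the cone the radius stays in a compact part of (0, ∞), where k is bounded, and
polar coordinates separate the two factors. -/
theorem locallyIntegrableOn_cone {F : Type*} [NormedAddCommGroup F] [NormedSpace ℝ F]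
    (hD : MeasurableSet D) {g : Sph N → F} (hg : IntegrableOn g D (surf N)) {k : ℝ → ℝ}
    (hk : ContinuousOn k (Ioi 0)) :
    LocallyIntegrableOn (fun x : Amb N => k ‖x‖ • g (dir x)) (cone D) := by
  rintro x ⟨hx, hxD⟩
  have hx0 : 0 < ‖x‖ := norm_pos_iff.2 hx
  set a := ‖x‖ / 2
  set b := 2 * ‖x‖
  have ha : 0 < a := by positivity
  have hkc : ContinuousOn k (Icc a b) := hk.mono fun t ht => lt_of_lt_of_le ha ht.1
  have hg0 : Integrable (D.indicator g) (surf N) := (integrable_indicator_iff hD).2 hg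
  have h1 := integrable_radial_smul (measurable_indicator_Ioo_of_continuousOn hkc)
    (integrableOn_pow_mul_indicator_Ioo (N - 1) hkc) hg0
  refine ⟨cone D ∩ {y | ‖y‖ ∈ Ioo a b}, ?_, ?_⟩
  · refine inter_mem self_mem_nhdsWithin (mem_nhdsWithin_of_mem_nhds ?_)
    refine (isOpen_Ioo.preimage continuous_norm).mem_nhds ?_
    simp only [mem_preimage, mem_Ioo, a, b]
    constructor <;> linarith
  · have hm : MeasurableSet (cone D ∩ {y : Amb N | ‖y‖ ∈ Ioo a b}) := by
      refine MeasurableSet.inter ?_ (measurableSet_Ioo.preimage measurable_norm)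
      exact (measurableSet_singleton 0).compl.inter (measurable_dir hD)
    refine h1.integrableOn.congr_fun (fun y hy => ?_) hm
    have hy2 : ‖y‖ ∈ Ioo a b := hy.2
    simp only [indicator_of_mem hy2, indicator_of_mem hy.1.2]

/-! ### Averages along rays. -/

section RadialAverage

variable {φ : Amb N → ℝ} {a b : ℝ} {m : ℕ}

/-- The weighted integral of `φ` along the ray through `x`. -/
noncomputable def radialAverage (m : ℕ) (a b : ℝ) (φ : Amb N → ℝ) (x : Amb N) : ℝ :=
  ∫ t in a..b, t ^ m * φ (t • x)

theorem contDiff_radialAverage (hφ : ContDiff ℝ ∞ φ) (hab : a ≤ b) :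
    ContDiff ℝ ∞ (radialAverage m a b φ) := by
  rw [← contDiffOn_univ]
  refine contDiffOn_intervalIntegral_param (g := fun x t => t ^ m * φ (t • x)) isOpen_univ ?_ hab
  refine ContDiff.contDiffOn ?_
  exact (contDiff_snd.pow m).mul (hφ.comp (contDiff_snd.smul contDiff_fst))

/-- Differentiation under the integral sign; the chain rule raises the power of t by one. -/
theorem fderiv_radialAverage (hφ : ContDiff ℝ ∞ φ) (hc : HasCompactSupport φ) (hab : a ≤ b)
    (ha : 0 ≤ a) (x v : Amb N) :
    fderiv ℝ (radialAverage m a b φ) x v = ∫ t in a..b, t ^ (m + 1) * fderiv ℝ φ (t • x) v := by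
  have hd : DifferentiableAt ℝ (radialAverage m a b φ) x :=
    (contDiff_radialAverage hφ hab).differentiable (by simp) x
  have h1 : HasDerivAt (fun s : ℝ => radialAverage m a b φ (x + s • v))
      (fderiv ℝ (radialAverage m a b φ) x v) 0 := by
    have h0 : HasDerivAt (fun s : ℝ => x + s • v) v 0 := by
      simpa using ((hasDerivAt_id (0 : ℝ)).smul_const v).const_add x
    exact HasFDerivAt.comp_hasDerivAt (x := (0 : ℝ)) (f := fun s : ℝ => x + s • v)
      (l := radialAverage m a b φ) (by simpa using hd.hasFDerivAt) h0
  have hφ' : Continuous (fderiv ℝ φ) := hφ.continuous_fderiv (by simp)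
  obtain ⟨C, hC⟩ := hφ'.bounded_above_of_compact_support (hc.fderiv ℝ)
  have hder : ∀ t s : ℝ, HasDerivAt (fun s : ℝ => t ^ m * φ (t • (x + s • v)))
      (t ^ (m + 1) * fderiv ℝ φ (t • (x + s • v)) v) s := by
    intro t s
    have h0 : HasDerivAt (fun s : ℝ => t • (x + s • v)) (t • v) s :=
      ((((hasDerivAt_id s).smul_const v).const_add x).const_smul t).congr_deriv (by simp)
    have h2 := ((hφ.differentiable (by simp) (t • (x + s • v))).hasFDerivAt.comp_hasDerivAt s
      h0).const_mul (t ^ m)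
    refine h2.congr_deriv ?_
    rw [map_smul, smul_eq_mul]
    ring
  have hφc := hφ.continuous
  have h2 := intervalIntegral.hasDerivAt_integral_of_dominated_loc_of_deriv_le (μ := volume)
    (F := fun s t => t ^ m * φ (t • (x + s • v)))
    (F' := fun s t => t ^ (m + 1) * fderiv ℝ φ (t • (x + s • v)) v) (x₀ := (0 : ℝ))
    (a := a) (b := b) (bound := fun _ => b ^ (m + 1) * (C * ‖v‖)) (s := univ)
    univ_mem
    (Eventually.of_forall fun s =>
      (by fun_prop : Continuous fun t : ℝ => t ^ m * φ (t • (x + s • v))).aestronglyMeasurable)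
    ((by fun_prop : Continuous fun t : ℝ =>
      t ^ m * φ (t • (x + (0 : ℝ) • v))).intervalIntegrable _ _)
    ((by fun_prop : Continuous fun t : ℝ =>
      t ^ (m + 1) * fderiv ℝ φ (t • (x + (0 : ℝ) • v)) v).aestronglyMeasurable)
    (ae_of_all _ fun t ht s _ => by
      rw [uIoc_of_le hab] at ht
      have ht0 : 0 ≤ t := ha.trans ht.1.le
      rw [norm_mul, norm_pow, Real.norm_eq_abs, abs_of_nonneg ht0]
      have hC' := hC (t • (x + s • v))
      have hC0 : 0 ≤ C := (norm_nonneg _).trans hC'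
      have h3 : ‖fderiv ℝ φ (t • (x + s • v)) v‖ ≤ C * ‖v‖ :=
        (ContinuousLinearMap.le_opNorm _ v).trans (by gcongr)
      exact mul_le_mul (pow_le_pow_left₀ ht0 ht.2 _) h3 (norm_nonneg _)
        (pow_nonneg (ht0.trans ht.2) _))
    (by simp)
    (ae_of_all _ fun t _ s _ => hder t s)
  have h3 := h1.unique h2.2
  simpa using h3

/-- Euler's relation for degree -(m + 1), by integrating the derivative of t^{m+1} φ(tx); the end
point terms vanish by hypothesis. -/
theorem fderiv_radialAverage_self (hφ : ContDiff ℝ ∞ φ) (hc : HasCompactSupport φ) (hab : a ≤ b)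
    (ha : 0 ≤ a) {x : Amb N} (hxa : φ (a • x) = 0) (hxb : φ (b • x) = 0) :
    fderiv ℝ (radialAverage m a b φ) x x = - (m + 1) * radialAverage m a b φ x := by
  rw [fderiv_radialAverage hφ hc hab ha]
  have hφc := hφ.continuous
  have hφ' : Continuous (fderiv ℝ φ) := hφ.continuous_fderiv (by simp)
  have hder : ∀ t ∈ uIcc a b, HasDerivAt (fun t : ℝ => t ^ (m + 1) * φ (t • x))
      ((m + 1) * (t ^ m * φ (t • x)) + t ^ (m + 1) * fderiv ℝ φ (t • x) x) t := by
    intro t _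
    have h0 : HasDerivAt (fun t : ℝ => t • x) x t := by
      simpa using (hasDerivAt_id t).smul_const x
    have h2 := (hasDerivAt_pow (m + 1) t).mul
      ((hφ.differentiable (by simp) (t • x)).hasFDerivAt.comp_hasDerivAt t h0)
    refine h2.congr_deriv ?_
    simp
    ring
  have h := intervalIntegral.integral_eq_sub_of_hasDerivAt hder
    (Continuous.intervalIntegrable (by fun_prop) _ _)
  rw [hxa, hxb, mul_zero, mul_zero, sub_zero, intervalIntegral.integral_add
    (Continuous.intervalIntegrable (by fun_prop) _ _)
    (Continuous.intervalIntegrable (by fun_prop) _ _), intervalIntegral.integral_const_mul] at h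
  rw [radialAverage]
  linarith

end RadialAverage

/-- The tangential projection of the constant field e has spherical divergence -(N - 1)⟨e, p⟩; the
remaining terms are the derivative of h along that projection. -/
theorem sphDiv_smul_tangential {h : Amb N → ℝ} {p : Sph N} (hd : DifferentiableAt ℝ h p)
    (e : Amb N) :
    sphDiv (fun x => h x • (e - ⟪e, x⟫_ℝ • x)) p =
      fderiv ℝ h p e - ⟪e, (p : Amb N)⟫_ℝ * (fderiv ℝ h p p + (N - 1) * h p) := by
  have h1 : HasFDerivAt (fun x : Amb N => ⟪e, x⟫_ℝ) (innerSL ℝ e) (p : Amb N) :=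
    (innerSL ℝ e).hasFDerivAt
  have h2 : HasFDerivAt (fun x => h x • (e - ⟪e, x⟫_ℝ • x))
      (h ↑p • (0 - (⟪e, (p : Amb N)⟫_ℝ • ContinuousLinearMap.id ℝ (Amb N) +
        (innerSL ℝ e).smulRight (p : Amb N))) +
        (fderiv ℝ h ↑p).smulRight (e - ⟪e, (p : Amb N)⟫_ℝ • (p : Amb N))) (p : Amb N) :=
    hd.hasFDerivAt.smul ((hasFDerivAt_const e (p : Amb N)).sub
      (h1.smul (hasFDerivAt_id (p : Amb N))))
  rw [sphDiv, h2.fderiv]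
  have htr : LinearMap.trace ℝ (Amb N) (LinearMap.id : Amb N →ₗ[ℝ] Amb N) = N := by
    rw [LinearMap.trace_id]
    simp
  rw [ContinuousLinearMap.toLinearMap_add, ContinuousLinearMap.toLinearMap_smul,
    ContinuousLinearMap.toLinearMap_sub, ContinuousLinearMap.toLinearMap_add,
    ContinuousLinearMap.toLinearMap_smul, ContinuousLinearMap.toLinearMap_zero,
    ContinuousLinearMap.coe_id, map_add, map_smul, map_sub, map_add, map_smul, map_zero,
    trace_smulRight, trace_smulRight, htr]
  simp only [innerSL_apply_apply, map_sub, map_smul, smul_eq_mul, add_apply,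
    smul_apply, sub_apply, zero_apply,
    ContinuousLinearMap.smulRight_apply, ContinuousLinearMap.id_apply, inner_add_left,
    innerSL_apply_apply,
    inner_smul_left, inner_sub_left, inner_zero_left, inner_self_sph, RCLike.conj_to_real]
  ring

theorem exists_annulus {φ : Amb N → ℝ} (hc : HasCompactSupport φ) (hs : tsupport φ ⊆ cone D) :
    ∃ a b : ℝ, 0 < a ∧ a ≤ b ∧ ∀ x ∈ tsupport φ, a < ‖x‖ ∧ ‖x‖ < b := by
  have h0 : (0 : Amb N) ∉ tsupport φ := fun h => (hs h).1 rfl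
  obtain ⟨a, ha, haφ⟩ := Metric.isOpen_iff.1 (isClosed_tsupport φ).isOpen_compl 0 h0
  obtain ⟨b, hb⟩ := hc.isCompact.isBounded.subset_ball 0
  refine ⟨a / 2, max (a / 2) b, by positivity, le_max_left _ _, fun x hx => ⟨?_, ?_⟩⟩
  · by_contra h
    refine haφ ?_ hx
    rw [mem_ball_zero_iff]
    linarith
  · exact (mem_ball_zero_iff.1 (hb hx)).trans_le (le_max_right _ _)

theorem setIntegral_Ioi_eq_of_support {a b : ℝ} (ha : 0 < a) (hab : a ≤ b) {f : ℝ → ℝ}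
    (hf : ∀ t, 0 < t → f t ≠ 0 → a < t ∧ t < b) :
    ∫ t in Ioi (0 : ℝ), f t = ∫ t in a..b, f t := by
  rw [intervalIntegral.integral_of_le hab]
  refine setIntegral_eq_of_subset_of_forall_sdiff_eq_zero measurableSet_Ioi
    (fun t ht => ha.trans ht.1) ?_
  rintro t ⟨ht0, ht⟩
  by_contra h
  obtain ⟨h1, h2⟩ := hf t ht0 h
  exact ht ⟨h1, h2.le⟩

/-- The homogeneous extension of a Sobolev function on `D` is weakly differentiable on the cone. -/
theorem HasSobolevGradient.hasWeakGradient {u : Sph N → ℝ} {G : Sph N → Amb N} (hN : 2 ≤ N)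
    (h : HasSobolevGradient D u G) (hD : MeasurableSet D) :
    HasWeakGradient (cone D) (fun x => u (dir x)) (fun x => ‖x‖⁻¹ • G (dir x)) := by
  intro φ hφ hc hs e
  have hfinD : IsFiniteMeasure ((surf N).restrict D) := inferInstance
  have huD : IntegrableOn u D (surf N) := h.memLp.integrable (by norm_num)
  have hGD : IntegrableOn G D (surf N) := h.memLp_grad.integrable (by norm_num)
  have hul : LocallyIntegrableOn (fun x => u (dir x)) (cone D) := by
    simpa using locallyIntegrableOn_cone hD huD (k := fun _ => 1) continuousOn_const
  have hGl : LocallyIntegrableOn (fun x => ‖x‖⁻¹ • G (dir x)) (cone D) :=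
    locallyIntegrableOn_cone hD hGD (k := fun t => t⁻¹)
      (continuousOn_inv₀.mono fun t ht => (ne_of_gt ht))
  obtain ⟨a, b, ha, hab, hφab⟩ := exists_annulus hc hs
  have hφ0 : ∀ x, x ∉ tsupport φ → φ x = 0 := fun x hx => image_eq_zero_of_notMem_tsupport hx
  have hφ1 : ∀ x, x ∉ tsupport φ → fderiv ℝ φ x = 0 := by
    intro x hx
    by_contra h0
    exact hx (support_fderiv_subset ℝ h0)
  have hφab0 : ∀ (p : Sph N) (t : ℝ), 0 < t → t • (p : Amb N) ∈ tsupport φ → a < t ∧ t < b := by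
    intro p t ht hp
    simpa [norm_smul_sph ht] using hφab _ hp
  have hφD : ∀ (p : Sph N) (t : ℝ), 0 < t → t • (p : Amb N) ∈ tsupport φ → p ∈ D := by
    intro p t ht hp
    simpa [dir_smul_sph ht] using (hs hp).2
  -- With weight t^{N-2} the ray average has degree -(N - 1), so the last bracket in
  -- `sphDiv_smul_tangential` vanishes and only the derivative along e survives.
  set m := N - 2
  have hm1 : m + 1 = N - 1 := by omega
  have hmN : ((m : ℝ) + 1) = (N : ℝ) - 1 := by
    have : (m : ℝ) = (N : ℝ) - 2 := by
      simp only [m]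
      push_cast [Nat.cast_sub hN]
      ring
    linarith
  set H := radialAverage m a b φ with hH
  have hHs : ContDiff ℝ ∞ H := contDiff_radialAverage hφ hab
  -- This field on the sphere encodes the Euclidean test pair (φ, e): integrating along rays turns
  -- the weak identity on the cone into the one on D tested with X.
  set X : Amb N → Amb N := fun x => H x • (e - ⟪e, x⟫_ℝ • x) with hX
  have hH0 : ∀ p : Sph N, p ∉ dir '' tsupport φ → H p = 0 := by
    intro p hp
    rw [hH, radialAverage]
    refine (intervalIntegral.integral_congr (g := fun _ => (0 : ℝ)) fun t ht => ?_).trans (by simp)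
    rw [uIcc_of_le hab] at ht
    have ht0 : 0 < t := ha.trans_le ht.1
    simp only
    rw [hφ0, mul_zero]
    exact fun hp' => hp ⟨_, hp', dir_smul_sph ht0 p⟩
  have hXt : IsTestField D X := by
    refine ⟨hHs.smul (contDiff_const.sub ((contDiff_const.inner ℝ contDiff_id).smul contDiff_id)),
      fun p => ?_, dir '' tsupport φ, ?_, ?_, ?_⟩
    · rw [hX]
      simp only [inner_smul_right, inner_sub_right, inner_self_sph, real_inner_comm e]
      ring
    · exact hc.isCompact.image_of_continuousOn fun x hx =>
        (continuousAt_dir (hs hx).1).continuousWithinAt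
    · rintro _ ⟨x, hx, rfl⟩
      exact (hs hx).2
    · intro p hp
      simp [hX, hH0 p hp]
  have hdiv : ∀ p : Sph N, sphDiv X p = ∫ t in Ioi (0 : ℝ),
      t ^ (N - 1) * fderiv ℝ φ (t • (p : Amb N)) e := by
    intro p
    rw [hX, sphDiv_smul_tangential (hHs.differentiable (by simp) _),
      fderiv_radialAverage_self hφ hc hab ha.le, fderiv_radialAverage hφ hc hab ha.le, hm1, ← hmN,
      setIntegral_Ioi_eq_of_support ha hab]
    · rw [← hH]
      ring
    · intro t ht h0
      refine hφab0 p t ht ?_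
      by_contra hn
      simp [hφ1 _ hn] at h0
    · exact hφ0 _ fun hn => lt_irrefl a (hφab0 p a ha hn).1
    · exact hφ0 _ fun hn => lt_irrefl b (hφab0 p b (ha.trans_le hab) hn).2
  -- The weight t^{N-2} is written as the polar density t^{N-1} times the factor t⁻¹ carried by the
  -- extended gradient.
  have hHp : ∀ p : Sph N, H p = ∫ t in Ioi (0 : ℝ), t ^ (N - 1) * (t⁻¹ * φ (t • (p : Amb N))) := by
    intro p
    rw [setIntegral_Ioi_eq_of_support ha hab, hH, radialAverage]
    · refine intervalIntegral.integral_congr fun t ht => ?_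
      rw [uIcc_of_le hab] at ht
      have ht0 : t ≠ 0 := (ha.trans_le ht.1).ne'
      simp only [← hm1, pow_succ]
      field_simp
    · intro t ht h0
      refine hφab0 p t ht ?_
      by_contra hn
      simp [hφ0 _ hn] at h0
  have i1 : Integrable fun x => u (dir x) * fderiv ℝ φ x e := by
    have h0 : ContDiff ℝ ∞ fun x => fderiv ℝ φ x e :=
      (hφ.fderiv_right (by simp)).clm_apply contDiff_const
    have := integrable_mul_of_locallyIntegrableOn hul h0.continuous
      (HasCompactSupport.fderiv_apply ℝ hc e) ((tsupport_fderiv_apply_subset ℝ e).trans hs)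
    simpa [mul_comm] using this
  have i2 : Integrable fun x => ⟪‖x‖⁻¹ • G (dir x), e⟫_ℝ * φ x := by
    have := (integrable_mul_of_locallyIntegrableOn hGl hφ.continuous hc hs).inner_const
      (𝕜 := ℝ) e
    refine this.congr (ae_of_all _ fun x => ?_)
    simp only [inner_smul_left, RCLike.conj_to_real]
    ring
  have e1 : ∫ x, u (dir x) * fderiv ℝ φ x e = ∫ p in D, u p * sphDiv X p ∂surf N := by
    rw [integral_polar i1, ← integral_indicator hD]
    refine integral_congr_ae (ae_of_all _ fun p => ?_)
    by_cases hp : p ∈ D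
    · simp only [indicator_of_mem hp, hdiv]
      rw [← integral_const_mul]
      refine setIntegral_congr_fun measurableSet_Ioi fun t ht => ?_
      simp only [dir_smul_sph ht, smul_eq_mul]
      ring
    · simp only [indicator_of_notMem hp]
      refine setIntegral_eq_zero_of_forall_eq_zero fun t ht => ?_
      rw [hφ1 _ fun hn => hp (hφD p t ht hn)]
      simp
  -- The normal part of X is invisible because G is tangent almost everywhere.
  have e2 : ∫ x, ⟪‖x‖⁻¹ • G (dir x), e⟫_ℝ * φ x = ∫ p in D, ⟪G p, X p⟫_ℝ ∂surf N := by
    have e3 : ∫ p in D, ⟪G p, X p⟫_ℝ ∂surf N = ∫ p in D, ⟪G p, e⟫_ℝ * H p ∂surf N := by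
      refine integral_congr_ae ?_
      filter_upwards [h.tangent] with p hp
      rw [hX]
      simp only [inner_smul_right, inner_sub_right, real_inner_comm, hp]
      ring
    rw [e3, integral_polar i2, ← integral_indicator hD]
    refine integral_congr_ae (ae_of_all _ fun p => ?_)
    by_cases hp : p ∈ D
    · simp only [indicator_of_mem hp, hHp]
      rw [← integral_const_mul]
      refine setIntegral_congr_fun measurableSet_Ioi fun t ht => ?_
      simp only [dir_smul_sph ht, smul_eq_mul, norm_smul_sph ht, inner_smul_left,
        RCLike.conj_to_real]
      ring
    · simp only [indicator_of_notMem hp]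
      refine setIntegral_eq_zero_of_forall_eq_zero fun t ht => ?_
      rw [hφ0 _ fun hn => hp (hφD p t ht hn)]
      simp
  rw [e1, e2]
  exact h.weak_gradient X hXt

omit [NeZero N] in
theorem hasFDerivAt_norm_of_ne_zero {x : Amb N} (hx : x ≠ 0) :
    HasFDerivAt (fun y : Amb N => ‖y‖) (‖x‖⁻¹ • innerSL ℝ x) x := by
  have h := ((hasStrictFDerivAt_norm_sq x).hasFDerivAt).sqrt
    (pow_ne_zero 2 (norm_ne_zero_iff.2 hx))
  simp only [Real.sqrt_sq (norm_nonneg _)] at h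
  refine h.congr_fderiv ?_
  ext v
  simp
  field_simp

theorem hasFDerivAt_norm_inv_smul {x : Amb N} (hx : x ≠ 0) :
    HasFDerivAt (fun y : Amb N => ‖y‖⁻¹ • y)
      (‖x‖⁻¹ • (ContinuousLinearMap.id ℝ (Amb N) -
        (innerSL ℝ (dir x : Amb N)).smulRight (dir x : Amb N))) x := by
  have hx' : ‖x‖ ≠ 0 := norm_ne_zero_iff.2 hx
  have h := ((hasDerivAt_inv hx').comp_hasFDerivAt x (hasFDerivAt_norm_of_ne_zero hx)).smul
    (hasFDerivAt_id x)
  refine h.congr_fderiv ?_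
  ext1 v
  simp only [coe_dir hx, Function.comp_apply, add_apply, smul_apply, sub_apply,
    ContinuousLinearMap.smulRight_apply, ContinuousLinearMap.id_apply, innerSL_apply_apply,
    inner_smul_left, RCLike.conj_to_real, smul_sub, smul_smul, smul_eq_mul, id]
  rw [sub_eq_add_neg, ← neg_smul]
  congr 2
  field_simp

theorem continuous_sphDiv {X : Amb N → Amb N} (hX : ContDiff ℝ ∞ X) :
    Continuous (sphDiv X : Sph N → ℝ) := by
  have hX' : Continuous (fderiv ℝ X) := hX.continuous_fderiv (by simp)
  let T : (Amb N →L[ℝ] Amb N) →ₗ[ℝ] ℝ :=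
    (LinearMap.trace ℝ (Amb N)).comp (ContinuousLinearMap.coeLM ℝ)
  have hT : Continuous T := T.continuous_of_finiteDimensional
  have h1 : Continuous fun p : Sph N => T (fderiv ℝ X p) := by fun_prop
  exact h1.sub (by fun_prop)

/-! ### Radially cut-off homogeneous vector fields. -/

section RadialField

variable {X : Amb N → Amb N} (η : ContDiffBump (2 : ℝ))

/-- The radially cut off homogeneous extension of a vector field on the sphere. -/
noncomputable def radialField (η : ContDiffBump (2 : ℝ)) (X : Amb N → Amb N) (x : Amb N) : Amb N :=
  η ‖x‖ • X (dir x)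

theorem radialField_eventuallyEq {x : Amb N} (hx : x ≠ 0) :
    radialField η X =ᶠ[𝓝 x] fun y => η ‖y‖ • X (‖y‖⁻¹ • y) := by
  filter_upwards [isOpen_ne.mem_nhds hx] with y hy
  rw [radialField, coe_dir hy]

theorem radialField_eventuallyEq_zero (hη : η.rOut ≤ 1) :
    radialField η X =ᶠ[𝓝 0] fun _ => 0 := by
  filter_upwards [Metric.ball_mem_nhds (0 : Amb N) one_pos] with y hy
  rw [radialField, η.zero_of_le_dist, zero_smul]
  rw [mem_ball_zero_iff] at hy
  rw [Real.dist_eq, abs_sub_comm, abs_of_nonneg (by linarith)]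
  linarith

theorem contDiff_radialField (hη : η.rOut ≤ 1) (hX : ContDiff ℝ ∞ X) :
    ContDiff ℝ ∞ (radialField η X) := by
  rw [contDiff_iff_contDiffAt]
  intro x
  rcases eq_or_ne x 0 with rfl | hx
  · exact contDiffAt_const.congr_of_eventuallyEq (radialField_eventuallyEq_zero η hη)
  · refine ContDiffAt.congr_of_eventuallyEq ?_ (radialField_eventuallyEq η hx)
    have h1 : ContDiffAt ℝ ∞ (fun y : Amb N => ‖y‖) x := contDiffAt_norm ℝ hx
    exact (η.contDiff.contDiffAt.comp x h1).smul
      (hX.contDiffAt.comp x ((h1.inv (norm_ne_zero_iff.2 hx)).smul contDiffAt_id))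

theorem support_radialField_subset (hη : η.rOut ≤ 1) {K : Set (Sph N)}
    (hXK : ∀ p : Sph N, p ∉ K → X p = 0) :
    Function.support (radialField η X) ⊆
      (fun q : Sph N × ℝ => q.2 • (q.1 : Amb N)) '' (K ×ˢ Icc (1 : ℝ) 3) := by
  intro x hx
  refine ⟨(dir x, ‖x‖), ⟨?_, ?_⟩, norm_smul_dir x⟩
  · by_contra h
    exact hx (by rw [radialField, hXK _ h, smul_zero])
  · by_contra h
    apply hx
    rw [radialField, η.zero_of_le_dist, zero_smul]
    rw [mem_Icc, not_and_or, not_le, not_le] at h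
    rw [Real.dist_eq, le_abs]
    rcases h with h | h
    · right; linarith
    · left; linarith

/-- Differentiating the radial cut-off gives a multiple of ⟨x, X⟩, which is zero by tangency. The
derivative of the radial projection removes the normal direction from the trace, leaving the
spherical divergence. -/
theorem trace_fderiv_radialField (hη : η.rOut ≤ 1) (hX : ContDiff ℝ ∞ X)
    (ht : ∀ p : Sph N, ⟪(p : Amb N), X p⟫_ℝ = 0) (x : Amb N) :
    LinearMap.trace ℝ (Amb N) (fderiv ℝ (radialField η X) x : Amb N →ₗ[ℝ] Amb N) =
      (η ‖x‖ * ‖x‖⁻¹) * sphDiv X (dir x) := by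
  rcases eq_or_ne x 0 with rfl | hx
  · rw [(radialField_eventuallyEq_zero η hη).fderiv_eq]
    simp
  rw [(radialField_eventuallyEq η hx).fderiv_eq]
  have h1 : HasFDerivAt (fun y : Amb N => η ‖y‖) (deriv η ‖x‖ • (‖x‖⁻¹ • innerSL ℝ x)) x :=
    ((η.contDiff (n := 1)).differentiable one_ne_zero ‖x‖).hasDerivAt.comp_hasFDerivAt x
      (hasFDerivAt_norm_of_ne_zero hx)
  have h2 : HasFDerivAt X (fderiv ℝ X (dir x : Amb N)) (‖x‖⁻¹ • x) := by
    rw [← coe_dir hx]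
    exact (hX.differentiable (by simp) _).hasFDerivAt
  have h3 := h1.smul (HasFDerivAt.comp (g := X) (f := fun y : Amb N => ‖y‖⁻¹ • y) x h2
    (hasFDerivAt_norm_inv_smul hx))
  have h4 : HasFDerivAt (fun y => η ‖y‖ • X (‖y‖⁻¹ • y)) _ x := h3
  rw [h4.fderiv]
  set A := fderiv ℝ X (dir x : Amb N) with hA
  set p : Amb N := ((dir x : Sph N) : Amb N) with hp
  have hcomp : A.comp (‖x‖⁻¹ • (ContinuousLinearMap.id ℝ (Amb N) - (innerSL ℝ p).smulRight p)) =
      ‖x‖⁻¹ • (A - (innerSL ℝ p).smulRight (A p)) := by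
    ext1 v
    simp
  have hXp : (X ∘ fun y : Amb N => ‖y‖⁻¹ • y) x = X p := by
    simp [hp, coe_dir hx]
  rw [hcomp, hXp, ContinuousLinearMap.toLinearMap_add, ContinuousLinearMap.toLinearMap_smul,
    ContinuousLinearMap.toLinearMap_smul, ContinuousLinearMap.toLinearMap_sub, map_add, map_smul,
    map_smul, map_sub, trace_smulRight, trace_smulRight]
  have hxp : ⟪x, X p⟫_ℝ = 0 := by
    rw [← norm_smul_dir x, inner_smul_left, ← hp, ht, mul_zero]
  simp only [smul_apply, innerSL_apply_apply, hxp, smul_eq_mul, sphDiv]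
  rw [real_inner_comm p (A p)]
  ring

end RadialField

theorem exists_radial_bump : ∃ η : ContDiffBump (2 : ℝ), η.rOut ≤ 1 :=
  ⟨{ rIn := 1 / 2, rOut := 1, rIn_pos := by norm_num, rIn_lt_rOut := by norm_num }, le_rfl⟩

/-- The cone identity is tested with the radially cut-off extension of X. In polar coordinates both
sides acquire the same radial factor c, which is positive and cancels. -/
theorem hasSobolevGradient_of_hasWeakGradient {u : Sph N → ℝ} {G : Sph N → Amb N}
    (hD : MeasurableSet D) (hu : MemLp u 2 ((surf N).restrict D))
    (hG : MemLp G 2 ((surf N).restrict D))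
    (ht : ∀ᵐ (p : Sph N) ∂((surf N).restrict D), ⟪(p : Amb N), G p⟫_ℝ = 0)
    (h : HasWeakGradient (cone D) (fun x => u (dir x)) (fun x => ‖x‖⁻¹ • G (dir x))) :
    HasSobolevGradient D u G := by
  refine ⟨hu, hG, ht, fun X hX => ?_⟩
  obtain ⟨K, hK, hKD, hXK⟩ := hX.compact_support
  obtain ⟨η, hη⟩ := exists_radial_bump
  have huD : IntegrableOn u D (surf N) := hu.integrable (by norm_num)
  have hGD : IntegrableOn G D (surf N) := hG.integrable (by norm_num)
  have hul : LocallyIntegrableOn (fun x => u (dir x)) (cone D) := by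
    simpa using locallyIntegrableOn_cone hD huD (k := fun _ => 1) continuousOn_const
  have hGl : LocallyIntegrableOn (fun x => ‖x‖⁻¹ • G (dir x)) (cone D) :=
    locallyIntegrableOn_cone hD hGD (k := fun t => t⁻¹)
      (continuousOn_inv₀.mono fun t ht => (ne_of_gt ht))
  set L : Set (Amb N) := (fun q : Sph N × ℝ => q.2 • (q.1 : Amb N)) '' (K ×ˢ Icc (1 : ℝ) 3)
  have hL : IsCompact L := (hK.prod isCompact_Icc).image (by fun_prop)
  have hLD : L ⊆ cone D := by
    rintro _ ⟨⟨p, t⟩, ⟨hp, ht⟩, rfl⟩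
    exact smul_mem_cone (hKD hp) (one_pos.trans_le ht.1)
  have hsupp : Function.support (radialField η X) ⊆ L := support_radialField_subset η hη hXK
  have htsupp : tsupport (radialField η X) ⊆ L := closure_minimal hsupp hL.isClosed
  have key := h.integral_mul_trace hul hGl (contDiff_radialField η hη hX.smooth)
    (HasCompactSupport.of_support_subset_isCompact hL hsupp) (htsupp.trans hLD)
  set k : ℝ → ℝ := fun t => η t * t⁻¹ with hk
  have hkm : Measurable k := η.continuous.measurable.mul measurable_inv
  set c := ∫ t in Ioi (0 : ℝ), t ^ (N - 1) * k t with hc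
  have hm1 : AEStronglyMeasurable (D.indicator fun p => u p * sphDiv X p) (surf N) :=
    (aestronglyMeasurable_indicator_iff hD).2
      (hu.1.mul (continuous_sphDiv hX.smooth).aestronglyMeasurable)
  have hXc : Continuous fun p : Sph N => X p := hX.smooth.continuous.comp continuous_subtype_val
  have hm2 : AEStronglyMeasurable (D.indicator fun p => ⟪G p, X p⟫_ℝ) (surf N) :=
    (aestronglyMeasurable_indicator_iff hD).2 (hG.1.inner hXc.aestronglyMeasurable)
  have hη0 : ∀ x : Amb N, dir x ∉ D → x ∉ L := fun x hx hxL => hx (hLD hxL).2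
  have e1 : ∫ x, u (dir x) * LinearMap.trace ℝ (Amb N)
      (fderiv ℝ (radialField η X) x : Amb N →ₗ[ℝ] Amb N) =
      c * ∫ p in D, u p * sphDiv X p ∂surf N := by
    rw [← integral_indicator hD, ← integral_radial_mul hkm hm1]
    refine integral_congr_ae (ae_of_all _ fun x => ?_)
    by_cases hx : dir x ∈ D
    · simp only [indicator_of_mem hx, trace_fderiv_radialField η hη hX.smooth hX.tangent, hk]
      ring
    · have h0 : fderiv ℝ (radialField η X) x = 0 := by
        by_contra h0
        exact hη0 x hx (htsupp (support_fderiv_subset ℝ h0))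
      simp [indicator_of_notMem hx, h0]
  have e2 : ∫ x, ⟪‖x‖⁻¹ • G (dir x), radialField η X x⟫_ℝ =
      c * ∫ p in D, ⟪G p, X p⟫_ℝ ∂surf N := by
    rw [← integral_indicator hD, ← integral_radial_mul hkm hm2]
    refine integral_congr_ae (ae_of_all _ fun x => ?_)
    by_cases hx : dir x ∈ D
    · simp only [indicator_of_mem hx, radialField, inner_smul_left, inner_smul_right, hk,
        RCLike.conj_to_real]
      ring
    · have h0 : radialField η X x = 0 := by
        by_contra h0
        exact hη0 x hx (hsupp h0)
      simp [indicator_of_notMem hx, h0]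
  have hc0 : 0 < c := by
    have hpos : ∀ t ∈ Ioi (0 : ℝ), 0 ≤ t ^ (N - 1) * k t := fun t ht => by
      have : (0 : ℝ) < t := ht
      have := η.nonneg (x := t)
      positivity
    have hsub : Ioo (1 : ℝ) 3 ⊇ Function.support η := by
      intro t ht
      rw [η.support_eq] at ht
      have := Metric.ball_subset_ball hη ht
      rw [Real.ball_eq_Ioo] at this
      norm_num at this
      exact this
    have hcont : ContinuousOn (fun t => t ^ (N - 1) * k t) (Icc 1 3) := by
      refine (continuousOn_pow _).mul (η.continuous.continuousOn.mul
        (continuousOn_inv₀.mono fun t ht => ?_))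
      exact (one_pos.trans_le ht.1).ne'
    have hint : IntegrableOn (fun t => t ^ (N - 1) * k t) (Ioi 0) := by
      have h1 := hcont.integrableOn_compact (μ := volume) isCompact_Icc
      refine ((integrableOn_iff_integrable_of_support_subset ?_).1 h1).integrableOn
      intro t ht
      refine Ioo_subset_Icc_self (hsub fun h0 => ht ?_)
      simp [hk, h0]
    rw [hc, setIntegral_pos_iff_support_of_nonneg_ae
      ((ae_restrict_iff' measurableSet_Ioi).2 (ae_of_all _ hpos)) hint]
    refine lt_of_lt_of_le ?_ (measure_mono (s := Metric.ball (2 : ℝ) η.rOut) ?_)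
    · exact Metric.measure_ball_pos _ _ η.rOut_pos
    · intro t ht
      rw [← η.support_eq] at ht
      have ht1 : 0 < t := one_pos.trans (hsub ht).1
      refine ⟨?_, ht1⟩
      simp only [hk, Function.mem_support]
      have : η t ≠ 0 := ht
      positivity
  rw [e1, e2, ← mul_neg] at key
  exact mul_left_cancel₀ hc0.ne' key

end Cone

end SphericalNeumann

namespace SphericalNeumann

/-! ### An abstract spectral gap: the first eigenvalue of a closed, compactly embedded relation -/

section Hilbert

variable {X Y : Type} [NormedAddCommGroup X] [InnerProductSpace ℝ X] [CompleteSpace X]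
  [NormedAddCommGroup Y] [InnerProductSpace ℝ Y] [CompleteSpace Y] {W : Submodule ℝ (X × Y)}

/-- Compactness of the first projection of `W` on sets bounded in both components, in the form of
an estimate by finitely many functionals. -/
def IsCompactlyEmbedded (W : Submodule ℝ (X × Y)) : Prop :=
  ∀ ε : ℝ, 0 < ε → ∃ (ι : Type) (_ : Fintype ι) (f : ι → X) (c : ℝ), 0 ≤ c ∧
    ∀ w ∈ W, ‖w.1‖ ^ 2 ≤ ε * (‖w.1‖ ^ 2 + ‖w.2‖ ^ 2) + c * ∑ i, ⟪f i, w.1⟫_ℝ ^ 2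

/-- The finitely many functionals send the set into a bounded subset of a finite-dimensional space.
Two points with images in the same small cell are close, by the estimate applied to their
difference. -/
theorem IsCompactlyEmbedded.totallyBounded (h : IsCompactlyEmbedded W) (M : ℝ) :
    TotallyBounded {x : X | ∃ w ∈ W, w.1 = x ∧ ‖w.1‖ ≤ 1 ∧ ‖w.2‖ ≤ M} := by
  set S := {x : X | ∃ w ∈ W, w.1 = x ∧ ‖w.1‖ ≤ 1 ∧ ‖w.2‖ ≤ M}
  refine Metric.totallyBounded_of_finite_discretization fun δ hδ => ?_
  have hB : 0 < 4 + (2 * M) ^ 2 := by positivity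
  -- Differences have components of norm at most 2 and 2M, so this choice makes the first term of
  -- the estimate at most δ² / 2.
  obtain ⟨ι, _, f, c, hc, ht⟩ := h (δ ^ 2 / (2 * (4 + (2 * M) ^ 2))) (by positivity)
  let T : X → (ι → ℝ) := fun x i => ⟪f i, x⟫_ℝ
  have hbd : Bornology.IsBounded (T '' S) := by
    rw [isBounded_iff_forall_norm_le]
    refine ⟨∑ i, ‖f i‖, ?_⟩
    rintro _ ⟨_, ⟨w, -, rfl, hw1, -⟩, rfl⟩
    refine (pi_norm_le_iff_of_nonneg (Finset.sum_nonneg fun _ _ => norm_nonneg _)).2 fun i => ?_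
    calc ‖T w.1 i‖ ≤ ‖f i‖ * ‖w.1‖ := norm_inner_le_norm _ _
      _ ≤ ‖f i‖ * 1 := by gcongr
      _ ≤ ∑ i, ‖f i‖ := by
        rw [mul_one]
        exact Finset.single_le_sum (f := fun i => ‖f i‖) (fun _ _ => norm_nonneg _) (Finset.mem_univ i)
  obtain ⟨η, hη, hηc⟩ : ∃ η : ℝ, 0 < η ∧ c * (Fintype.card ι * (2 * η) ^ 2) < δ ^ 2 / 2 := by
    have h0 : Tendsto (fun η : ℝ => c * (Fintype.card ι * (2 * η) ^ 2)) (𝓝[>] 0) (𝓝 0) := by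
      refine Tendsto.mono_left ?_ nhdsWithin_le_nhds
      have : Continuous fun η : ℝ => c * (Fintype.card ι * (2 * η) ^ 2) := by fun_prop
      simpa using this.tendsto 0
    exact ((eventually_mem_nhdsWithin (s := Ioi (0 : ℝ))).and
      (h0.eventually (gt_mem_nhds (by positivity)))).exists
  obtain ⟨A, hA, hAS⟩ := Metric.totallyBounded_iff.1
    (hbd.isCompact_closure.totallyBounded.subset subset_closure) η hη
  have hF : ∀ x : S, ∃ a : A, T x ∈ Metric.ball (a : ι → ℝ) η := fun x => by
    obtain ⟨a, ha, hxa⟩ := mem_iUnion₂.1 (hAS (mem_image_of_mem T x.2))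
    exact ⟨⟨a, ha⟩, hxa⟩
  choose F hF using hF
  refine ⟨A, hA.fintype, F, fun x y hxy => ?_⟩
  have h1 : dist (T x) (T y) < 2 * η := by
    have h2 := hF y
    have h3 := hF x
    rw [← hxy, Metric.mem_ball, dist_comm] at h2
    rw [Metric.mem_ball] at h3
    linarith [dist_triangle (T x) (F x) (T y)]
  obtain ⟨⟨_, w, hw, rfl, hw1, hw2⟩, _, w', hw', rfl, hw1', hw2'⟩ := x, y
  have h2 := ht (w - w') (W.sub_mem hw hw')
  have h3 : ∑ i, ⟪f i, (w - w').1⟫_ℝ ^ 2 ≤ Fintype.card ι * (2 * η) ^ 2 := by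
    rw [← nsmul_eq_mul, ← Finset.card_univ]
    refine Finset.sum_le_card_nsmul _ _ _ fun i _ => ?_
    have := (dist_le_pi_dist (T w.1) (T w'.1) i).trans h1.le
    rw [Real.dist_eq] at this
    rw [Prod.fst_sub, inner_sub_right]
    exact sq_le_sq' (by linarith [neg_abs_le (T w.1 i - T w'.1 i)])
      ((le_abs_self _).trans this)
  have h4 : ‖(w - w').1‖ ≤ 2 := by
    rw [Prod.fst_sub]
    linarith [norm_sub_le w.1 w'.1]
  have h5 : ‖(w - w').2‖ ≤ 2 * M := by
    rw [Prod.snd_sub]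
    linarith [norm_sub_le w.2 w'.2]
  have h6 : ‖(w - w').1‖ ^ 2 + ‖(w - w').2‖ ^ 2 ≤ 4 + (2 * M) ^ 2 := by
    have := pow_le_pow_left₀ (norm_nonneg _) h4 2
    have := pow_le_pow_left₀ (norm_nonneg _) h5 2
    linarith
  have h7 : ‖(w - w').1‖ ^ 2 < δ ^ 2 := by
    calc ‖(w - w').1‖ ^ 2 ≤ δ ^ 2 / (2 * (4 + (2 * M) ^ 2)) * (4 + (2 * M) ^ 2) +
          c * (Fintype.card ι * (2 * η) ^ 2) := h2.trans (by gcongr)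
      _ < δ ^ 2 / 2 + δ ^ 2 / 2 := by
        refine add_lt_add_of_le_of_lt (le_of_eq ?_) hηc
        field_simp
      _ = δ ^ 2 := by ring
  rw [dist_eq_norm]
  exact lt_of_pow_lt_pow_left₀ 2 hδ.le h7

/-- The first positive eigenvalue of a closed, compactly embedded relation `W` whose kernel is
spanned by a vector `e`: it is attained and is the optimal constant in the Poincaré inequality. -/
theorem exists_first_eigenpair (hW : IsClosed (W : Set (X × Y))) (hcpt : IsCompactlyEmbedded W)
    {e : X} (he : (e, 0) ∈ W) (hker : ∀ u : X, (u, 0) ∈ W → ∃ c : ℝ, u = c • e)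
    (hne : ∃ w ∈ W, ∀ c : ℝ, w.1 ≠ c • e) :
    ∃ R : ℝ, 0 < R ∧ (∃ w ∈ W, w.1 ≠ 0 ∧ ⟪w.1, e⟫_ℝ = 0 ∧
        ∀ v ∈ W, ⟪w.2, v.2⟫_ℝ = R * ⟪w.1, v.1⟫_ℝ) ∧
      ∀ v ∈ W, ∃ c : ℝ, ⟪v.1 - c • e, e⟫_ℝ = 0 ∧ R * ‖v.1 - c • e‖ ^ 2 ≤ ‖v.2‖ ^ 2 := by
  set P : Set (X × Y) := {w | w ∈ W ∧ ⟪w.1, e⟫_ℝ = 0 ∧ ‖w.1‖ = 1} with hP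
  have hproj : ∀ v : X, ∃ c : ℝ, ⟪v - c • e, e⟫_ℝ = 0 := by
    intro v
    refine ⟨⟪v, e⟫_ℝ / ⟪e, e⟫_ℝ, ?_⟩
    rcases eq_or_ne e 0 with rfl | h0
    · simp
    · rw [inner_sub_left, real_inner_smul_left, div_mul_cancel₀ _ (inner_self_ne_zero.2 h0), sub_self]
  have hsub : ∀ v ∈ W, ∀ c : ℝ, (v.1 - c • e, v.2) ∈ W := by
    intro v hv c
    have h := W.sub_mem hv (W.smul_mem c he)
    have h2 : v - c • (e, (0 : Y)) = (v.1 - c • e, v.2) := by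
      ext <;> simp
    rwa [h2] at h
  have hPne : P.Nonempty := by
    obtain ⟨w, hw, hwe⟩ := hne
    obtain ⟨c, hc⟩ := hproj w.1
    have h0 : ‖w.1 - c • e‖ ≠ 0 := norm_ne_zero_iff.2 (sub_ne_zero.2 (hwe c))
    refine ⟨‖w.1 - c • e‖⁻¹ • (w.1 - c • e, w.2), W.smul_mem _ (hsub w hw c), ?_, ?_⟩
    · simp only [Prod.smul_fst, real_inner_smul_left, hc, mul_zero]
    · simp only [Prod.smul_fst, norm_smul, norm_inv, norm_norm, inv_mul_cancel₀ h0]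
  set R : ℝ := sInf ((fun w : X × Y => ‖w.2‖ ^ 2) '' P) with hR
  have hbdd : BddBelow ((fun w : X × Y => ‖w.2‖ ^ 2) '' P) :=
    ⟨0, by rintro _ ⟨w, -, rfl⟩; positivity⟩
  have hRP : ∀ w ∈ P, R ≤ ‖w.2‖ ^ 2 := fun w hw => csInf_le hbdd (mem_image_of_mem _ hw)
  -- By scaling, the infimum over normalized elements becomes an inequality for all elements
  -- orthogonal to e.
  have hRle : ∀ v ∈ W, ⟪v.1, e⟫_ℝ = 0 → R * ‖v.1‖ ^ 2 ≤ ‖v.2‖ ^ 2 := by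
    intro v hv hve
    rcases eq_or_ne v.1 0 with h0 | h0
    · rw [h0]
      simp
    have h0' : ‖v.1‖ ≠ 0 := norm_ne_zero_iff.2 h0
    have := hRP (‖v.1‖⁻¹ • v) ⟨W.smul_mem _ hv, by
      simp only [Prod.smul_fst, real_inner_smul_left, hve, mul_zero], by
      simp only [Prod.smul_fst, norm_smul, norm_inv, norm_norm, inv_mul_cancel₀ h0']⟩
    rw [Prod.smul_snd, norm_smul, norm_inv, norm_norm, mul_pow, inv_pow, inv_mul_eq_div,
      le_div_iff₀ (by positivity)] at this
    exact this
  have hR0 : 0 ≤ R := le_csInf (hPne.image _) (by rintro _ ⟨w, -, rfl⟩; positivity)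
  obtain ⟨s, -, hs, hsP⟩ := exists_seq_tendsto_sInf (hPne.image fun w : X × Y => ‖w.2‖ ^ 2) hbdd
  choose w hwP hws using hsP
  have hlim : Tendsto (fun n => ‖(w n).2‖ ^ 2) atTop (𝓝 R) := by
    refine hs.congr fun n => (hws n).symm
  obtain ⟨M, hM⟩ : ∃ M : ℝ, ∀ n, ‖(w n).2‖ ≤ M := by
    obtain ⟨B, hB⟩ := hlim.bddAbove_range
    refine ⟨√B, fun n => Real.le_sqrt_of_sq_le (hB ⟨n, rfl⟩)⟩
  obtain ⟨u, -, φ, hφ, hu⟩ := (hcpt.totallyBounded M).closure.isCompact_of_isClosed isClosed_closure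
    |>.tendsto_subseq (x := fun n => (w n).1) fun n =>
      subset_closure ⟨w n, (hwP n).1, rfl, (hwP n).2.2.le, hM n⟩
  have hlimφ := hlim.comp hφ.tendsto_atTop
  have hcauchy : CauchySeq fun n => (w (φ n)).2 := by
    -- Parallelogram law in both components: the Rayleigh bound for the sum of two minimizers
    -- controls their difference, so convergence of the first components forces that of the second.
    have key : ∀ m n, ‖(w (φ m)).2 - (w (φ n)).2‖ ^ 2 ≤
        2 * (‖(w (φ m)).2‖ ^ 2 - R) + 2 * (‖(w (φ n)).2‖ ^ 2 - R) +
          R * ‖(w (φ m)).1 - (w (φ n)).1‖ ^ 2 := by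
      intro m n
      have h1 := parallelogram_law_with_norm ℝ (w (φ m)).2 (w (φ n)).2
      have h2 := parallelogram_law_with_norm ℝ (w (φ m)).1 (w (φ n)).1
      have h3 := hRle (w (φ m) + w (φ n)) (W.add_mem (hwP _).1 (hwP _).1) (by
        rw [Prod.fst_add, inner_add_left, (hwP _).2.1, (hwP _).2.1, add_zero])
      rw [(hwP (φ m)).2.2, (hwP (φ n)).2.2] at h2
      rw [Prod.fst_add, Prod.snd_add] at h3
      nlinarith
    rw [Metric.cauchySeq_iff']
    intro δ hδ
    have hu' := hu.cauchySeq
    rw [Metric.cauchySeq_iff] at hu'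
    -- This bound contributes less than δ² / 4 and the two energy excesses together less than δ² /
    -- 2.
    obtain ⟨N1, hN1⟩ := hu' (δ / (2 * (R + 1))) (by positivity)
    have h4 : ∀ᶠ n in atTop, ‖(w (φ n)).2‖ ^ 2 < R + δ ^ 2 / 8 :=
      hlimφ.eventually (gt_mem_nhds (by have : 0 < δ ^ 2 := by positivity
                                        linarith))
    obtain ⟨N2, hN2⟩ := eventually_atTop.1 h4
    refine ⟨max N1 N2, fun n hn => ?_⟩
    rw [dist_eq_norm]
    refine lt_of_pow_lt_pow_left₀ 2 hδ.le ((key n (max N1 N2)).trans_lt ?_)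
    have h5 := hN2 n ((le_max_right _ _).trans hn)
    have h6 := hN2 (max N1 N2) (le_max_right _ _)
    have h7 := hN1 n ((le_max_left _ _).trans hn) (max N1 N2) (le_max_left _ _)
    rw [dist_eq_norm, lt_div_iff₀ (by positivity)] at h7
    simp only [Function.comp_apply] at h7
    set a := ‖(w (φ n)).1 - (w (φ (max N1 N2))).1‖
    have ha : 0 ≤ a := norm_nonneg _
    have h8 : (a * (2 * (R + 1))) ^ 2 < δ ^ 2 := by gcongr
    have h9 : R * a ^ 2 ≤ (R + 1) ^ 2 * a ^ 2 := by
      gcongr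
      nlinarith
    nlinarith
  obtain ⟨G, hG⟩ := cauchySeq_tendsto_of_complete hcauchy
  have hmem : (u, G) ∈ W :=
    hW.mem_of_tendsto (hu.prodMk_nhds hG) (Eventually.of_forall fun n => (hwP _).1)
  have hue : ⟪u, e⟫_ℝ = 0 := by
    have h1 : Tendsto (fun n => ⟪(w (φ n)).1, e⟫_ℝ) atTop (𝓝 ⟪u, e⟫_ℝ) := hu.inner tendsto_const_nhds
    simp only [(hwP _).2.1] at h1
    exact (tendsto_nhds_unique h1 tendsto_const_nhds)
  have hu1 : ‖u‖ = 1 := by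
    have h1 := hu.norm
    simp only [Function.comp_def, (hwP _).2.2] at h1
    exact (tendsto_nhds_unique h1 tendsto_const_nhds)
  have hGR : ‖G‖ ^ 2 = R := tendsto_nhds_unique (hG.norm.pow 2) hlimφ
  have hu0 : u ≠ 0 := by
    rw [← norm_ne_zero_iff, hu1]
    exact one_ne_zero
  -- If R were 0, the minimizer would lie in the kernel and be a multiple of e, while being a unit
  -- vector orthogonal to e.
  have hRpos : 0 < R := by
    refine lt_of_le_of_ne hR0 fun h0 => ?_
    rw [← h0] at hGR
    have hG0 : G = 0 := by simpa using hGR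
    rw [hG0] at hmem
    obtain ⟨c, hc⟩ := hker u hmem
    apply hu0
    rw [← inner_self_eq_zero (𝕜 := ℝ)]
    nth_rewrite 2 [hc]
    rw [real_inner_smul_right, hue, mul_zero]
  have hEuler : ∀ v ∈ W, ⟪v.1, e⟫_ℝ = 0 → ⟪G, v.2⟫_ℝ = R * ⟪u, v.1⟫_ℝ := by
    intro v hv hve
    -- The excess of the Rayleigh inequality at u + t v is a nonnegative quadratic in t without
    -- constant term; its discriminant forces the linear coefficient to vanish.
    have hq : ∀ t : ℝ, 0 ≤ (‖v.2‖ ^ 2 - R * ‖v.1‖ ^ 2) * (t * t) +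
        (2 * (⟪G, v.2⟫_ℝ - R * ⟪u, v.1⟫_ℝ)) * t + 0 := by
      intro t
      have h1 := hRle ((u, G) + t • v) (W.add_mem hmem (W.smul_mem t hv)) (by
        simp [inner_add_left, real_inner_smul_left, hue, hve])
      simp only [Prod.fst_add, Prod.snd_add, Prod.smul_fst, Prod.smul_snd] at h1
      rw [norm_add_sq_real, norm_add_sq_real, real_inner_smul_right, real_inner_smul_right,
        norm_smul, norm_smul, mul_pow, mul_pow, hGR, hu1, Real.norm_eq_abs, sq_abs] at h1
      nlinarith
    have h2 := discrim_le_zero hq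
    rw [discrim] at h2
    nlinarith [sq_nonneg (⟪G, v.2⟫_ℝ - R * ⟪u, v.1⟫_ℝ)]
  refine ⟨R, hRpos, ⟨(u, G), hmem, hu0, hue, fun v hv => ?_⟩, fun v hv => ?_⟩
  · obtain ⟨c, hc⟩ := hproj v.1
    -- Subtracting a multiple of e changes neither the second component nor the pairing with u.
    have := hEuler _ (hsub v hv c) hc
    simpa [inner_sub_right, real_inner_smul_right, hue] using this
  · obtain ⟨c, hc⟩ := hproj v.1
    exact ⟨c, hc, hRle _ (hsub v hv c) hc⟩

end Hilbert

end SphericalNeumann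

namespace SphericalNeumann

/-! ### The Sobolev space of a subset of the sphere as a closed subspace -/

theorem inner_toLp_left {Z F : Type*} [MeasurableSpace Z] {μ : Measure Z} [NormedAddCommGroup F]
    [InnerProductSpace ℝ F] {f : Z → F} (hf : MemLp f 2 μ) (w : Lp F 2 μ) :
    ⟪hf.toLp f, w⟫_ℝ = ∫ x, ⟪f x, w x⟫_ℝ ∂μ := by
  rw [integral_inner_eq_inner_toLp hf (Lp.memLp w), Lp.toLp_coeFn]

section SobolevSpace

variable {N : ℕ} [NeZero N] {D : Set (Sph N)}

theorem HasSobolevGradient.congr_ae {u v : Sph N → ℝ} {G H : Sph N → Amb N}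
    (h : HasSobolevGradient D u G) (huv : u =ᵐ[(surf N).restrict D] v)
    (hGH : G =ᵐ[(surf N).restrict D] H) : HasSobolevGradient D v H := by
  refine ⟨h.memLp.ae_eq huv, h.memLp_grad.ae_eq hGH, ?_, fun X hX => ?_⟩
  · filter_upwards [h.tangent, hGH] with p h1 h2
    rwa [← h2]
  · have h1 := h.weak_gradient X hX
    have h2 : ∫ p in D, v p * sphDiv X p ∂surf N = ∫ p in D, u p * sphDiv X p ∂surf N := by
      refine integral_congr_ae ?_
      filter_upwards [huv] with p hp
      rw [hp]
    have h3 : ∫ p in D, ⟪H p, X p⟫_ℝ ∂surf N = ∫ p in D, ⟪G p, X p⟫_ℝ ∂surf N := by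
      refine integral_congr_ae ?_
      filter_upwards [hGH] with p hp
      rw [hp]
    rw [h2, h3, h1]

theorem memLp_of_continuous_sph {F : Type*} [NormedAddCommGroup F]
    [SecondCountableTopologyEither (Sph N) F] {g : Sph N → F} (hg : Continuous g) :
    MemLp g 2 ((surf N).restrict D) := by
  obtain ⟨C, hC⟩ := isCompact_univ.exists_bound_of_continuousOn (f := g) hg.continuousOn
  exact MemLp.of_bound hg.aestronglyMeasurable C (ae_of_all _ fun p => hC p (mem_univ p))

theorem IsTestField.memLp_sphDiv {X : Amb N → Amb N} (hX : IsTestField D X) :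
    MemLp (sphDiv X : Sph N → ℝ) 2 ((surf N).restrict D) :=
  memLp_of_continuous_sph (continuous_sphDiv hX.smooth)

theorem IsTestField.memLp {X : Amb N → Amb N} (hX : IsTestField D X) :
    MemLp (fun p : Sph N => X p) 2 ((surf N).restrict D) :=
  memLp_of_continuous_sph (hX.smooth.continuous.comp continuous_subtype_val)

variable (D) in
/-- The graph of the weak gradient of `H¹(D)`. -/
noncomputable def sobolevGraph : Submodule ℝ
    (Lp ℝ 2 ((surf N).restrict D) × Lp (Amb N) 2 ((surf N).restrict D)) where
  -- Tangency is stated as orthogonality to all normal fields, so that both conditions are visibly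
  -- closed in L².
  carrier := {w | (∀ (g : Sph N → ℝ)
      (hg : MemLp (fun p => g p • (p : Amb N)) 2 ((surf N).restrict D)), ⟪hg.toLp _, w.2⟫_ℝ = 0) ∧
    ∀ (X : Amb N → Amb N) (hX : IsTestField D X),
      ⟪hX.memLp_sphDiv.toLp _, w.1⟫_ℝ = - ⟪hX.memLp.toLp _, w.2⟫_ℝ}
  zero_mem' := by simp
  add_mem' := by
    rintro v w ⟨hv1, hv2⟩ ⟨hw1, hw2⟩
    refine ⟨fun g hg => ?_, fun X hX => ?_⟩
    · rw [Prod.snd_add, inner_add_right, hv1, hw1, add_zero]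
    · rw [Prod.snd_add, Prod.fst_add, inner_add_right, inner_add_right, hv2 X hX, hw2 X hX, neg_add]
  smul_mem' := by
    rintro c v ⟨hv1, hv2⟩
    refine ⟨fun g hg => ?_, fun X hX => ?_⟩
    · rw [Prod.smul_snd, real_inner_smul_right, hv1, mul_zero]
    · rw [Prod.smul_snd, Prod.smul_fst, real_inner_smul_right, real_inner_smul_right, hv2 X hX,
        mul_neg]

theorem isClosed_sobolevGraph : IsClosed (sobolevGraph D : Set
    (Lp ℝ 2 ((surf N).restrict D) × Lp (Amb N) 2 ((surf N).restrict D))) := by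
  refine IsClosed.inter (s₁ := {w : Lp ℝ 2 ((surf N).restrict D) × Lp (Amb N) 2 ((surf N).restrict D) | ∀ (g : Sph N → ℝ)
      (hg : MemLp (fun p => g p • (p : Amb N)) 2 ((surf N).restrict D)), ⟪hg.toLp _, w.2⟫_ℝ = 0})
    (s₂ := {w : Lp ℝ 2 ((surf N).restrict D) × Lp (Amb N) 2 ((surf N).restrict D) | ∀ (X : Amb N → Amb N) (hX : IsTestField D X),
      ⟪hX.memLp_sphDiv.toLp _, w.1⟫_ℝ = - ⟪hX.memLp.toLp _, w.2⟫_ℝ}) ?_ ?_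
  · simp only [ofPred_forall]
    exact isClosed_iInter fun g => isClosed_iInter fun hg =>
      isClosed_eq (by fun_prop) continuous_const
  · simp only [ofPred_forall]
    exact isClosed_iInter fun g => isClosed_iInter fun hg =>
      isClosed_eq (by fun_prop) (by fun_prop)

theorem mem_sobolevGraph_iff
    {w : Lp ℝ 2 ((surf N).restrict D) × Lp (Amb N) 2 ((surf N).restrict D)} :
    w ∈ sobolevGraph D ↔ HasSobolevGradient D w.1 w.2 := by
  have hw := Lp.memLp w.2
  constructor
  · rintro ⟨h1, h2⟩
    refine ⟨Lp.memLp _, hw, ?_, fun X hX => ?_⟩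
    -- The normal component of the gradient is itself an admissible normal field; testing with it
    -- shows that its square integrates to zero.
    · have hg : MemLp (fun p : Sph N => ⟪(p : Amb N), w.2 p⟫_ℝ • (p : Amb N)) 2
          ((surf N).restrict D) := by
        refine MemLp.of_le hw ?_ (ae_of_all _ fun p => ?_)
        · exact (continuous_subtype_val.aestronglyMeasurable.inner (𝕜 := ℝ) hw.1).smul
            continuous_subtype_val.aestronglyMeasurable
        · rw [norm_smul, norm_coe_sph, mul_one]
          simpa using norm_inner_le_norm (𝕜 := ℝ) (p : Amb N) (w.2 p)
      have h3 := h1 _ hg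
      rw [inner_toLp_left] at h3
      have h4 : ∀ p : Sph N, ⟪⟪(p : Amb N), w.2 p⟫_ℝ • (p : Amb N), w.2 p⟫_ℝ =
          ⟪(p : Amb N), w.2 p⟫_ℝ ^ 2 := fun p => by rw [real_inner_smul_left, sq]
      have h5 := integrable_inner_of_memLp hg hw
      simp only [h4] at h3 h5
      rw [integral_eq_zero_iff_of_nonneg (fun p => sq_nonneg _) h5] at h3
      filter_upwards [h3] with p hp
      simpa using hp
    · have h3 := h2 X hX
      rw [inner_toLp_left, inner_toLp_left] at h3
      simpa [real_inner_comm, mul_comm] using h3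
  · intro h
    refine ⟨fun g hg => ?_, fun X hX => ?_⟩
    · rw [inner_toLp_left]
      refine integral_eq_zero_of_ae ?_
      filter_upwards [h.tangent] with p hp
      rw [real_inner_smul_left, hp, mul_zero, Pi.zero_apply]
    · have h3 := h.weak_gradient X hX
      rw [inner_toLp_left, inner_toLp_left]
      simpa [real_inner_comm, mul_comm] using h3

theorem HasSobolevGradient.toLp_mem {u : Sph N → ℝ} {G : Sph N → Amb N}
    (h : HasSobolevGradient D u G) :
    (h.memLp.toLp u, h.memLp_grad.toLp G) ∈ sobolevGraph D :=
  mem_sobolevGraph_iff.2 (h.congr_ae h.memLp.coeFn_toLp.symm h.memLp_grad.coeFn_toLp.symm)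

/-! ### Homogeneous extension to a truncated cone -/

/-- Homogeneous extension of `g`, weighted by a radial factor and cut off to `1/2 < ‖x‖ < 4`. -/
noncomputable def annularExtension {F : Type*} [NormedAddCommGroup F] [NormedSpace ℝ F]
    (D : Set (Sph N)) (m : ℝ → ℝ) (g : Sph N → F) (x : Amb N) : F :=
  (Ioo (1 / 2 : ℝ) 4).indicator m ‖x‖ • D.indicator g (dir x)

/-- The radial weight of `annularExtension`. -/
noncomputable def annularWeight (N : ℕ) (m : ℝ → ℝ) : ℝ :=
  ∫ t in Ioi (0 : ℝ), t ^ (N - 1) * (Ioo (1 / 2 : ℝ) 4).indicator (fun t => m t ^ 2) t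

theorem annularWeight_nonneg (m : ℝ → ℝ) : 0 ≤ annularWeight N m := by
  refine setIntegral_nonneg measurableSet_Ioi fun t ht => ?_
  refine mul_nonneg (pow_nonneg (le_of_lt ht) _) (indicator_nonneg (fun t _ => sq_nonneg _) t)

variable {F : Type*} [NormedAddCommGroup F] [NormedSpace ℝ F] {m : ℝ → ℝ} {g : Sph N → F}

theorem norm_annularExtension_sq (x : Amb N) : ‖annularExtension D m g x‖ ^ 2 =
    (Ioo (1 / 2 : ℝ) 4).indicator (fun t => m t ^ 2) ‖x‖ *
      D.indicator (fun p => ‖g p‖ ^ 2) (dir x) := by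
  rw [annularExtension, norm_smul, mul_pow]
  congr 1
  · by_cases h : ‖x‖ ∈ Ioo (1 / 2 : ℝ) 4
    · simp only [indicator_of_mem h, Real.norm_eq_abs, sq_abs]
    · rw [indicator_of_notMem h, indicator_of_notMem h, norm_zero, zero_pow two_ne_zero]
  · by_cases h : dir x ∈ D <;> simp [h]

theorem integral_norm_annularExtension_sq (hD : MeasurableSet D)
    (hg : MemLp g 2 ((surf N).restrict D)) (hm : ContinuousOn m (Icc (1 / 2) 4)) :
    ∫ x, ‖annularExtension D m g x‖ ^ 2 =
      annularWeight N m * ∫ p in D, ‖g p‖ ^ 2 ∂surf N := by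
  simp only [norm_annularExtension_sq]
  rw [integral_radial_mul (measurable_indicator_Ioo_of_continuousOn (k := fun t => m t ^ 2)
    (hm.pow 2)) ?_,
    integral_indicator hD, annularWeight]
  rw [aestronglyMeasurable_indicator_iff hD]
  exact hg.1.norm.pow 2

theorem memLp_annularExtension (hD : MeasurableSet D)
    (hg : MemLp g 2 ((surf N).restrict D)) (hm : ContinuousOn m (Icc (1 / 2) 4)) :
    MemLp (annularExtension D m g) 2 := by
  have h1 : AEStronglyMeasurable (annularExtension D m g) volume :=
    ((measurable_indicator_Ioo_of_continuousOn hm).comp measurable_norm).aestronglyMeasurable.smul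
      (((aestronglyMeasurable_indicator_iff hD).2 hg.1).comp_quasiMeasurePreserving
        quasiMeasurePreserving_dir)
  rw [memLp_two_iff_integrable_sq_norm h1]
  simp only [norm_annularExtension_sq]
  refine integrable_radial_mul (integrableOn_pow_mul_indicator_Ioo _ (hm.pow 2)) ?_
  rw [integrable_indicator_iff hD]
  exact (memLp_two_iff_integrable_sq_norm hg.1).1 hg

variable (D) in
/-- The part of the cone over `D` between the spheres of radius `1/2` and `4`. -/
def truncatedCone : Set (Amb N) := {x | x ∈ cone D ∧ ‖x‖ ∈ Ioo (1 / 2 : ℝ) 4}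

theorem isOpen_truncatedCone (hD : IsOpen D) : IsOpen (truncatedCone D) :=
  (isOpen_cone hD).inter (isOpen_Ioo.preimage continuous_norm)

theorem continuousOn_inv_Icc : ContinuousOn (fun t : ℝ => t⁻¹) (Icc (1 / 2) 4) :=
  continuousOn_inv₀.mono fun t ht => by
    have : (1 / 2 : ℝ) ≤ t := ht.1
    exact (by linarith : (0 : ℝ) < t).ne'

/-- The weights 1 and t⁻¹ are the degrees of homogeneity of a function and of its gradient. The
radial truncation makes both extensions square integrable, and inside the truncated cone it changes
nothing. -/
theorem HasSobolevGradient.isSobolevPair (hN : 2 ≤ N) (hD : IsOpen D) {u : Sph N → ℝ}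
    {G : Sph N → Amb N} (h : HasSobolevGradient D u G) (hu : Measurable u) :
    IsSobolevPair (truncatedCone D) (annularExtension D (fun _ => 1) u)
      (annularExtension D (fun t => t⁻¹) G) := by
  refine ⟨?_, memLp_annularExtension hD.measurableSet h.memLp continuousOn_const,
    memLp_annularExtension hD.measurableSet h.memLp_grad continuousOn_inv_Icc, ?_⟩
  · exact ((measurable_indicator_Ioo_of_continuousOn continuousOn_const).comp measurable_norm).smul
      ((hu.indicator hD.measurableSet).comp measurable_dir)
  · refine ((h.hasWeakGradient hN hD.measurableSet).mono fun x hx => hx.1).congr ?_ ?_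
    · rintro x ⟨hx, hx'⟩
      rw [annularExtension, indicator_of_mem hx', indicator_of_mem hx.2, one_smul]
    · rintro x ⟨hx, hx'⟩
      rw [annularExtension, indicator_of_mem hx', indicator_of_mem hx.2]

end SobolevSpace

end SphericalNeumann

namespace SphericalNeumann

/-! ### Compactness and connectedness for smooth domains of the sphere -/

section Smooth

variable {N : ℕ} [NeZero N] {D : Set (Sph N)}

/-- Radii in [1, 2] stay away from the spherical caps at 1/2 and 4, so only the lateral boundary is
met. There f(x / ‖x‖) is a defining function, and its derivative along the tangent vector v is a
nonzero multiple of that of f. -/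
theorem IsSmoothDomain.isRegularBoundaryPoint (hD : IsSmoothDomain D) {x : Amb N}
    (hx : ‖x‖ ∈ Icc (1 : ℝ) 2) (hxf : x ∈ frontier (truncatedCone D)) :
    IsRegularBoundaryPoint (truncatedCone D) x := by
  have hx0 : x ≠ 0 := by
    rintro rfl
    rw [norm_zero] at hx
    linarith [hx.1]
  have hxI : ‖x‖ ∈ Ioo (1 / 2 : ℝ) 4 := ⟨by linarith [hx.1], by linarith [hx.2]⟩
  set p : Sph N := dir x with hp
  have hpD : p ∈ frontier D := by
    rw [hD.isOpen.frontier_eq]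
    rw [(isOpen_truncatedCone hD.isOpen).frontier_eq] at hxf
    refine ⟨?_, fun h => hxf.2 ⟨⟨hx0, h⟩, hxI⟩⟩
    rw [mem_closure_iff_nhds]
    intro V hV
    obtain ⟨y, hy1, hy2⟩ := mem_closure_iff_nhds.1 hxf.1 _
      ((continuousAt_dir hx0).preimage_mem_nhds hV)
    exact ⟨dir y, hy1, hy2.1.2⟩
  obtain ⟨U, f, hU, hpU, hf, -, ⟨v, hv, hfv⟩, hfD⟩ := hD.smooth_boundary p hpD
  have hc : ContinuousOn (fun y : Amb N => ‖y‖⁻¹ • y) {y | ‖y‖ ∈ Ioo (1 / 2 : ℝ) 4} := by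
    intro y hy
    have hy0 : ‖y‖ ≠ 0 := by
      have : (1 / 2 : ℝ) < ‖y‖ := hy.1
      linarith
    exact ContinuousAt.continuousWithinAt (by fun_prop (disch := assumption))
  have hO : IsOpen {y : Amb N | ‖y‖ ∈ Ioo (1 / 2 : ℝ) 4} := isOpen_Ioo.preimage continuous_norm
  have hne : ∀ y : Amb N, ‖y‖ ∈ Ioo (1 / 2 : ℝ) 4 → y ≠ 0 := by
    rintro y hy rfl
    rw [norm_zero] at hy
    linarith [hy.1]
  refine ⟨{y | ‖y‖ ∈ Ioo (1 / 2 : ℝ) 4} ∩ (fun y : Amb N => ‖y‖⁻¹ • y) ⁻¹' U,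
    fun y => f (‖y‖⁻¹ • y), v, hc.isOpen_inter_preimage hO hU, ⟨hxI, ?_⟩, ?_, ?_, ?_⟩
  · rwa [mem_preimage, ← coe_dir hx0]
  · refine (hf.of_le (by exact_mod_cast le_top)).comp (t := U) (fun y hy => ?_) fun y hy => hy.2
    have h0 := hne y hy.1
    exact (((contDiffAt_norm ℝ h0).inv (norm_ne_zero_iff.2 h0)).smul contDiffAt_id).contDiffWithinAt
  · have hfd : DifferentiableAt ℝ f ((fun y : Amb N => ‖y‖⁻¹ • y) x) := by
      simp only [← coe_dir hx0]
      exact (hf.contDiffAt (hU.mem_nhds hpU)).differentiableAt (by simp)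
    have h1 := HasFDerivAt.comp (f := fun y : Amb N => ‖y‖⁻¹ • y) x hfd.hasFDerivAt
      (hasFDerivAt_norm_inv_smul hx0)
    have h2 : fderiv ℝ (fun y : Amb N => f (‖y‖⁻¹ • y)) x v = _ := congrArg (fun L => L v) h1.fderiv
    rw [h2]
    simp only [← coe_dir hx0, ContinuousLinearMap.comp_apply, smul_apply, sub_apply,
      ContinuousLinearMap.id_apply, ContinuousLinearMap.smulRight_apply, innerSL_apply_apply]
    rw [← hp, hv, zero_smul, sub_zero, map_smul, smul_eq_mul]
    exact mul_ne_zero (inv_ne_zero (norm_ne_zero_iff.2 hx0)) hfv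
  · rintro y ⟨hy, hyU⟩
    have h0 := hne y hy
    have h1 := hfD (dir y) (by rw [coe_dir h0]; exact hyU)
    rw [coe_dir h0] at h1
    exact ⟨fun h => h1.1 h.1.2, fun h => ⟨⟨h0, h1.2 h⟩, hy⟩⟩

variable (N) in
/-- The kernel of the functional `u ↦ ∫_{ball y r} u(x/‖x‖)` over `1/2 < ‖x‖ < 4`. -/
noncomputable def ballWeight (y : Amb N) (r : ℝ) (p : Sph N) : ℝ :=
  ∫ t in Ioi (0 : ℝ), t ^ (N - 1) * ((Ioo (1 / 2 : ℝ) 4).indicator (fun _ => 1) t *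
    (Metric.ball y r).indicator (fun _ => 1) (t • (p : Amb N)))

theorem memLp_ballWeight (y : Amb N) (r : ℝ) : MemLp (ballWeight N y r) 2 ((surf N).restrict D) := by
  have hi := integrableOn_pow_mul_indicator_Ioo (a := 1 / 2) (b := 4) (N - 1) (k := fun _ => (1 : ℝ))
    continuousOn_const
  refine MemLp.of_bound (C := ∫ t in Ioi (0 : ℝ), t ^ (N - 1) *
    (Ioo (1 / 2 : ℝ) 4).indicator (fun _ => 1) t) ?_ (ae_of_all _ fun p => ?_)
  · refine StronglyMeasurable.aestronglyMeasurable ?_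
    refine StronglyMeasurable.integral_prod_right (f := fun (p : Sph N) (t : ℝ) => t ^ (N - 1) *
      ((Ioo (1 / 2 : ℝ) 4).indicator (fun _ => 1) t *
      (Metric.ball y r).indicator (fun _ => (1 : ℝ)) (t • (p : Amb N)))) ?_
    refine Measurable.stronglyMeasurable ?_
    refine (measurable_snd.pow_const _).mul (Measurable.mul ?_ ?_)
    · exact (measurable_const.indicator measurableSet_Ioo).comp measurable_snd
    · exact (measurable_const.indicator Metric.isOpen_ball.measurableSet).comp
        (by fun_prop : Measurable fun q : Sph N × ℝ => q.2 • (q.1 : Amb N))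
  · refine norm_integral_le_of_norm_le hi ?_
    filter_upwards [ae_restrict_mem measurableSet_Ioi] with t ht
    have h0 : 0 ≤ t ^ (N - 1) := pow_nonneg (le_of_lt ht) _
    rw [norm_mul, Real.norm_of_nonneg h0]
    refine mul_le_mul_of_nonneg_left ?_ h0
    by_cases h1 : t ∈ Ioo (1 / 2 : ℝ) 4 <;> by_cases h2 : t • (p : Amb N) ∈ Metric.ball y r <;>
      simp only [indicator_of_mem, indicator_of_notMem, h1, h2, not_false_eq_true, mul_one,
        mul_zero, norm_zero, norm_one, le_refl, zero_le_one]

/-- Ball averages of the extension become pairings of u with fixed L² functions on the sphere, the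
form required by `IsCompactlyEmbedded`. -/
theorem setIntegral_ball_annularExtension (hD : MeasurableSet D) {u : Sph N → ℝ}
    (hu : MemLp u 2 ((surf N).restrict D)) (y : Amb N) (r : ℝ) :
    ∫ x in Metric.ball y r, annularExtension D (fun _ => 1) u x =
      ∫ p in D, ballWeight N y r p * u p ∂surf N := by
  have h1 : MemLp (annularExtension D (fun _ => 1) u) 2 :=
    memLp_annularExtension hD hu continuousOn_const
  have h2 : IntegrableOn (annularExtension D (fun _ => 1) u) (Metric.ball y r) := by
    have : IsFiniteMeasure ((volume : Measure (Amb N)).restrict (Metric.ball y r)) :=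
      ⟨by simpa using measure_ball_lt_top⟩
    exact (h1.restrict _).integrable (by norm_num)
  rw [← integral_indicator Metric.isOpen_ball.measurableSet, integral_polar
    ((integrable_indicator_iff Metric.isOpen_ball.measurableSet).2 h2), ← integral_indicator hD]
  refine integral_congr_ae (ae_of_all _ fun p => ?_)
  have h3 : ∀ t ∈ Ioi (0 : ℝ), t ^ (N - 1) • (Metric.ball y r).indicator
      (annularExtension D (fun _ => 1) u) (t • (p : Amb N)) =
      t ^ (N - 1) * ((Ioo (1 / 2 : ℝ) 4).indicator (fun _ => 1) t *
        (Metric.ball y r).indicator (fun _ => 1) (t • (p : Amb N))) * D.indicator u p := by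
    intro t ht
    by_cases h2 : t • (p : Amb N) ∈ Metric.ball y r
    · rw [indicator_of_mem h2, indicator_of_mem h2, annularExtension, norm_smul_sph ht,
        dir_smul_sph ht, smul_eq_mul, smul_eq_mul, mul_one, mul_assoc]
    · rw [indicator_of_notMem h2, indicator_of_notMem h2]
      simp
  simp only
  rw [setIntegral_congr_fun measurableSet_Ioi h3, integral_mul_const]
  by_cases hp : p ∈ D
  · rw [indicator_of_mem hp, indicator_of_mem hp, ballWeight]
  · rw [indicator_of_notMem hp, indicator_of_notMem hp, mul_zero]

/-- In polar coordinates the right side is the left side times ∫₁² t^{N-1} dt, which is at least 1.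
-/
theorem setIntegral_annulus_sq (hD : MeasurableSet D) {u : Sph N → ℝ}
    (hu : MemLp u 2 ((surf N).restrict D)) :
    ∫ p in D, u p ^ 2 ∂surf N ≤ ∫ x in {x : Amb N | ‖x‖ ∈ Icc (1 : ℝ) 2} ∩ truncatedCone D,
      annularExtension D (fun _ => 1) u x ^ 2 := by
  have hm : MeasurableSet ({x : Amb N | ‖x‖ ∈ Icc (1 : ℝ) 2}) :=
    (isClosed_Icc.preimage continuous_norm).measurableSet
  have hm2 : MeasurableSet (truncatedCone D) := by
    refine MeasurableSet.inter (s₁ := cone D) ?_ (isOpen_Ioo.preimage continuous_norm).measurableSet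
    exact (measurableSet_singleton (0 : Amb N)).compl.inter (measurable_dir hD)
  have h1 : ∀ x : Amb N, ({x : Amb N | ‖x‖ ∈ Icc (1 : ℝ) 2} ∩ truncatedCone D).indicator
      (fun x => annularExtension D (fun _ => 1) u x ^ 2) x =
      (Icc (1 : ℝ) 2).indicator (fun _ => 1) ‖x‖ * D.indicator (fun p => u p ^ 2) (dir x) := by
    intro x
    by_cases hx : ‖x‖ ∈ Icc (1 : ℝ) 2
    · have hxI : ‖x‖ ∈ Ioo (1 / 2 : ℝ) 4 := ⟨by linarith [hx.1], by linarith [hx.2]⟩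
      have hx0 : x ≠ 0 := by
        rintro rfl
        rw [norm_zero] at hx
        linarith [hx.1]
      rw [indicator_of_mem hx]
      by_cases hxD : dir x ∈ D
      · have : x ∈ {x : Amb N | ‖x‖ ∈ Icc (1 : ℝ) 2} ∩ truncatedCone D := ⟨hx, ⟨hx0, hxD⟩, hxI⟩
        rw [indicator_of_mem this, indicator_of_mem hxD, annularExtension, indicator_of_mem hxI,
          indicator_of_mem hxD, one_smul, one_mul]
      · rw [indicator_of_notMem (fun h => hxD h.2.1.2), indicator_of_notMem hxD, mul_zero]
    · rw [indicator_of_notMem (fun h => hx h.1), indicator_of_notMem hx, zero_mul]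
  rw [← integral_indicator (hm.inter hm2)]
  simp only [h1]
  rw [integral_radial_mul (measurable_const.indicator measurableSet_Icc) ?_, integral_indicator hD]
  · have hnn : 0 ≤ ∫ p in D, u p ^ 2 ∂surf N := integral_nonneg fun _ => sq_nonneg _
    refine le_mul_of_one_le_left hnn ?_
    have h2 : ∀ t : ℝ, t ^ (N - 1) * (Icc (1 : ℝ) 2).indicator (fun _ => 1) t =
        (Icc (1 : ℝ) 2).indicator (fun t => t ^ (N - 1)) t := fun t => by
      by_cases ht : t ∈ Icc (1 : ℝ) 2
      · rw [indicator_of_mem ht, indicator_of_mem ht, mul_one]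
      · rw [indicator_of_notMem ht, indicator_of_notMem ht, mul_zero]
    simp only [h2]
    have h4 : Ioi (0 : ℝ) ∩ Icc 1 2 = Icc 1 2 :=
      inter_eq_right.2 fun t ht => lt_of_lt_of_le one_pos ht.1
    rw [setIntegral_indicator measurableSet_Icc, h4]
    have h3 : (∫ t in Icc (1 : ℝ) 2, (1 : ℝ)) ≤ ∫ t in Icc (1 : ℝ) 2, t ^ (N - 1) := by
      refine setIntegral_mono_on (by simp) ?_ measurableSet_Icc fun t ht => one_le_pow₀ ht.1
      exact (continuous_pow (N - 1)).continuousOn.integrableOn_compact isCompact_Icc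
    refine le_trans (le_of_eq ?_) h3
    simp
    norm_num
  · rw [aestronglyMeasurable_indicator_iff hD]
    exact hu.1.pow 2

/-- The Euclidean compactness estimate for the truncated cone, applied to the homogeneous extension
on radii in [1, 2]. -/
theorem IsSmoothDomain.isCompactlyEmbedded (hN : 2 ≤ N) (hD : IsSmoothDomain D) :
    IsCompactlyEmbedded (sobolevGraph D) := by
  intro ε hε
  have hDm := hD.isOpen.measurableSet
  set a := annularWeight N (fun _ => 1)
  set b := annularWeight N (fun t => t⁻¹)
  have ha : 0 ≤ a := annularWeight_nonneg _
  have hb : 0 ≤ b := annularWeight_nonneg _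
  have hK : IsCompact {x : Amb N | ‖x‖ ∈ Icc (1 : ℝ) 2} := by
    refine Metric.isCompact_of_isClosed_isBounded (isClosed_Icc.preimage continuous_norm) ?_
    exact (Metric.isBounded_closedBall (x := (0 : Amb N)) (r := 2)).subset fun x hx => by
      simpa using hx.2
  -- The denominator absorbs the radial weights by which the norms of the extensions exceed those on
  -- the sphere.
  obtain ⟨t, r, c, hc, h⟩ := exists_compactness_estimate (isOpen_truncatedCone hD.isOpen) hK
    (fun x hx => hD.isRegularBoundaryPoint hx.1 hx.2) (ε := ε / (a + b + 1)) (by positivity)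
  refine ⟨Fin t.card, inferInstance,
    fun i => (memLp_ballWeight (D := D) (t.equivFin.symm i : Amb N) r).toLp _, c, hc, fun w hw => ?_⟩
  have hw' := mem_sobolevGraph_iff.1 hw
  have h1 := h _ _ (hw'.isSobolevPair hN hD.isOpen (Lp.stronglyMeasurable _).measurable)
  have h2 := integral_norm_annularExtension_sq hDm hw'.memLp (m := fun _ => 1) continuousOn_const
  have h3 := integral_norm_annularExtension_sq hDm hw'.memLp_grad continuousOn_inv_Icc
  have h4 := integral_norm_sq_eq_norm_toLp_sq hw'.memLp
  have h5 := integral_norm_sq_eq_norm_toLp_sq hw'.memLp_grad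
  rw [Lp.toLp_coeFn] at h4 h5
  rw [h4] at h2
  rw [h5] at h3
  have h6 := setIntegral_annulus_sq hDm hw'.memLp
  simp only [Real.norm_eq_abs, sq_abs] at h2 h4
  rw [h2, h3] at h1
  rw [h4] at h6
  have h7 : ∑ y ∈ t, (∫ x in Metric.ball y r, annularExtension D (fun _ => 1) w.1 x) ^ 2 =
      ∑ i, ⟪(memLp_ballWeight (D := D) (t.equivFin.symm i : Amb N) r).toLp _, w.1⟫_ℝ ^ 2 := by
    rw [← Finset.sum_coe_sort t, ← t.equivFin.symm.sum_comp]
    refine Finset.sum_congr rfl fun i _ => ?_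
    rw [setIntegral_ball_annularExtension hDm hw'.memLp, inner_toLp_left]
    simp [mul_comm]
  rw [h7] at h1
  refine h6.trans (h1.trans (add_le_add_left ?_ _))
  rw [div_mul_eq_mul_div, div_le_iff₀ (by positivity), mul_assoc]
  refine mul_le_mul_of_nonneg_left ?_ hε.le
  have hx := sq_nonneg ‖w.1‖
  have hy := sq_nonneg ‖w.2‖
  nlinarith [mul_nonneg ha hy, mul_nonneg hb hx]

end Smooth

end SphericalNeumann

namespace SphericalNeumann

/-! ### The spectral gap of a smooth domain -/

theorem hasWeakGradient_of_contDiffOn {E : Type*} [NormedAddCommGroup E] [InnerProductSpace ℝ E]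
    [FiniteDimensional ℝ E] [MeasurableSpace E] [BorelSpace E] {Ω : Set E} (hΩ : IsOpen Ω)
    {f : E → ℝ} {G : E → E} (hf : ContDiffOn ℝ 1 f Ω)
    (hG : ∀ x ∈ Ω, ∀ v, fderiv ℝ f x v = ⟪G x, v⟫_ℝ) : HasWeakGradient Ω f G := by
  intro φ hφ hc hs e
  have hφ1 : Continuous fun x => fderiv ℝ φ x e := (hφ.continuous_fderiv (by simp)).clm_apply
    continuous_const
  have hφs : tsupport (fun x => fderiv ℝ φ x e) ⊆ tsupport φ := by
    refine closure_minimal (fun x hx => ?_) (isClosed_tsupport φ)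
    by_contra h
    exact hx (by simp [fderiv_of_notMem_tsupport (𝕜 := ℝ) h])
  have hfl : LocallyIntegrableOn f Ω := hf.continuousOn.locallyIntegrableOn hΩ.measurableSet
  have hfl' : LocallyIntegrableOn (fun x => fderiv ℝ f x e) Ω :=
    ((hf.continuousOn_fderiv_of_isOpen hΩ le_rfl).clm_apply
      continuousOn_const).locallyIntegrableOn hΩ.measurableSet
  have h := integral_mul_fderiv_eq_neg_fderiv_mul_of_integrable (μ := (volume : Measure E))
    (f := f) (g := φ) (v := e) ?_ ?_ ?_ ?_ ?_
  · rw [h]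
    congr 1
    refine integral_congr_ae (ae_of_all _ fun x => ?_)
    by_cases hx : x ∈ tsupport φ
    · simp only [hG x (hs hx)]
    · simp [image_eq_zero_of_notMem_tsupport hx]
  · simpa [mul_comm] using integrable_mul_of_locallyIntegrableOn hfl' hφ.continuous hc hs
  · simpa [mul_comm] using integrable_mul_of_locallyIntegrableOn hfl hφ1
      (hc.mono' ((subset_tsupport _).trans hφs)) (hφs.trans hs)
  · simpa [mul_comm] using integrable_mul_of_locallyIntegrableOn hfl hφ.continuous hc hs
  · exact fun x hx => (hf.contDiffAt (hΩ.mem_nhds (hs hx))).differentiableAt one_ne_zero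
  · exact fun x _ => hφ.differentiable (by simp) x

section Gap

variable {N : ℕ} [NeZero N] {D : Set (Sph N)}

/-- Supplies the constants, which span the kernel, and nonconstant elements of H¹(D). -/
theorem hasSobolevGradient_affine (hD : IsOpen D) (a : Amb N) (b : ℝ) :
    HasSobolevGradient D (fun p => ⟪a, (p : Amb N)⟫_ℝ + b)
      (fun p => a - ⟪a, (p : Amb N)⟫_ℝ • (p : Amb N)) := by
  refine hasSobolevGradient_of_hasWeakGradient hD.measurableSet
    (memLp_of_continuous_sph (by fun_prop)) (memLp_of_continuous_sph (by fun_prop))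
    (ae_of_all _ fun p => ?_) ?_
  · rw [inner_sub_right, real_inner_smul_right, inner_self_sph, mul_one, real_inner_comm, sub_self]
  · refine (hasWeakGradient_of_contDiffOn (isOpen_cone hD)
      (f := fun x => ⟪a, ‖x‖⁻¹ • x⟫_ℝ + b)
      (G := fun x => ‖x‖⁻¹ • (a - ⟪a, (dir x : Amb N)⟫_ℝ • (dir x : Amb N))) ?_ ?_).congr ?_ ?_
    · intro x hx
      have h := (((contDiffAt_norm ℝ hx.1).inv (norm_ne_zero_iff.2 hx.1)).smul
        (contDiffAt_id (𝕜 := ℝ) (n := 1) (x := x)))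
      exact ((contDiffAt_const.inner ℝ h).add contDiffAt_const).contDiffWithinAt
    · intro x hx v
      have h := (((innerSL ℝ a).hasFDerivAt.comp x (hasFDerivAt_norm_inv_smul hx.1)).add_const b)
      have h2 : fderiv ℝ (fun x : Amb N => ⟪a, ‖x‖⁻¹ • x⟫_ℝ + b) x v = _ :=
        congrArg (fun L => L v) h.fderiv
      rw [h2]
      simp only [ContinuousLinearMap.comp_apply, smul_apply, sub_apply, innerSL_apply_apply,
        ContinuousLinearMap.id_apply, ContinuousLinearMap.smulRight_apply, inner_sub_left,
        inner_sub_right, real_inner_smul_left, real_inner_smul_right]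
      ring
    · intro x hx
      simp only [coe_dir hx.1]
    · intro x hx
      rfl

/-- The extension is almost everywhere constant on a Euclidean ball, which contains a product of a
spherical neighbourhood and a radial interval. As that interval has positive radial measure, the
exceptional set on the sphere is null. -/
theorem HasSobolevGradient.exists_ae_eq_const_nhds (hN : 2 ≤ N) (hD : IsOpen D) {u : Sph N → ℝ}
    {G : Sph N → Amb N} (h : HasSobolevGradient D u G) (hu : Measurable u)
    (hG : ∫ p in D, ‖G p‖ ^ 2 ∂surf N = 0) {p : Sph N} (hp : p ∈ D) :
    ∃ V : Set (Sph N), IsOpen V ∧ p ∈ V ∧ ∃ c : ℝ, ∀ᵐ q ∂(surf N).restrict V, u q = c := by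
  have hpt : (p : Amb N) ∈ truncatedCone D := by
    refine ⟨by simpa using smul_mem_cone hp one_pos, ?_⟩
    rw [norm_coe_sph]
    constructor <;> norm_num
  obtain ⟨r, hr, c, hc⟩ := (h.isSobolevPair hN hD hu).exists_ae_eq_const (isOpen_truncatedCone hD)
    (by rw [integral_norm_annularExtension_sq hD.measurableSet h.memLp_grad continuousOn_inv_Icc,
      hG, mul_zero]) hpt
  -- The bound r/2 keeps the product in the ball, and 1/2 keeps the radius inside the truncation.
  set δ : ℝ := min (r / 2) (1 / 2)
  have hδ : 0 < δ := by positivity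
  have hVo : IsOpen (D ∩ {q : Sph N | ‖(q : Amb N) - p‖ < r / 2}) :=
    hD.inter (isOpen_lt (by fun_prop) continuous_const)
  refine ⟨_, hVo, ⟨hp, by simpa using hr⟩, c, ?_⟩
  set V := D ∩ {q : Sph N | ‖(q : Amb N) - p‖ < r / 2}
  rw [ae_restrict_iff' hVo.measurableSet, ae_iff]
  have hBm : MeasurableSet {q : Sph N | ¬ (q ∈ V → u q = c)} := by
    have : {q : Sph N | ¬ (q ∈ V → u q = c)} = V ∩ (u ⁻¹' {c})ᶜ := by
      ext q
      simp
    rw [this]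
    exact hVo.measurableSet.inter (hu (measurableSet_singleton c)).compl
  set B := {q : Sph N | ¬ (q ∈ V → u q = c)}
  have h1 : (volume : Measure (Amb N)) ((fun x : Amb N => (dir x, ‖x‖)) ⁻¹'
      (B ×ˢ Ioo (1 - δ) (1 + δ))) = 0 := by
    rw [ae_restrict_iff' Metric.isOpen_ball.measurableSet, ae_iff] at hc
    refine measure_mono_null ?_ hc
    rintro x ⟨hxB, hx⟩
    simp only [B, mem_ofPred_eq, Classical.not_imp] at hxB ⊢
    obtain ⟨⟨hxD, hxp⟩, hxu⟩ := hxB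
    have h2 : δ ≤ r / 2 := min_le_left _ _
    have h3 : δ ≤ 1 / 2 := min_le_right _ _
    refine ⟨?_, ?_⟩
    · rw [mem_ball_iff_norm]
      have h4 : x - p = (‖x‖ - 1) • (dir x : Amb N) + ((dir x : Amb N) - p) := by
        rw [sub_smul, norm_smul_dir, one_smul]
        abel
      rw [h4]
      refine (norm_add_le _ _).trans_lt ?_
      rw [norm_smul, norm_coe_sph, mul_one, Real.norm_eq_abs]
      have h5 : |‖x‖ - 1| < δ := abs_lt.2 ⟨by linarith [hx.1], by linarith [hx.2]⟩
      have h6 : ‖(dir x : Amb N) - p‖ < r / 2 := hxp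
      linarith
    · have hxI : ‖x‖ ∈ Ioo (1 / 2 : ℝ) 4 := ⟨by linarith [hx.1], by linarith [hx.2]⟩
      rwa [annularExtension, indicator_of_mem hxI, indicator_of_mem hxD, one_smul]
  rw [measurePreserving_polar.measure_preimage (hBm.prod measurableSet_Ioo).nullMeasurableSet,
    Measure.prod_prod, mul_eq_zero] at h1
  refine h1.resolve_right fun h0 => ?_
  have hI : Ioo (1 - δ) (1 + δ) ⊆ Ioi (0 : ℝ) := fun t ht => by
    have h3 : δ ≤ 1 / 2 := min_le_right _ _
    have : 1 - δ < t := ht.1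
    exact (by linarith : (0 : ℝ) < t)
  rw [radialMeasure, withDensity_apply_eq_zero (by fun_prop)] at h0
  have h7 : {t : ℝ | ENNReal.ofReal (t ^ (N - 1)) ≠ 0} ∩ Ioo (1 - δ) (1 + δ) =
      Ioo (1 - δ) (1 + δ) := by
    refine inter_eq_right.2 fun t ht => ?_
    simpa using pow_pos (hI ht) (N - 1)
  rw [h7, Measure.restrict_apply measurableSet_Ioo, inter_eq_left.2 hI, Real.volume_Ioo] at h0
  simp at h0
  linarith

theorem surf_pos_of_isOpen {V : Set (Sph N)} (hV : IsOpen V) (hne : V.Nonempty) :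
    surf N V ≠ 0 :=
  (hV.measure_pos (surf N) hne).ne'

/-- Local constants agree on overlaps, since nonempty open sets have positive measure; hence they
form a locally constant function on the connected set D. -/
theorem HasSobolevGradient.exists_ae_eq_const (hN : 2 ≤ N) (hD : IsOpen D) (hDc : IsConnected D)
    {u : Sph N → ℝ} {G : Sph N → Amb N} (h : HasSobolevGradient D u G) (hu : Measurable u)
    (hG : ∫ p in D, ‖G p‖ ^ 2 ∂surf N = 0) :
    ∃ c : ℝ, ∀ᵐ q ∂(surf N).restrict D, u q = c := by
  choose! V hV hpV c hc using fun p (hp : p ∈ D) => h.exists_ae_eq_const_nhds hN hD hu hG hp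
  have hcc : ∀ p ∈ D, ∀ q ∈ D, q ∈ V p → c q = c p := by
    intro p hp q hq hqp
    by_contra hne
    have h1 := ae_mono (Measure.restrict_mono_set (surf N) (inter_subset_left (t := V q))) (hc p hp)
    have h2 := ae_mono (Measure.restrict_mono_set (surf N) (inter_subset_right (s := V p))) (hc q hq)
    have h3 : ∀ᵐ _ ∂(surf N).restrict (V p ∩ V q), False := by
      filter_upwards [h1, h2] with z hz1 hz2
      exact hne (hz2.symm.trans hz1)
    rw [eventually_false_iff_eq_bot, ae_eq_bot, Measure.restrict_eq_zero] at h3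
    exact surf_pos_of_isOpen ((hV p hp).inter (hV q hq)) ⟨q, hqp, hpV q hq⟩ h3
  have hloc : IsLocallyConstant fun p : D => c p := by
    rw [IsLocallyConstant.iff_exists_open]
    exact fun p => ⟨Subtype.val ⁻¹' V p, (hV p p.2).preimage continuous_subtype_val, hpV p p.2,
      fun q hq => hcc p p.2 q q.2 hq⟩
  obtain ⟨p₀, hp₀⟩ := hDc.nonempty
  have : PreconnectedSpace D := isPreconnected_iff_preconnectedSpace.1 hDc.isPreconnected
  have hconst : ∀ p ∈ D, c p = c p₀ := fun p hp =>
    hloc.apply_eq_of_preconnectedSpace ⟨p, hp⟩ ⟨p₀, hp₀⟩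
  refine ⟨c p₀, ?_⟩
  rw [ae_restrict_iff' hD.measurableSet, ae_iff]
  refine measure_null_of_locally_null _ fun p hp => ?_
  simp only [mem_ofPred_eq, Classical.not_imp] at hp
  refine ⟨_, inter_mem_nhdsWithin _ ((hV p hp.1).mem_nhds (hpV p hp.1)), ?_⟩
  have h1 := hc p hp.1
  rw [ae_restrict_iff' (hV p hp.1).measurableSet, ae_iff] at h1
  refine measure_mono_null ?_ h1
  rintro q ⟨hq1, hq2⟩
  simp only [mem_ofPred_eq, Classical.not_imp] at hq1 ⊢
  exact ⟨hq2, by rw [hconst p hp.1]; exact hq1.2⟩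

/-- An isolated point would be a clopen subset of the connected sphere, which contains antipodal
pairs. -/
theorem exists_mem_ne_of_isOpen (hN : 2 ≤ N) (hD : IsOpen D) {p : Sph N} (hp : p ∈ D) :
    ∃ q ∈ D, q ≠ p := by
  by_contra! hcon
  have hDp : D = {p} := Subset.antisymm hcon (singleton_subset_iff.2 hp)
  have hr : 1 < Module.rank ℝ (Amb N) := by
    rw [← Module.finrank_eq_rank, finrank_euclideanSpace_fin]
    exact_mod_cast hN
  have : PreconnectedSpace (Sph N) := isPreconnected_iff_preconnectedSpace.1
    (isPreconnected_sphere hr 0 1)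
  have hcl : IsClopen ({p} : Set (Sph N)) := ⟨isClosed_singleton, hDp ▸ hD⟩
  have h1 : (-p : Sph N) ∈ ({p} : Set (Sph N)) := by
    rw [hcl.eq_univ (singleton_nonempty p)]
    trivial
  have h2 : (-(p : Amb N)) = p := congrArg Subtype.val (mem_singleton_iff.1 h1)
  have h3 := inner_self_sph p
  nth_rewrite 1 [← h2] at h3
  rw [inner_neg_left, inner_self_sph] at h3
  norm_num at h3

/-- The Poincaré inequality with constant `1 / l` on `D`. -/
def PoincareBound (D : Set (Sph N)) (l : ℝ) : Prop :=
  ∀ (u : Sph N → ℝ) (G : Sph N → Amb N), HasSobolevGradient D u G →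
    ∃ c : ℝ, l * ∫ p in D, (u p - c) ^ 2 ∂surf N ≤ ∫ p in D, ‖G p‖ ^ 2 ∂surf N

/-- The abstract eigenpair theorem for the Sobolev graph, with the constant function 1 as kernel
vector. Its number R is the least positive eigenvalue by the Poincaré inequality, and no larger
Poincaré constant is possible because of the eigenfunction. -/
theorem IsSmoothDomain.spectral_gap (hN : 2 ≤ N) (hD : IsSmoothDomain D) :
    0 < lambdaOne D ∧ IsNeumannEigenvalue D (lambdaOne D) ∧ PoincareBound D (lambdaOne D) ∧
      ∀ l : ℝ, PoincareBound D l → l ≤ lambdaOne D := by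
  have hone : HasSobolevGradient D (fun _ => (1 : ℝ)) (fun _ => 0) := by
    simpa using hasSobolevGradient_affine hD.isOpen 0 1
  set e : Lp ℝ 2 ((surf N).restrict D) := hone.memLp.toLp _ with he
  have hone' := hone.toLp_mem
  rw [show hone.memLp_grad.toLp (fun _ : Sph N => (0 : Amb N)) = 0 from MemLp.toLp_zero _] at hone'
  have hsmul : ∀ c : ℝ, (c • e : Lp ℝ 2 ((surf N).restrict D)) =ᵐ[(surf N).restrict D]
      fun _ => c := by
    intro c
    filter_upwards [Lp.coeFn_smul c e, hone.memLp.coeFn_toLp] with p h1 h2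
    rw [h1, Pi.smul_apply, h2, smul_eq_mul, mul_one]
  have hker : ∀ u : Lp ℝ 2 ((surf N).restrict D), (u, 0) ∈ sobolevGraph D →
      ∃ c : ℝ, u = c • e := by
    intro u hu
    have h1 := mem_sobolevGraph_iff.1 hu
    obtain ⟨c, hc⟩ := h1.exists_ae_eq_const hN hD.isOpen hD.isConnected
      (Lp.stronglyMeasurable _).measurable (by
        rw [integral_norm_sq_eq_norm_toLp_sq h1.memLp_grad, Lp.toLp_coeFn, norm_zero,
          zero_pow two_ne_zero])
    refine ⟨c, Lp.ext ?_⟩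
    filter_upwards [hc, hsmul c] with p h2 h3
    rw [h3]
    exact h2
  have hne : ∃ w ∈ sobolevGraph D, ∀ c : ℝ, w.1 ≠ c • e := by
    obtain ⟨p₀, hp₀⟩ := hD.isConnected.nonempty
    have h1 := hasSobolevGradient_affine hD.isOpen (p₀ : Amb N) 0
    refine ⟨_, h1.toLp_mem, fun c hc => ?_⟩
    have h2 : (fun p : Sph N => ⟪(p₀ : Amb N), (p : Amb N)⟫_ℝ + 0) =ᵐ[(surf N).restrict D]
        fun _ => c := by
      refine h1.memLp.coeFn_toLp.symm.trans (EventuallyEq.trans ?_ (hsmul c))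
      exact EventuallyEq.of_eq
        (congrArg (fun f : Lp ℝ 2 ((surf N).restrict D) => (f : Sph N → ℝ)) hc)
    have h3 := Measure.eqOn_open_of_ae_eq h2 hD.isOpen (by fun_prop) continuousOn_const
    obtain ⟨q, hq, hqp⟩ := exists_mem_ne_of_isOpen hN hD.isOpen hp₀
    have h4 := (h3 hq).trans (h3 hp₀).symm
    simp only [add_zero, inner_self_sph] at h4
    refine hqp (Subtype.ext ?_)
    exact ((inner_eq_one_iff_of_norm_eq_one (norm_coe_sph p₀) (norm_coe_sph q)).1 h4).symm
  obtain ⟨R, hR, ⟨w, hw, hw0, hwe, hwE⟩, hP⟩ := exists_first_eigenpair isClosed_sobolevGraph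
    (hD.isCompactlyEmbedded hN) hone' hker hne
  have hw' := mem_sobolevGraph_iff.1 hw
  have hReig : IsNeumannEigenvalue D R := by
    refine ⟨w.1, w.2, hw', fun h0 => hw0 (Lp.ext (h0.trans (Lp.coeFn_zero _ _ _).symm)),
      fun v H hv => ?_⟩
    have h1 := hwE _ hv.toLp_mem
    simp only at h1
    rw [real_inner_comm, inner_toLp_left, real_inner_comm, inner_toLp_left] at h1
    simpa [real_inner_comm] using h1
  have hRle : ∀ μ : ℝ, 0 < μ → IsNeumannEigenvalue D μ → R ≤ μ := by
    rintro μ hμ0 ⟨u, G, hu, hu0, huE⟩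
    -- Testing with the constant 1 shows that an eigenfunction of a positive eigenvalue has mean
    -- zero.
    have h1 := huE _ _ hone
    simp only [inner_zero_right, integral_zero, mul_one] at h1
    have h2 := huE _ _ hu
    obtain ⟨c, hc1, hc2⟩ := hP _ hu.toLp_mem
    simp only at hc1 hc2
    have h3 : ⟪hu.memLp.toLp u, e⟫_ℝ = 0 := by
      rw [real_inner_comm, inner_toLp_left, ← (mul_eq_zero.1 h1.symm).resolve_left hμ0.ne']
      refine integral_congr_ae ?_
      filter_upwards [hu.memLp.coeFn_toLp] with p hp
      simp [hp]
    have h4 : c • e = 0 := by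
      rw [inner_sub_left, h3, real_inner_smul_left, zero_sub, neg_eq_zero] at hc1
      rcases mul_eq_zero.1 hc1 with h | h
      · rw [h, zero_smul]
      · have h' : e = 0 := inner_self_eq_zero.1 h
        rw [h', smul_zero]
    rw [h4, sub_zero, ← integral_norm_sq_eq_norm_toLp_sq, ← integral_norm_sq_eq_norm_toLp_sq] at hc2
    simp only [real_inner_self_eq_norm_sq] at h2
    have h5 : ∀ p, u p * u p = ‖u p‖ ^ 2 := fun p => by rw [Real.norm_eq_abs, sq_abs, sq]
    simp only [h5] at h2
    rw [h2] at hc2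
    refine le_of_mul_le_mul_right hc2 ?_
    rw [integral_norm_sq_eq_norm_toLp_sq hu.memLp]
    refine pow_pos (norm_pos_iff.2 fun h => hu0 ?_) 2
    have := hu.memLp.coeFn_toLp
    rw [h] at this
    exact this.symm.trans (Lp.coeFn_zero _ _ _)
  have hlam : lambdaOne D = R :=
    (IsLeast.csInf_eq ⟨⟨hR, hReig⟩, fun μ hμ => hRle μ hμ.1 hμ.2⟩)
  rw [hlam]
  have hsub : ∀ (f : Lp ℝ 2 ((surf N).restrict D)) (c : ℝ),
      ‖f - c • e‖ ^ 2 = ∫ p in D, (f p - c) ^ 2 ∂surf N := by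
    intro f c
    rw [← Lp.toLp_coeFn (f - c • e) (Lp.memLp _), ← integral_norm_sq_eq_norm_toLp_sq]
    refine integral_congr_ae ?_
    filter_upwards [Lp.coeFn_sub f (c • e), hsmul c] with p h1 h2
    rw [h1, Pi.sub_apply, h2, Real.norm_eq_abs, sq_abs]
  refine ⟨hR, hReig, fun u G hu => ?_, fun l hl => ?_⟩
  · obtain ⟨c, -, hc⟩ := hP _ hu.toLp_mem
    refine ⟨c, ?_⟩
    rw [hsub, ← integral_norm_sq_eq_norm_toLp_sq] at hc
    refine le_trans (le_of_eq ?_) hc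
    congr 1
    refine integral_congr_ae ?_
    filter_upwards [hu.memLp.coeFn_toLp] with p hp
    rw [hp]
  · obtain ⟨c, hc⟩ := hl _ _ hw'
    rw [← hsub, integral_norm_sq_eq_norm_toLp_sq hw'.memLp_grad, Lp.toLp_coeFn,
      ← real_inner_self_eq_norm_sq w.2, hwE w hw, real_inner_self_eq_norm_sq] at hc
    -- The eigenfunction is orthogonal to constants, so no choice of c can reduce its norm.
    have h1 : ‖w.1‖ ^ 2 ≤ ‖w.1 - c • e‖ ^ 2 := by
      rw [norm_sub_sq_real, real_inner_smul_right, hwe]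
      nlinarith [sq_nonneg ‖c • e‖]
    have h2 : 0 < ‖w.1‖ ^ 2 := pow_pos (norm_pos_iff.2 hw0) 2
    by_contra! hlt
    nlinarith

end Gap

end SphericalNeumann

namespace SphericalNeumann

/-! ### The entire function `z ↦ cos √z` and a smooth version of `arccos²` -/

/-- The entire function `C` with `C (t ^ 2) = cos t`. -/
noncomputable def cosSqrt (z : ℝ) : ℝ :=
  FormalMultilinearSeries.ofScalarsSum (E := ℝ) (fun n : ℕ => (-1 : ℝ) ^ n / (2 * n).factorial) z

theorem cosSqrt_sq (t : ℝ) : cosSqrt (t ^ 2) = cos t := by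
  rw [cosSqrt, FormalMultilinearSeries.ofScalars_sum_eq, Real.cos_eq_tsum]
  refine tsum_congr fun n => ?_
  rw [smul_eq_mul, ← pow_mul]
  ring

theorem analyticAt_cosSqrt (z : ℝ) : AnalyticAt ℝ cosSqrt z := by
  have hr : (FormalMultilinearSeries.ofScalars ℝ
      (fun n : ℕ => (-1 : ℝ) ^ n / (2 * n).factorial)).radius = ⊤ := by
    refine FormalMultilinearSeries.ofScalars_radius_eq_top_of_tendsto _ _
      (Eventually.of_forall fun n => by positivity) ?_
    have h1 : ∀ n : ℕ, ‖(-1 : ℝ) ^ n.succ / (2 * n.succ).factorial‖ /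
        ‖(-1 : ℝ) ^ n / (2 * n).factorial‖ = ((2 * (n : ℝ) + 2) * (2 * n + 1))⁻¹ := by
      intro n
      rw [show 2 * n.succ = 2 * n + 1 + 1 by rw [Nat.succ_eq_add_one]; ring, Nat.factorial_succ,
        Nat.factorial_succ]
      have : ((2 * n).factorial : ℝ) ≠ 0 := by positivity
      simp only [norm_div, norm_pow, norm_neg, norm_one, one_pow, RCLike.norm_natCast]
      push_cast
      field_simp
      ring
    simp only [h1]
    refine tendsto_inv_atTop_zero.comp ?_
    refine tendsto_atTop_mono (fun n : ℕ => ?_) (tendsto_natCast_atTop_atTop (R := ℝ))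
    have : (0 : ℝ) ≤ n := n.cast_nonneg
    nlinarith
  have h := (FormalMultilinearSeries.ofScalars ℝ
      (fun n : ℕ => (-1 : ℝ) ^ n / (2 * n).factorial)).hasFPowerSeriesOnBall (by rw [hr]; simp)
  exact h.analyticAt_of_mem (by simp [hr])

theorem contDiff_cosSqrt : ContDiff ℝ ∞ cosSqrt :=
  contDiff_iff_contDiffAt.2 fun z => (analyticAt_cosSqrt z).contDiffAt

theorem contDiff_deriv_cosSqrt : ContDiff ℝ ∞ (deriv cosSqrt) :=
  contDiff_iff_contDiffAt.2 fun z => (analyticAt_cosSqrt z).deriv.contDiffAt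

/-- Differentiate C(t²) = cos t for t ≠ 0; both sides are continuous, so the identity extends to 0.
-/
theorem sinc_eq_deriv_cosSqrt (t : ℝ) : sinc t = -2 * deriv cosSqrt (t ^ 2) := by
  have hc : Continuous fun t : ℝ => -2 * deriv cosSqrt (t ^ 2) :=
    continuous_const.mul (contDiff_deriv_cosSqrt.continuous.comp (continuous_pow 2))
  refine congrFun (Continuous.ext_on (dense_compl_singleton (0 : ℝ)) continuous_sinc hc ?_) t
  intro t ht
  have h1 : HasDerivAt (fun t : ℝ => cosSqrt (t ^ 2)) (deriv cosSqrt (t ^ 2) * (2 * t)) t := by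
    have h2 := (analyticAt_cosSqrt (t ^ 2)).differentiableAt.hasDerivAt
    have h3 : HasDerivAt (fun t : ℝ => t ^ 2) (2 * t) t := by simpa using hasDerivAt_pow 2 t
    exact HasDerivAt.comp (h := fun t : ℝ => t ^ 2) t h2 h3
  simp only [cosSqrt_sq] at h1
  have h2 := h1.unique (hasDerivAt_cos t)
  have ht' : t ≠ 0 := ht
  rw [sinc_of_ne_zero ht', div_eq_iff ht']
  linarith

theorem mul_sinc (t : ℝ) : t * sinc t = sin t := by
  rcases eq_or_ne t 0 with rfl | h
  · simp
  · rw [sinc_of_ne_zero h, mul_div_cancel₀ _ h]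

theorem sinc_pos_of_lt_pi {t : ℝ} (h0 : 0 ≤ t) (hπ : t < π) : 0 < sinc t := by
  rcases h0.eq_or_lt with rfl | h
  · simp
  · rw [sinc_of_ne_zero h.ne']
    exact div_pos (sin_pos_of_pos_of_lt_pi h hπ) h

/-- A function that is smooth on a neighbourhood of `(-1, 1]` and equals `arccos²` there. -/
theorem exists_smooth_arccosSq : ∃ Q : ℝ → ℝ, (∀ c ∈ Ioc (-1 : ℝ) 1, ContDiffAt ℝ ∞ Q c) ∧
    ∀ c ≤ 1, Q c = arccos c ^ 2 := by
  have h0 : deriv cosSqrt 0 ≠ 0 := by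
    intro h
    have := sinc_eq_deriv_cosSqrt 0
    simp [h] at this
  have hs := (analyticAt_cosSqrt 0).hasStrictDerivAt
  have hC0 : cosSqrt 0 = 1 := by simpa using cosSqrt_sq 0
  -- Although arccos is not smooth at 1, its square is there the local inverse of the analytic
  -- function `cosSqrt`, whose derivative at 0 is nonzero.
  set g : ℝ → ℝ := hs.localInverse _ _ _ h0 with hg
  have hga : ContDiffAt ℝ ∞ g 1 := by
    rw [← hC0]
    exact ((analyticAt_cosSqrt 0).analyticAt_localInverse h0).contDiffAt
  have hgl : ∀ᶠ z in 𝓝 (0 : ℝ), g (cosSqrt z) = z := hs.eventually_left_inverse h0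
  have hgc : ∀ᶠ c in 𝓝 (1 : ℝ), -1 ≤ c → c ≤ 1 → g c = arccos c ^ 2 := by
    have h1 : Tendsto (fun c => arccos c ^ 2) (𝓝 1) (𝓝 0) := by
      have : Continuous fun c => arccos c ^ 2 := continuous_arccos.pow 2
      simpa using this.tendsto 1
    filter_upwards [h1.eventually hgl] with c hc h2 h3
    rwa [cosSqrt_sq, cos_arccos h2 h3] at hc
  refine ⟨fun c => if c ≤ 1 then arccos c ^ 2 else g c, fun c hc => ?_, fun c hc => if_pos hc⟩
  rcases hc.2.eq_or_lt with rfl | h1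
  · refine hga.congr_of_eventuallyEq ?_
    filter_upwards [hgc, lt_mem_nhds hc.1] with c h1 h2
    by_cases h3 : c ≤ 1
    · simp only [h3, if_true, h1 h2.le h3]
    · simp only [h3, if_false]
  · refine ((contDiffAt_arccos hc.1.ne' h1.ne).pow 2).congr_of_eventuallyEq ?_
    filter_upwards [gt_mem_nhds h1] with c h2
    simp only [le_of_lt h2, if_true]

end SphericalNeumann

namespace SphericalNeumann

/-! ### Polar coordinates and the maps `φ_γ` -/

section Dilation

variable {N : ℕ} [NeZero N] {γ δ : ℝ} {p q : Sph N}

theorem inner_northPole_self : ⟪northPole N, northPole N⟫_ℝ = 1 := by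
  rw [real_inner_self_eq_norm_sq, norm_northPole, one_pow]

theorem abs_inner_northPole_le (p : Sph N) : |⟪northPole N, (p : Amb N)⟫_ℝ| ≤ 1 := by
  simpa [norm_northPole] using abs_real_inner_le_norm (northPole N) (p : Amb N)

theorem cos_polarRadius (p : Sph N) : cos (polarRadius p) = ⟪northPole N, (p : Amb N)⟫_ℝ :=
  cos_arccos (abs_le.1 (abs_inner_northPole_le p)).1 (abs_le.1 (abs_inner_northPole_le p)).2

theorem polarRadius_nonneg (p : Sph N) : 0 ≤ polarRadius p := arccos_nonneg _

theorem polarRadius_le_pi (p : Sph N) : polarRadius p ≤ π := arccos_le_pi _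

theorem continuous_polarRadius : Continuous (polarRadius : Sph N → ℝ) := by
  unfold polarRadius
  exact continuous_arccos.comp (by fun_prop)

theorem polarRadius_lt_pi_div_two_iff : polarRadius p < π / 2 ↔ p ∈ upperHemisphere N := by
  rw [polarRadius, arccos_lt_pi_div_two]
  rfl

theorem norm_sub_cos_smul_northPole_sq (p : Sph N) :
    ‖(p : Amb N) - cos (polarRadius p) • northPole N‖ ^ 2 = sin (polarRadius p) ^ 2 := by
  rw [norm_sub_sq_real, norm_coe_sph, norm_smul, norm_northPole, real_inner_smul_right,
    real_inner_comm, ← cos_polarRadius, mul_one, Real.norm_eq_abs, sq_abs]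
  linarith [sin_sq_add_cos_sq (polarRadius p)]

theorem inner_northPole_polarDirection (p : Sph N) :
    ⟪northPole N, polarDirection p⟫_ℝ = 0 := by
  rw [polarDirection, real_inner_smul_right, inner_sub_right, real_inner_smul_right,
    inner_northPole_self, cos_polarRadius, mul_one, sub_self, mul_zero]

theorem sin_smul_polarDirection (p : Sph N) :
    sin (polarRadius p) • polarDirection p = p - cos (polarRadius p) • northPole N := by
  rcases eq_or_ne (sin (polarRadius p)) 0 with h | h
  · have h1 := norm_sub_cos_smul_northPole_sq p
    rw [h, zero_pow two_ne_zero, pow_eq_zero_iff two_ne_zero, norm_eq_zero] at h1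
    rw [h, h1, zero_smul]
  · rw [polarDirection, smul_smul, mul_inv_cancel₀ h, one_smul]

theorem norm_polarDirection (h : sin (polarRadius p) ≠ 0) : ‖polarDirection p‖ = 1 := by
  have h1 := norm_sub_cos_smul_northPole_sq p
  rw [← sin_smul_polarDirection, norm_smul, mul_pow, Real.norm_eq_abs, sq_abs] at h1
  have h2 : ‖polarDirection p‖ ^ 2 = 1 := by
    have : sin (polarRadius p) ^ 2 ≠ 0 := pow_ne_zero 2 h
    exact mul_left_cancel₀ this (by rw [h1, mul_one])
  exact (pow_eq_one_iff_of_nonneg (norm_nonneg _) two_ne_zero).1 h2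

theorem norm_polarDirection_le (p : Sph N) : ‖polarDirection p‖ ≤ 1 := by
  rcases eq_or_ne (sin (polarRadius p)) 0 with h | h
  · simp [polarDirection, h]
  · exact (norm_polarDirection h).le

theorem dilation_one (p : Sph N) : dilation 1 p = p := by
  rw [dilation, fromPolar, one_mul, sin_smul_polarDirection]
  abel

theorem sin_mul_polarRadius_eq_zero (hp : polarRadius p < π) (h : sin (polarRadius p) = 0) :
    polarRadius p = 0 := by
  by_contra h0
  exact (sin_pos_of_pos_of_lt_pi ((polarRadius_nonneg p).lt_of_ne' h0) hp).ne' h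

/-- At the north pole the direction is 0 but so is its coefficient. The south pole must be excluded:
there the formula gives cos(γπ) times the north pole, in general not a unit vector. -/
theorem norm_dilation (γ : ℝ) (hp : polarRadius p < π) : ‖dilation γ p‖ = 1 := by
  have h1 : ‖dilation γ p‖ ^ 2 = 1 := by
    rw [dilation, fromPolar, norm_add_sq_real, norm_smul, norm_smul, norm_northPole,
      real_inner_smul_left, real_inner_smul_right, inner_northPole_polarDirection, mul_pow, mul_pow,
      Real.norm_eq_abs, Real.norm_eq_abs, sq_abs, sq_abs]
    rcases eq_or_ne (sin (polarRadius p)) 0 with h | h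
    · simp [sin_mul_polarRadius_eq_zero hp h]
    · rw [norm_polarDirection h]
      linarith [sin_sq_add_cos_sq (γ * polarRadius p)]
  exact (pow_eq_one_iff_of_nonneg (norm_nonneg _) two_ne_zero).1 h1

/-- The map `φ_γ`, as a map to the sphere. -/
noncomputable def dilSph (γ : ℝ) (p : Sph N) : Sph N := dir (dilation γ p)

theorem coe_dilSph (γ : ℝ) (hp : polarRadius p < π) : (dilSph γ p : Amb N) = dilation γ p := by
  have h := norm_dilation γ hp
  rw [dilSph, coe_dir (norm_ne_zero_iff.1 (by rw [h]; exact one_ne_zero)), h, inv_one, one_smul]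

theorem inner_northPole_dilation (γ : ℝ) (p : Sph N) :
    ⟪northPole N, dilation γ p⟫_ℝ = cos (γ * polarRadius p) := by
  rw [dilation, fromPolar, inner_add_right, real_inner_smul_right, real_inner_smul_right,
    inner_northPole_self, inner_northPole_polarDirection]
  ring

theorem polarRadius_dilSph (hp : polarRadius p < π) (hγ : 0 ≤ γ) (h : γ * polarRadius p ≤ π) :
    polarRadius (dilSph γ p) = γ * polarRadius p := by
  rw [polarRadius, coe_dilSph γ hp, inner_northPole_dilation,
    arccos_cos (mul_nonneg hγ (polarRadius_nonneg p)) h]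

theorem dilation_dilSph (hp : polarRadius p < π) (hγ : 0 < γ) (h : γ * polarRadius p < π) (δ : ℝ) :
    dilation δ (dilSph γ p) = dilation (γ * δ) p := by
  rw [dilation, dilation, polarRadius_dilSph hp hγ.le h.le, mul_comm γ δ, mul_assoc]
  rcases (polarRadius_nonneg p).eq_or_lt with h0 | h0
  · rw [← h0, mul_zero, mul_zero]
    simp [fromPolar]
  · have hs : sin (γ * polarRadius p) ≠ 0 :=
      (sin_pos_of_pos_of_lt_pi (mul_pos hγ h0) h).ne'
    congr 1
    rw [polarDirection, polarRadius_dilSph hp hγ.le h.le, coe_dilSph γ hp, dilation, fromPolar,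
      add_sub_cancel_left, smul_smul, inv_mul_cancel₀ hs, one_smul]

theorem dilSph_dilSph (hp : polarRadius p < π) (hγ : 0 < γ) (h : γ * polarRadius p < π) (δ : ℝ) :
    dilSph δ (dilSph γ p) = dilSph (γ * δ) p := by
  rw [dilSph, dilation_dilSph hp hγ h, dilSph]

theorem dilSph_one (p : Sph N) : dilSph 1 p = p := by
  rw [dilSph, dilation_one, dir_coe]

theorem dilSph_inv_dilSph (hp : polarRadius p < π) (hγ : 0 < γ) (h : γ * polarRadius p < π) :
    dilSph γ⁻¹ (dilSph γ p) = p := by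
  rw [dilSph_dilSph hp hγ h, mul_inv_cancel₀ hγ.ne', dilSph_one]

/-- The squared chord splits into a radial and an angular term with nonnegative coefficients
independent of γ, so distortion bounds reduce to inequalities for the sine. -/
theorem norm_dilation_sub_sq (γ : ℝ) (hp : polarRadius p < π) (hq : polarRadius q < π) :
    ‖dilation γ p - dilation γ q‖ ^ 2 =
      4 * sin (γ * ((polarRadius p - polarRadius q) / 2)) ^ 2 +
        2 * (1 - ⟪polarDirection p, polarDirection q⟫_ℝ) *
          (sin (γ * polarRadius p) * sin (γ * polarRadius q)) := by
  have h1 : ⟪dilation γ p, dilation γ q⟫_ℝ = cos (γ * polarRadius p) * cos (γ * polarRadius q) +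
      sin (γ * polarRadius p) * sin (γ * polarRadius q) *
        ⟪polarDirection p, polarDirection q⟫_ℝ := by
    simp only [dilation, fromPolar, inner_add_left, inner_add_right, real_inner_smul_left,
      real_inner_smul_right, inner_northPole_self, inner_northPole_polarDirection,
      real_inner_comm (northPole N)]
    ring
  have h2 : cos (γ * polarRadius p) * cos (γ * polarRadius q) +
      sin (γ * polarRadius p) * sin (γ * polarRadius q) =
      1 - 2 * sin (γ * ((polarRadius p - polarRadius q) / 2)) ^ 2 := by
    rw [← cos_sub, ← mul_sub,
      show γ * (polarRadius p - polarRadius q) = 2 * (γ * ((polarRadius p - polarRadius q) / 2)) by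
        ring, cos_two_mul]
    linarith [sin_sq_add_cos_sq (γ * ((polarRadius p - polarRadius q) / 2))]
  rw [norm_sub_sq_real, norm_dilation γ hp, norm_dilation γ hq, h1]
  linarith

theorem norm_coe_sub_sq (hp : polarRadius p < π) (hq : polarRadius q < π) :
    ‖(p : Amb N) - q‖ ^ 2 = 4 * sin ((polarRadius p - polarRadius q) / 2) ^ 2 +
        2 * (1 - ⟪polarDirection p, polarDirection q⟫_ℝ) *
          (sin (polarRadius p) * sin (polarRadius q)) := by
  have h := norm_dilation_sub_sq 1 hp hq
  rwa [dilation_one, dilation_one, one_mul, one_mul, one_mul] at h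

theorem inner_polarDirection_le_one (p q : Sph N) :
    ⟪polarDirection p, polarDirection q⟫_ℝ ≤ 1 := by
  refine (real_inner_le_norm _ _).trans ?_
  exact mul_le_one₀ (norm_polarDirection_le p) (norm_nonneg _) (norm_polarDirection_le q)

theorem sin_mul_le_sin {x : ℝ} (hγ : γ ≤ 1) (hγ0 : 0 ≤ γ) (hx : 0 ≤ x) (hx' : x ≤ π / 2) :
    sin (γ * x) ≤ sin x :=
  sin_le_sin_of_le_of_le_pi_div_two (by nlinarith [pi_pos]) hx' (by nlinarith)

/-- Concavity of the sine on [0, π], which vanishes at 0. -/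
theorem mul_sin_le_sin_mul {x : ℝ} (hγ : γ ≤ 1) (hγ0 : 0 ≤ γ) (hx : 0 ≤ x) (hx' : x ≤ π) :
    γ * sin x ≤ sin (γ * x) := by
  have h := strictConcaveOn_sin_Icc.concaveOn.2 (x := x) (y := 0) ⟨hx, hx'⟩ ⟨le_rfl, pi_pos.le⟩
    hγ0 (sub_nonneg.2 hγ) (by ring)
  simpa using h

theorem sin_mul_sq_abs (γ x : ℝ) : sin (γ * x) ^ 2 = sin (γ * |x|) ^ 2 := by
  rcases abs_choice x with h | h <;> rw [h]
  rw [mul_neg, sin_neg, neg_sq]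

/-- Termwise from sin(γx) ≤ sin x, which uses x ≤ π/2; hence the restriction to the hemisphere. -/
theorem norm_dilation_sub_sq_le (hγ : γ ≤ 1) (hγ0 : 0 ≤ γ) (hp : polarRadius p ≤ π / 2)
    (hq : polarRadius q ≤ π / 2) :
    ‖dilation γ p - dilation γ q‖ ^ 2 ≤ ‖(p : Amb N) - q‖ ^ 2 := by
  have hπ := pi_pos
  have hp' : polarRadius p < π := by linarith
  have hq' : polarRadius q < π := by linarith
  have hp0 := polarRadius_nonneg p
  have hq0 := polarRadius_nonneg q
  rw [norm_dilation_sub_sq γ hp' hq', norm_coe_sub_sq hp' hq']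
  have h1 : 0 ≤ 1 - ⟪polarDirection p, polarDirection q⟫_ℝ :=
    sub_nonneg.2 (inner_polarDirection_le_one p q)
  have ha : |(polarRadius p - polarRadius q) / 2| ≤ π / 2 :=
    abs_le.2 ⟨by linarith, by linarith⟩
  have h2 : sin (γ * ((polarRadius p - polarRadius q) / 2)) ^ 2 ≤
      sin ((polarRadius p - polarRadius q) / 2) ^ 2 := by
    have hab := sin_mul_sq_abs 1 ((polarRadius p - polarRadius q) / 2)
    rw [one_mul, one_mul] at hab
    have hnn := abs_nonneg ((polarRadius p - polarRadius q) / 2)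
    rw [sin_mul_sq_abs, hab]
    exact pow_le_pow_left₀ (sin_nonneg_of_nonneg_of_le_pi (by positivity)
      (by nlinarith)) (sin_mul_le_sin hγ hγ0 (abs_nonneg _) ha) 2
  have h3 : sin (γ * polarRadius p) * sin (γ * polarRadius q) ≤
      sin (polarRadius p) * sin (polarRadius q) := by
    exact mul_le_mul (sin_mul_le_sin hγ hγ0 hp0 hp) (sin_mul_le_sin hγ hγ0 hq0 hq)
      (sin_nonneg_of_nonneg_of_le_pi (by positivity) (by nlinarith))
      (sin_nonneg_of_nonneg_of_le_pi hp0 hp'.le)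
  have h4 := mul_le_mul_of_nonneg_left h3 (by linarith : 0 ≤ 2 *
    (1 - ⟪polarDirection p, polarDirection q⟫_ℝ))
  linarith

/-- Termwise from γ sin x ≤ sin(γx); the bound makes the inverse map γ⁻¹-Lipschitz. -/
theorem le_norm_dilation_sub_sq (hγ : γ ≤ 1) (hγ0 : 0 ≤ γ) (hp : polarRadius p < π)
    (hq : polarRadius q < π) :
    γ ^ 2 * ‖(p : Amb N) - q‖ ^ 2 ≤ ‖dilation γ p - dilation γ q‖ ^ 2 := by
  have hπ := pi_pos
  have hp0 := polarRadius_nonneg p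
  have hq0 := polarRadius_nonneg q
  rw [norm_dilation_sub_sq γ hp hq, norm_coe_sub_sq hp hq]
  have h1 : 0 ≤ 1 - ⟪polarDirection p, polarDirection q⟫_ℝ :=
    sub_nonneg.2 (inner_polarDirection_le_one p q)
  have ha : |(polarRadius p - polarRadius q) / 2| ≤ π :=
    abs_le.2 ⟨by linarith, by linarith⟩
  have h2 : γ ^ 2 * sin ((polarRadius p - polarRadius q) / 2) ^ 2 ≤
      sin (γ * ((polarRadius p - polarRadius q) / 2)) ^ 2 := by
    have hab := sin_mul_sq_abs 1 ((polarRadius p - polarRadius q) / 2)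
    rw [one_mul, one_mul] at hab
    rw [sin_mul_sq_abs γ, hab, ← mul_pow]
    exact pow_le_pow_left₀ (mul_nonneg hγ0 (sin_nonneg_of_nonneg_of_le_pi (abs_nonneg _) ha))
      (mul_sin_le_sin_mul hγ hγ0 (abs_nonneg _) ha) 2
  have h3 : γ ^ 2 * (sin (polarRadius p) * sin (polarRadius q)) ≤
      sin (γ * polarRadius p) * sin (γ * polarRadius q) := by
    rw [show γ ^ 2 * (sin (polarRadius p) * sin (polarRadius q)) =
      (γ * sin (polarRadius p)) * (γ * sin (polarRadius q)) by ring]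
    exact mul_le_mul (mul_sin_le_sin_mul hγ hγ0 hp0 hp.le) (mul_sin_le_sin_mul hγ hγ0 hq0 hq.le)
      (mul_nonneg hγ0 (sin_nonneg_of_nonneg_of_le_pi hq0 hq.le))
      (sin_nonneg_of_nonneg_of_le_pi (by positivity) (by nlinarith))
  have h4 := mul_le_mul_of_nonneg_left h3 (by linarith : 0 ≤ 2 *
    (1 - ⟪polarDirection p, polarDirection q⟫_ℝ))
  linarith

/-- The double angle formula reduces this to 2 cos²(x/2) ≥ 1, that is, cos x ≥ 0. It is the source
of the contraction factor 1/2. -/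
theorem two_mul_sin_half_sq_le {x : ℝ} (hx : |x| ≤ π / 2) : 2 * sin (1 / 2 * x) ^ 2 ≤ sin x ^ 2 := by
  have h1 : sin x = 2 * sin (1 / 2 * x) * cos (1 / 2 * x) := by
    rw [← sin_two_mul]
    ring_nf
  have h2 : cos x = 2 * cos (1 / 2 * x) ^ 2 - 1 := by
    rw [← cos_two_mul]
    ring_nf
  have h3 : 0 ≤ cos x := cos_nonneg_of_neg_pi_div_two_le_of_le (abs_le.1 hx).1 (abs_le.1 hx).2
  rw [h1, mul_pow, mul_pow]
  nlinarith [sq_nonneg (sin (1 / 2 * x))]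

theorem norm_dilation_half_sub_sq_le (hp : polarRadius p ≤ π / 2) (hq : polarRadius q ≤ π / 2) :
    ‖dilation (1 / 2) p - dilation (1 / 2) q‖ ^ 2 ≤ 1 / 2 * ‖(p : Amb N) - q‖ ^ 2 := by
  have hπ := pi_pos
  have hp' : polarRadius p < π := by linarith
  have hq' : polarRadius q < π := by linarith
  have hp0 := polarRadius_nonneg p
  have hq0 := polarRadius_nonneg q
  rw [norm_dilation_sub_sq _ hp' hq', norm_coe_sub_sq hp' hq']
  have h1 : 0 ≤ 1 - ⟪polarDirection p, polarDirection q⟫_ℝ :=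
    sub_nonneg.2 (inner_polarDirection_le_one p q)
  have h2 := two_mul_sin_half_sq_le (x := (polarRadius p - polarRadius q) / 2)
    (abs_le.2 ⟨by linarith, by linarith⟩)
  have h3 : 2 * (sin (1 / 2 * polarRadius p) * sin (1 / 2 * polarRadius q)) ≤
      sin (polarRadius p) * sin (polarRadius q) := by
    have hx := two_mul_sin_half_sq_le (x := polarRadius p) (abs_le.2 ⟨by linarith, hp⟩)
    have hy := two_mul_sin_half_sq_le (x := polarRadius q) (abs_le.2 ⟨by linarith, hq⟩)
    have h4 : 0 ≤ sin (polarRadius p) * sin (polarRadius q) :=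
      mul_nonneg (sin_nonneg_of_nonneg_of_le_pi hp0 hp'.le)
        (sin_nonneg_of_nonneg_of_le_pi hq0 hq'.le)
    -- After squaring, the angular inequality is the product of the two half-angle inequalities.
    refine le_of_abs_le (abs_le_of_sq_le_sq ?_ h4)
    have h5 := mul_le_mul hx hy (by positivity) (sq_nonneg _)
    nlinarith
  have h4 := mul_le_mul_of_nonneg_left h3 (by linarith : 0 ≤
    (1 - ⟪polarDirection p, polarDirection q⟫_ℝ))
  linarith

end Dilation

end SphericalNeumann

namespace SphericalNeumann

/-! ### The homogeneous extension of `φ_γ` and dilated smooth domains -/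

section ConeDilation

variable {N : ℕ} [NeZero N] {γ δ : ℝ} {p q : Sph N} {x : Amb N} {D : Set (Sph N)}

theorem polarRadius_lt_pi_iff : polarRadius p < π ↔ -1 < ⟪northPole N, (p : Amb N)⟫_ℝ := by
  rw [lt_iff_le_and_ne, and_iff_right (polarRadius_le_pi p), Ne, polarRadius, arccos_eq_pi, not_le]

variable (N) in
/-- The complement of the negative axis. -/
def slitSpace : Set (Amb N) := {x | -‖x‖ < ⟪northPole N, x⟫_ℝ}

theorem isOpen_slitSpace : IsOpen (slitSpace N) :=
  isOpen_lt (by fun_prop) (by fun_prop)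

theorem ne_zero_of_mem_slitSpace (hx : x ∈ slitSpace N) : x ≠ 0 := by
  rintro rfl
  simp [slitSpace] at hx

theorem mem_slitSpace_iff (hx : x ≠ 0) : x ∈ slitSpace N ↔ polarRadius (dir x) < π := by
  have h0 : 0 < ‖x‖ := norm_pos_iff.2 hx
  rw [polarRadius_lt_pi_iff, coe_dir hx, real_inner_smul_right, slitSpace, mem_ofPred_eq,
    inv_mul_eq_div, lt_div_iff₀ h0, neg_one_mul]

/-- The extension of `φ_γ` that is homogeneous of degree one. -/
noncomputable def coneDilation (γ : ℝ) (x : Amb N) : Amb N := ‖x‖ • dilation γ (dir x)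

theorem coneDilation_coe (γ : ℝ) (p : Sph N) : coneDilation γ (p : Amb N) = dilation γ p := by
  rw [coneDilation, norm_coe_sph, one_smul, dir_coe]

theorem coneDilation_smul (γ : ℝ) {t : ℝ} (ht : 0 < t) (x : Amb N) :
    coneDilation γ (t • x) = t • coneDilation γ x := by
  rw [coneDilation, coneDilation, dir_smul ht, norm_smul, Real.norm_eq_abs, abs_of_pos ht, mul_smul]

theorem coneDilation_eq_smul_dilSph (γ : ℝ) (hx : x ∈ slitSpace N) :
    coneDilation γ x = ‖x‖ • (dilSph γ (dir x) : Amb N) := by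
  rw [coneDilation, coe_dilSph γ ((mem_slitSpace_iff (ne_zero_of_mem_slitSpace hx)).1 hx)]

theorem norm_coneDilation (γ : ℝ) (hx : x ∈ slitSpace N) : ‖coneDilation γ x‖ = ‖x‖ := by
  rw [coneDilation_eq_smul_dilSph γ hx, norm_smul, norm_coe_sph, norm_norm, mul_one]

theorem dir_coneDilation (γ : ℝ) (hx : x ∈ slitSpace N) :
    dir (coneDilation γ x) = dilSph γ (dir x) := by
  rw [coneDilation_eq_smul_dilSph γ hx,
    dir_smul_sph (norm_pos_iff.2 (ne_zero_of_mem_slitSpace hx))]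

/-- The quotient sin(γr) / sin r equals γ sinc(γr) / sinc r, and cos and sinc are smooth functions
of r². As r² is a smooth function of the height, this form shows smoothness across the pole. -/
theorem dilation_eq_cosSqrt {Q : ℝ → ℝ} (hQ : ∀ c ≤ 1, Q c = arccos c ^ 2) (γ : ℝ)
    (hp : polarRadius p < π) :
    dilation γ p = cosSqrt (γ ^ 2 * Q ⟪northPole N, (p : Amb N)⟫_ℝ) • northPole N +
      (γ * (deriv cosSqrt (γ ^ 2 * Q ⟪northPole N, (p : Amb N)⟫_ℝ) /
        deriv cosSqrt (Q ⟪northPole N, (p : Amb N)⟫_ℝ))) •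
        ((p : Amb N) - ⟪northPole N, (p : Amb N)⟫_ℝ • northPole N) := by
  have h1 : Q ⟪northPole N, (p : Amb N)⟫_ℝ = polarRadius p ^ 2 :=
    hQ _ (abs_le.1 (abs_inner_northPole_le p)).2
  have h2 : deriv cosSqrt (polarRadius p ^ 2) = -sinc (polarRadius p) / 2 := by
    rw [sinc_eq_deriv_cosSqrt]
    ring
  have h3 : deriv cosSqrt ((γ * polarRadius p) ^ 2) = -sinc (γ * polarRadius p) / 2 := by
    rw [sinc_eq_deriv_cosSqrt]
    ring
  have h4 := sinc_pos_of_lt_pi (polarRadius_nonneg p) hp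
  rw [h1, ← mul_pow, cosSqrt_sq, h2, h3, ← cos_polarRadius, ← sin_smul_polarDirection, smul_smul,
    dilation, fromPolar, ← mul_sinc (polarRadius p), ← mul_sinc (γ * polarRadius p)]
  congr 2
  field_simp

theorem contDiffAt_coneDilation (γ : ℝ) (hx : x ∈ slitSpace N) :
    ContDiffAt ℝ ∞ (coneDilation γ : Amb N → Amb N) x := by
  obtain ⟨Q, hQs, hQ⟩ := exists_smooth_arccosSq
  have hx0 := ne_zero_of_mem_slitSpace hx
  have hxn : ‖x‖ ≠ 0 := norm_ne_zero_iff.2 hx0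
  have hnorm : ContDiffAt ℝ ∞ (fun y : Amb N => ‖y‖) x := contDiffAt_norm ℝ hx0
  have hdir : ContDiffAt ℝ ∞ (fun y : Amb N => ‖y‖⁻¹ • y) x := (hnorm.inv hxn).smul contDiffAt_id
  have hc : ContDiffAt ℝ ∞ (fun y : Amb N => ⟪northPole N, ‖y‖⁻¹ • y⟫_ℝ) x :=
    contDiffAt_const.inner ℝ hdir
  have hr := (mem_slitSpace_iff hx0).1 hx
  have hcx : ⟪northPole N, ‖x‖⁻¹ • x⟫_ℝ ∈ Ioc (-1 : ℝ) 1 := by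
    rw [← coe_dir hx0]
    exact ⟨polarRadius_lt_pi_iff.1 hr, (abs_le.1 (abs_inner_northPole_le _)).2⟩
  have hQc : ContDiffAt ℝ ∞ (fun y : Amb N => Q ⟪northPole N, ‖y‖⁻¹ • y⟫_ℝ) x :=
    ContDiffAt.comp (f := fun y : Amb N => ⟪northPole N, ‖y‖⁻¹ • y⟫_ℝ) x (hQs _ hcx) hc
  have hne : deriv cosSqrt (Q ⟪northPole N, ‖x‖⁻¹ • x⟫_ℝ) ≠ 0 := by
    rw [hQ _ hcx.2, ← coe_dir hx0]
    intro h
    have h1 := sinc_eq_deriv_cosSqrt (polarRadius (dir x))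
    rw [polarRadius, h, mul_zero] at h1
    exact (sinc_pos_of_lt_pi (polarRadius_nonneg _) hr).ne' h1
  have h1 : ContDiffAt ℝ ∞ (fun y : Amb N => cosSqrt (γ ^ 2 * Q ⟪northPole N, ‖y‖⁻¹ • y⟫_ℝ)) x :=
    contDiff_cosSqrt.contDiffAt.comp x (contDiffAt_const.mul hQc)
  have h2 : ContDiffAt ℝ ∞ (fun y : Amb N =>
      deriv cosSqrt (γ ^ 2 * Q ⟪northPole N, ‖y‖⁻¹ • y⟫_ℝ)) x :=
    contDiff_deriv_cosSqrt.contDiffAt.comp x (contDiffAt_const.mul hQc)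
  have h3 : ContDiffAt ℝ ∞ (fun y : Amb N => deriv cosSqrt (Q ⟪northPole N, ‖y‖⁻¹ • y⟫_ℝ)) x :=
    contDiff_deriv_cosSqrt.contDiffAt.comp x hQc
  have h4 := hnorm.smul ((h1.smul (contDiffAt_const (c := northPole N))).add
    ((contDiffAt_const (c := γ)).mul (h2.div h3 hne) |>.smul
      (hdir.sub (hc.smul (contDiffAt_const (c := northPole N))))))
  refine h4.congr_of_eventuallyEq ?_
  filter_upwards [isOpen_slitSpace.mem_nhds hx] with y hy
  have hy0 := ne_zero_of_mem_slitSpace hy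
  rw [coneDilation, dilation_eq_cosSqrt hQ γ ((mem_slitSpace_iff hy0).1 hy), coe_dir hy0]
  rfl

/-- A norm preserving diffeomorphism between the cones over `D` and `D'` that is homogeneous of
degree one, together with its inverse. -/
structure IsConeDiffeo (D D' : Set (Sph N)) (F F' : Amb N → Amb N) : Prop where
  smooth : ContDiffOn ℝ ∞ F (cone D)
  smooth_inv : ContDiffOn ℝ ∞ F' (cone D')
  maps : ∀ x ∈ cone D, F x ∈ cone D'
  maps_inv : ∀ y ∈ cone D', F' y ∈ cone D
  left_inv : ∀ x ∈ cone D, F' (F x) = x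
  right_inv : ∀ y ∈ cone D', F (F' y) = y
  norm_eq : ∀ x ∈ cone D, ‖F x‖ = ‖x‖
  homogeneous : ∀ x ∈ cone D, ∀ t : ℝ, 0 < t → F (t • x) = t • F x

theorem smul_mem_cone_of_mem {x : Amb N} (hx : x ∈ cone D) {t : ℝ} (ht : 0 < t) :
    t • x ∈ cone D :=
  ⟨smul_ne_zero ht.ne' hx.1, by rw [dir_smul ht]; exact hx.2⟩

theorem IsConeDiffeo.symm {D' : Set (Sph N)} {F F' : Amb N → Amb N} (h : IsConeDiffeo D D' F F') :
    IsConeDiffeo D' D F' F where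
  smooth := h.smooth_inv
  smooth_inv := h.smooth
  maps := h.maps_inv
  maps_inv := h.maps
  left_inv := h.right_inv
  right_inv := h.left_inv
  norm_eq y hy := by rw [← h.norm_eq _ (h.maps_inv y hy), h.right_inv y hy]
  homogeneous y hy t ht := by
    rw [← h.left_inv _ (smul_mem_cone_of_mem (h.maps_inv y hy) ht),
      h.homogeneous _ (h.maps_inv y hy) t ht, h.right_inv y hy]

theorem dilatedDomain_eq_image (hD : ∀ p ∈ D, polarRadius p < π) (γ : ℝ) :
    dilatedDomain γ D = dilSph γ '' D := by
  ext q
  constructor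
  · rintro ⟨p, hp, hq⟩
    exact ⟨p, hp, Subtype.ext (by rw [coe_dilSph γ (hD p hp), hq])⟩
  · rintro ⟨p, hp, rfl⟩
    exact ⟨p, hp, coe_dilSph γ (hD p hp)⟩

theorem cone_subset_slitSpace (hD : ∀ p ∈ D, polarRadius p < π) : cone D ⊆ slitSpace N :=
  fun _ hx => (mem_slitSpace_iff hx.1).2 (hD _ hx.2)

theorem isConeDiffeo_coneDilation (hD : ∀ p ∈ D, polarRadius p < π) (hγ : 0 < γ)
    (hD' : ∀ p ∈ D, γ * polarRadius p < π) :
    IsConeDiffeo D (dilatedDomain γ D) (coneDilation γ) (coneDilation γ⁻¹) := by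
  have hs := cone_subset_slitSpace hD
  have himg := dilatedDomain_eq_image hD γ
  have hDγ : ∀ q ∈ dilatedDomain γ D, polarRadius q < π := by
    rw [himg]
    rintro _ ⟨p, hp, rfl⟩
    rw [polarRadius_dilSph (hD p hp) hγ.le (hD' p hp).le]
    exact hD' p hp
  have hs' := cone_subset_slitSpace hDγ
  have hmaps : ∀ x ∈ cone D, coneDilation γ x ∈ cone (dilatedDomain γ D) := by
    intro x hx
    refine ⟨?_, ?_⟩
    · rw [← norm_ne_zero_iff, norm_coneDilation γ (hs hx)]
      exact norm_ne_zero_iff.2 hx.1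
    · rw [dir_coneDilation γ (hs hx), himg]
      exact mem_image_of_mem _ hx.2
  have hleft : ∀ x ∈ cone D, coneDilation γ⁻¹ (coneDilation γ x) = x := by
    intro x hx
    rw [coneDilation_eq_smul_dilSph γ⁻¹ (hs' (hmaps x hx)), norm_coneDilation γ (hs hx),
      dir_coneDilation γ (hs hx), dilSph_inv_dilSph (hD _ hx.2) hγ (hD' _ hx.2), norm_smul_dir]
  have hsurj : ∀ y ∈ cone (dilatedDomain γ D), ∃ x ∈ cone D, coneDilation γ x = y := by
    rintro y ⟨hy0, hy⟩
    rw [himg] at hy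
    obtain ⟨p, hp, hpy⟩ := hy
    have h0 : 0 < ‖y‖ := norm_pos_iff.2 hy0
    refine ⟨‖y‖ • (p : Amb N), smul_mem_cone hp h0, ?_⟩
    rw [coneDilation_smul γ h0, coneDilation_coe, ← coe_dilSph γ (hD p hp), hpy, norm_smul_dir]
  refine ⟨fun x hx => (contDiffAt_coneDilation γ (hs hx)).contDiffWithinAt,
    fun x hx => (contDiffAt_coneDilation γ⁻¹ (hs' hx)).contDiffWithinAt, hmaps, ?_, hleft, ?_,
    fun x hx => norm_coneDilation γ (hs hx), fun x _ t ht => coneDilation_smul γ ht x⟩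
  · intro y hy
    obtain ⟨x, hx, rfl⟩ := hsurj y hy
    rwa [hleft x hx]
  · intro y hy
    obtain ⟨x, hx, rfl⟩ := hsurj y hy
    rw [hleft x hx]

theorem dilatedDomain_dilatedDomain (hD : ∀ p ∈ D, polarRadius p < π) (hγ : 0 < γ)
    (hD' : ∀ p ∈ D, γ * polarRadius p < π) (δ : ℝ) :
    dilatedDomain δ (dilatedDomain γ D) = dilatedDomain (γ * δ) D := by
  rw [dilatedDomain_eq_image hD (γ * δ), dilatedDomain_eq_image (D := dilatedDomain γ D),
    dilatedDomain_eq_image hD γ, image_image]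
  · exact image_congr fun p hp => dilSph_dilSph (hD p hp) hγ (hD' p hp) δ
  · rw [dilatedDomain_eq_image hD γ]
    rintro _ ⟨p, hp, rfl⟩
    rw [polarRadius_dilSph (hD p hp) hγ.le (hD' p hp).le]
    exact hD' p hp

theorem continuousOn_dilSph (γ : ℝ) :
    ContinuousOn (dilSph γ : Sph N → Sph N) {p | polarRadius p < π} := by
  intro p hp
  have hps : (p : Amb N) ∈ slitSpace N :=
    (mem_slitSpace_iff (coe_sph_ne_zero p)).2 (by rw [dir_coe]; exact hp)
  have h0 : dilation γ p ≠ 0 := norm_ne_zero_iff.1 (by rw [norm_dilation γ hp]; exact one_ne_zero)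
  have h1 : ContinuousAt (fun q : Sph N => coneDilation γ (q : Amb N)) p :=
    ContinuousAt.comp (f := fun q : Sph N => (q : Amb N))
      (contDiffAt_coneDilation γ hps).continuousAt continuous_subtype_val.continuousAt
  simp only [coneDilation_coe] at h1
  exact ((continuousAt_dir h0).comp h1).continuousWithinAt

/-- Differentiate ‖F(x)‖² = ‖x‖². In particular tangent vectors of the sphere are sent to tangent
vectors. -/
theorem inner_fderiv_coneDilation (hx : x ∈ slitSpace N) (v : Amb N) :
    ⟪coneDilation γ x, fderiv ℝ (coneDilation γ) x v⟫_ℝ = ⟪x, v⟫_ℝ := by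
  have hd := ((contDiffAt_coneDilation γ hx).differentiableAt (by simp)).hasFDerivAt
  have h1 := hd.norm_sq
  have h2 : HasFDerivAt (fun y : Amb N => ‖y‖ ^ 2) (2 • innerSL ℝ x) x :=
    (hasStrictFDerivAt_norm_sq x).hasFDerivAt
  have h3 : (fun y : Amb N => ‖y‖ ^ 2) =ᶠ[𝓝 x] fun y => ‖coneDilation γ y‖ ^ 2 := by
    filter_upwards [isOpen_slitSpace.mem_nhds hx] with y hy
    rw [norm_coneDilation γ hy]
  have h4 := congrArg (fun L => L v) ((h1.congr_of_eventuallyEq h3).unique h2)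
  simpa using h4

/-- A defining function of D composed with the inverse cone map defines the image, and a transversal
tangent vector is pushed forward by the derivative of the cone map. -/
theorem IsSmoothDomain.dilatedDomain (hD : IsSmoothDomain D) (hDH : D ⊆ upperHemisphere N)
    (hγ : γ ∈ Ioo (0 : ℝ) 2) : IsSmoothDomain (dilatedDomain γ D) := by
  have hπ := pi_pos
  have hr : ∀ p ∈ D, polarRadius p < π / 2 := fun p hp => polarRadius_lt_pi_div_two_iff.2 (hDH hp)
  have hr1 : ∀ p ∈ D, polarRadius p < π := fun p hp => by linarith [hr p hp]
  have hr2 : ∀ p ∈ D, γ * polarRadius p < π := fun p hp => by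
    nlinarith [hr p hp, polarRadius_nonneg p, hγ.1, hγ.2]
  have himg := dilatedDomain_eq_image hr1 γ
  have hγ0 : γ ≠ 0 := hγ.1.ne'
  have hmem : ∀ q : Sph N, polarRadius q < π → γ⁻¹ * polarRadius q < π →
      (q ∈ SphericalNeumann.dilatedDomain γ D ↔ dilSph γ⁻¹ q ∈ D) := by
    intro q hq1 hq2
    rw [himg]
    constructor
    · rintro ⟨p, hp, rfl⟩
      rwa [dilSph_inv_dilSph (hr1 p hp) hγ.1 (hr2 p hp)]
    · intro h
      refine ⟨_, h, ?_⟩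
      rw [dilSph_dilSph hq1 (inv_pos.2 hγ.1) hq2, inv_mul_cancel₀ hγ0, dilSph_one]
  have hopen : IsOpen (SphericalNeumann.dilatedDomain γ D) := by
    have hU : IsOpen {q : Sph N | polarRadius q < π} :=
      isOpen_lt continuous_polarRadius continuous_const
    have hV : IsOpen {q : Sph N | γ⁻¹ * polarRadius q < π} :=
      isOpen_lt (continuous_const.mul continuous_polarRadius) continuous_const
    have h1 := ((continuousOn_dilSph (N := N) γ⁻¹).isOpen_inter_preimage hU hD.isOpen).inter hV
    convert h1 using 1
    ext q
    constructor
    · intro hq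
      have hq' := hq
      rw [himg] at hq'
      obtain ⟨p, hp, rfl⟩ := hq'
      have h2 := polarRadius_dilSph (hr1 p hp) hγ.1.le (hr2 p hp).le
      have h3 : polarRadius (dilSph γ p) < π := by rw [h2]; exact hr2 p hp
      have h4 : γ⁻¹ * polarRadius (dilSph γ p) < π := by
        rw [h2, inv_mul_cancel_left₀ hγ0]
        exact hr1 p hp
      exact ⟨⟨h3, (hmem _ h3 h4).1 hq⟩, h4⟩
    · rintro ⟨⟨h3, h5⟩, h4⟩
      exact (hmem _ h3 h4).2 h5
  refine ⟨hopen, ?_, ?_⟩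
  · rw [himg]
    exact hD.isConnected.image _ ((continuousOn_dilSph γ).mono hr1)
  · intro q hq
    rw [hopen.frontier_eq] at hq
    -- The closure lies in the closed hemisphere, so for γ < 2 the map stays away from the south
    -- pole on it; by compactness every frontier point of the image comes from a frontier point of
    -- D.
    have hrc : ∀ p ∈ closure D, polarRadius p ≤ π / 2 := fun p hp =>
      closure_minimal (fun p hp => (hr p hp).le)
        (isClosed_le continuous_polarRadius continuous_const) hp
    have hrc1 : ∀ p ∈ closure D, polarRadius p < π := fun p hp => by linarith [hrc p hp]
    have hrc2 : ∀ p ∈ closure D, γ * polarRadius p < π := fun p hp => by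
      nlinarith [hrc p hp, polarRadius_nonneg p, hγ.1, hγ.2]
    obtain ⟨p, hp, rfl⟩ : q ∈ dilSph γ '' closure D := by
      have hcpt : IsCompact (dilSph γ '' closure D) :=
        isClosed_closure.isCompact.image_of_continuousOn ((continuousOn_dilSph γ).mono hrc1)
      refine closure_minimal ?_ hcpt.isClosed hq.1
      rw [himg]
      exact image_mono subset_closure
    have hpD : p ∈ frontier D := by
      rw [hD.isOpen.frontier_eq]
      exact ⟨hp, fun h => hq.2 (by rw [himg]; exact mem_image_of_mem _ h)⟩
    obtain ⟨U, f, hU, hpU, hf, hfp, ⟨w, hw, hfw⟩, hfD⟩ := hD.smooth_boundary p hpD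
    set q := dilSph γ p with hqdef
    have hrq : polarRadius q = γ * polarRadius p :=
      polarRadius_dilSph (hrc1 p hp) hγ.1.le (hrc2 p hp).le
    have hps : (p : Amb N) ∈ slitSpace N :=
      (mem_slitSpace_iff (coe_sph_ne_zero p)).2 (by rw [dir_coe]; exact hrc1 p hp)
    have hqs : (q : Amb N) ∈ slitSpace N :=
      (mem_slitSpace_iff (coe_sph_ne_zero q)).2 (by rw [dir_coe, hrq]; exact hrc2 p hp)
    have hqp : coneDilation γ (p : Amb N) = q := by
      rw [coneDilation_coe, hqdef, coe_dilSph γ (hrc1 p hp)]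
    have hpq : coneDilation γ⁻¹ (q : Amb N) = p := by
      rw [coneDilation_coe, ← coe_dilSph _ (by rw [hrq]; exact hrc2 p hp),
        dilSph_inv_dilSph (hrc1 p hp) hγ.1 (hrc2 p hp)]
    have hO : IsOpen (slitSpace N ∩ {y | γ⁻¹ * polarRadius (dir y) < π}) := by
      refine ContinuousOn.isOpen_inter_preimage (f := fun y : Amb N => γ⁻¹ * polarRadius (dir y))
        ?_ isOpen_slitSpace (isOpen_Iio (a := π))
      intro y hy
      exact (continuousAt_const.mul (continuous_polarRadius.continuousAt.comp
        (continuousAt_dir (ne_zero_of_mem_slitSpace hy)))).continuousWithinAt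
    have hcd : ContDiffOn ℝ ∞ (coneDilation γ⁻¹ : Amb N → Amb N)
        (slitSpace N ∩ {y | γ⁻¹ * polarRadius (dir y) < π}) :=
      fun y hy => (contDiffAt_coneDilation _ hy.1).contDiffWithinAt
    have hqO : (q : Amb N) ∈ slitSpace N ∩ {y | γ⁻¹ * polarRadius (dir y) < π} := by
      refine ⟨hqs, ?_⟩
      rw [mem_ofPred_eq, dir_coe, hrq, inv_mul_cancel_left₀ hγ0]
      exact hrc1 p hp
    have hfd : DifferentiableAt ℝ f (coneDilation γ⁻¹ (q : Amb N)) := by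
      rw [hpq]
      exact (hf.contDiffAt (hU.mem_nhds hpU)).differentiableAt (by simp)
    have hΦ : DifferentiableAt ℝ (coneDilation γ⁻¹ : Amb N → Amb N) (coneDilation γ (p : Amb N)) := by
      rw [hqp]
      exact (contDiffAt_coneDilation _ hqs).differentiableAt (by simp)
    have hΨ : DifferentiableAt ℝ (coneDilation γ : Amb N → Amb N) p :=
      (contDiffAt_coneDilation _ hps).differentiableAt (by simp)
    have hinv : fderiv ℝ (coneDilation γ⁻¹) (q : Amb N)
        (fderiv ℝ (coneDilation γ) (p : Amb N) w) = w := by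
      have h1 := fderiv_comp (p : Amb N) hΦ hΨ
      have hO' : IsOpen (slitSpace N ∩ {y | γ * polarRadius (dir y) < π}) := by
        refine ContinuousOn.isOpen_inter_preimage (f := fun y : Amb N => γ * polarRadius (dir y))
          ?_ isOpen_slitSpace (isOpen_Iio (a := π))
        intro y hy
        exact (continuousAt_const.mul (continuous_polarRadius.continuousAt.comp
          (continuousAt_dir (ne_zero_of_mem_slitSpace hy)))).continuousWithinAt
      have h2 : (coneDilation γ⁻¹ ∘ coneDilation γ : Amb N → Amb N) =ᶠ[𝓝 (p : Amb N)] id := by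
        filter_upwards [hO'.mem_nhds ⟨hps, by rw [mem_ofPred_eq, dir_coe]; exact hrc2 p hp⟩]
          with y hy
        have hy1 := (mem_slitSpace_iff (ne_zero_of_mem_slitSpace hy.1)).1 hy.1
        rw [Function.comp_apply, coneDilation_eq_smul_dilSph γ hy.1, coneDilation_smul _
          (norm_pos_iff.2 (ne_zero_of_mem_slitSpace hy.1)), coneDilation_coe,
          dilation_dilSph hy1 hγ.1 hy.2, mul_inv_cancel₀ hγ0, dilation_one, norm_smul_dir, id]
      rw [h2.fderiv_eq, fderiv_id, hqp] at h1
      exact (congrArg (fun L : Amb N →L[ℝ] Amb N => L w) h1).symm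
    refine ⟨_, fun y => f (coneDilation γ⁻¹ y), hcd.continuousOn.isOpen_inter_preimage hO hU,
      ⟨hqO, ?_⟩, ?_, ?_, ⟨fderiv ℝ (coneDilation γ) (p : Amb N) w, ?_, ?_⟩, ?_⟩
    · rw [mem_preimage, hpq]
      exact hpU
    · exact hf.comp (hcd.mono inter_subset_left) fun y hy => hy.2
    · simp only [hpq, hfp]
    · have := inner_fderiv_coneDilation (γ := γ) hps w
      rwa [hqp, hw] at this
    · have h1 := fderiv_comp (q : Amb N) hfd (by rw [← hqp]; exact hΦ)
      have h2 : fderiv ℝ (fun y => f (coneDilation γ⁻¹ y)) (q : Amb N)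
          (fderiv ℝ (coneDilation γ) (p : Amb N) w) = _ :=
        congrArg (fun L : Amb N →L[ℝ] ℝ => L (fderiv ℝ (coneDilation γ) (p : Amb N) w)) h1
      rw [h2, ContinuousLinearMap.comp_apply, hinv, hpq]
      exact hfw
    · rintro y ⟨⟨hy1, hy2⟩, hy3⟩
      have hy4 := (mem_slitSpace_iff (coe_sph_ne_zero y)).1 hy1
      rw [mem_ofPred_eq] at hy2
      rw [dir_coe] at hy2 hy4
      rw [mem_preimage, coneDilation_coe, ← coe_dilSph _ hy4] at hy3
      rw [hmem y hy4 hy2, hfD _ hy3, coe_dilSph _ hy4]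
      simp only [coneDilation_coe]

end ConeDilation

end SphericalNeumann

namespace SphericalNeumann

/-! ### The chain rule for weak gradients under diffeomorphisms -/

section ChainRule

variable {E : Type*} [NormedAddCommGroup E] [InnerProductSpace ℝ E] [FiniteDimensional ℝ E]
  [MeasurableSpace E] [BorelSpace E]

theorem contDiff_det : ContDiff ℝ ∞ (fun L : E →L[ℝ] E => L.det) := by
  set b := stdOrthonormalBasis ℝ E
  have h : (fun L : E →L[ℝ] E => L.det) = fun L : E →L[ℝ] E =>
      ∑ σ : Equiv.Perm (Fin (Module.finrank ℝ E)), Equiv.Perm.sign σ •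
        ∏ i, ⟪b (σ i), L (b i)⟫_ℝ := by
    funext L
    rw [ContinuousLinearMap.det, ← LinearMap.det_toMatrix b.toBasis, Matrix.det_apply]
    simp [LinearMap.toMatrix_apply, OrthonormalBasis.repr_apply_apply]
  rw [h]
  refine ContDiff.sum fun σ _ => ?_
  refine ContDiff.const_smul _ (contDiff_prod fun i _ => ?_)
  exact contDiff_const.inner ℝ (contDiff_id.clm_apply contDiff_const)

theorem contDiff_indicator_of_eq_zero {F : Type*} [NormedAddCommGroup F] [NormedSpace ℝ F]
    {Ω K : Set E} (hΩ : IsOpen Ω) (hK : IsCompact K) (hKΩ : K ⊆ Ω) {f : E → F}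
    (hf : ContDiffOn ℝ ∞ f Ω) (h0 : ∀ x ∈ Ω, x ∉ K → f x = 0) :
    ContDiff ℝ ∞ (Ω.indicator f) ∧ tsupport (Ω.indicator f) ⊆ K := by
  have h1 : ∀ x ∉ K, Ω.indicator f x = 0 := by
    intro x hx
    by_cases hxΩ : x ∈ Ω
    · rw [indicator_of_mem hxΩ, h0 x hxΩ hx]
    · rw [indicator_of_notMem hxΩ]
  refine ⟨contDiff_iff_contDiffAt.2 fun x => ?_, ?_⟩
  · by_cases hx : x ∈ Ω
    · refine (hf.contDiffAt (hΩ.mem_nhds hx)).congr_of_eventuallyEq ?_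
      filter_upwards [hΩ.mem_nhds hx] with y hy using indicator_of_mem hy f
    · refine (contDiffAt_const (c := (0 : F))).congr_of_eventuallyEq ?_
      filter_upwards [hK.isClosed.isOpen_compl.mem_nhds fun h => hx (hKΩ h)] with y hy
      exact h1 y hy
  · refine closure_minimal (fun x hx => ?_) hK.isClosed
    by_contra h
    exact hx (h1 x h)

variable {Ω Ω' : Set E} {F F' : E → E}

theorem fderiv_comp_fderiv_of_inverse (hΩ : IsOpen Ω) (hΩ' : IsOpen Ω') (hF : ContDiffOn ℝ ∞ F Ω)
    (hF' : ContDiffOn ℝ ∞ F' Ω') (hm' : ∀ y ∈ Ω', F' y ∈ Ω)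
    (hr : ∀ y ∈ Ω', F (F' y) = y) {y : E} (hy : y ∈ Ω') :
    (fderiv ℝ F (F' y)).comp (fderiv ℝ F' y) = ContinuousLinearMap.id ℝ E := by
  have h1 : DifferentiableAt ℝ F (F' y) :=
    (hF.contDiffAt (hΩ.mem_nhds (hm' y hy))).differentiableAt (by simp)
  have h2 : DifferentiableAt ℝ F' y := (hF'.contDiffAt (hΩ'.mem_nhds hy)).differentiableAt (by simp)
  rw [← fderiv_comp y h1 h2, ← fderiv_id (x := y)]
  refine Filter.EventuallyEq.fderiv_eq ?_
  filter_upwards [hΩ'.mem_nhds hy] with z hz using hr z hz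

theorem det_mul_det_of_comp_eq_id {A B : E →L[ℝ] E} (h : A.comp B = ContinuousLinearMap.id ℝ E) :
    A.det * B.det = 1 := by
  have h1 := congrArg ContinuousLinearMap.det h
  simpa [ContinuousLinearMap.det] using h1

theorem setIntegral_comp_diffeo {Z : Type*} [NormedAddCommGroup Z] [NormedSpace ℝ Z]
    (hΩ' : IsOpen Ω') (hF' : ContDiffOn ℝ ∞ F' Ω') (hm : ∀ x ∈ Ω, F x ∈ Ω')
    (hm' : ∀ y ∈ Ω', F' y ∈ Ω) (hl : ∀ x ∈ Ω, F' (F x) = x) (hr : ∀ y ∈ Ω', F (F' y) = y)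
    (g : E → Z) :
    ∫ x in Ω, g x = ∫ y in Ω', |(fderiv ℝ F' y).det| • g (F' y) := by
  have himg : F' '' Ω' = Ω := by
    refine Subset.antisymm (image_subset_iff.2 hm') fun x hx => ⟨F x, hm x hx, hl x hx⟩
  rw [← integral_image_eq_integral_abs_det_fderiv_smul volume hΩ'.measurableSet
    (fun y hy => ((hF'.contDiffAt (hΩ'.mem_nhds hy)).differentiableAt
      (by simp)).hasFDerivAt.hasFDerivWithinAt)
    (fun y hy z hz h => by rw [← hr y hy, h, hr z hz]), himg]

/-- The chain rule for weak gradients under a smooth diffeomorphism `F : Ω → Ω'` with inverse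
`F'`. -/
theorem HasWeakGradient.comp_diffeo {u : E → ℝ} {G : E → E} (hΩ : IsOpen Ω) (hΩ' : IsOpen Ω')
    (hF : ContDiffOn ℝ ∞ F Ω) (hF' : ContDiffOn ℝ ∞ F' Ω') (hm : ∀ x ∈ Ω, F x ∈ Ω')
    (hm' : ∀ y ∈ Ω', F' y ∈ Ω) (hl : ∀ x ∈ Ω, F' (F x) = x) (hr : ∀ y ∈ Ω', F (F' y) = y)
    (h : HasWeakGradient Ω' u G) (hu : LocallyIntegrableOn u Ω') (hG : LocallyIntegrableOn G Ω') :
    HasWeakGradient Ω (fun x => u (F x))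
      (fun x => ContinuousLinearMap.adjoint (fderiv ℝ F x) (G (F x))) := by
  intro φ hφ hc hs e
  have hcv := fun (g : E → ℝ) => setIntegral_comp_diffeo hΩ' hF' hm hm' hl hr g
  have hK : IsCompact (F '' tsupport φ) := hc.isCompact.image_of_continuousOn (hF.continuousOn.mono hs)
  have hKΩ : F '' tsupport φ ⊆ Ω' := by
    rintro _ ⟨x, hx, rfl⟩
    exact hm x (hs hx)
  have hKmem : ∀ y ∈ Ω', y ∉ F '' tsupport φ → F' y ∉ tsupport φ := fun y hy hyK h =>
    hyK ⟨F' y, h, hr y hy⟩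
  have hdet : ∀ y ∈ Ω', (fderiv ℝ F' y).det ≠ 0 := fun y hy => right_ne_zero_of_mul_eq_one
    (det_mul_det_of_comp_eq_id (fderiv_comp_fderiv_of_inverse hΩ hΩ' hF hF' hm' hr hy))
  have hJ : ContDiffOn ℝ ∞ (fun y => |(fderiv ℝ F' y).det|) Ω' :=
    (contDiff_det.comp_contDiffOn (hF'.fderiv_of_isOpen hΩ' (by simp))).abs hdet
  have hdF : ContDiffOn ℝ ∞ (fun y => fderiv ℝ F (F' y) e) Ω' :=
    ((hF.fderiv_of_isOpen hΩ (by simp)).comp hF' hm').clm_apply contDiffOn_const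
  have hφF : ContDiffOn ℝ ∞ (fun y => φ (F' y)) Ω' := hφ.comp_contDiffOn hF'
  have hφF' : ContDiffOn ℝ ∞ (fun y => fderiv ℝ φ (F' y) e) Ω' :=
    ((hφ.fderiv_right (m := ∞) (by simp)).comp_contDiffOn hF').clm_apply contDiffOn_const
  -- The field X is the Piola transform of φ e: the pushed-forward field times the Jacobian of the
  -- inverse, extended by zero.
  obtain ⟨hX, hXs⟩ := contDiff_indicator_of_eq_zero (f := fun y =>
    (φ (F' y) * |(fderiv ℝ F' y).det|) • fderiv ℝ F (F' y) e) hΩ' hK hKΩ ((hφF.mul hJ).smul hdF)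
    fun y hy hyK => by
      rw [image_eq_zero_of_notMem_tsupport (hKmem y hy hyK), zero_mul, zero_smul]
  obtain ⟨hT, hTs⟩ := contDiff_indicator_of_eq_zero (f := fun y =>
    |(fderiv ℝ F' y).det| * fderiv ℝ φ (F' y) e) hΩ' hK hKΩ (hJ.mul hφF') fun y hy hyK => by
      rw [fderiv_of_notMem_tsupport (𝕜 := ℝ) (hKmem y hy hyK)]
      simp
  set X := Ω'.indicator fun y => (φ (F' y) * |(fderiv ℝ F' y).det|) • fderiv ℝ F (F' y) e with hXdef
  set T := Ω'.indicator fun y => |(fderiv ℝ F' y).det| * fderiv ℝ φ (F' y) e with hTdef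
  have hXc : HasCompactSupport X := hK.of_isClosed_subset (isClosed_tsupport X) hXs
  have hTc : HasCompactSupport T := hK.of_isClosed_subset (isClosed_tsupport T) hTs
  have htrace : Continuous fun y => LinearMap.trace ℝ E (fderiv ℝ X y : E →ₗ[ℝ] E) := by
    have h1 : Continuous ((LinearMap.trace ℝ E).comp (ContinuousLinearMap.coeLM ℝ) :
      (E →L[ℝ] E) →ₗ[ℝ] ℝ) := LinearMap.continuous_of_finiteDimensional _
    exact h1.comp (hX.continuous_fderiv (by simp))
  -- The Piola identity div X = T is derived without differentiating the Jacobian: for every smooth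
  -- g, integration by parts in Ω' and, after the change of variables, in Ω gives equal pairings.
  have hdiv : ∀ᵐ y, LinearMap.trace ℝ E (fderiv ℝ X y : E →ₗ[ℝ] E) - T y = 0 := by
    refine ae_eq_zero_of_integral_contDiff_smul_eq_zero
      (htrace.sub hT.continuous).locallyIntegrable fun g hg hgc => ?_
    have hgrad : ∀ y v, fderiv ℝ g y v = ⟪gradient g y, v⟫_ℝ := fun y v => by
      rw [gradient, InnerProductSpace.toDual_symm_apply]
    have hgradc : Continuous (gradient g) :=
      (InnerProductSpace.toDual ℝ E).symm.continuous.comp (hg.continuous_fderiv (by simp))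
    have hw : HasWeakGradient univ g (gradient g) := hasWeakGradient_of_contDiffOn isOpen_univ
      (hg.contDiffOn.of_le (by exact_mod_cast le_top)) fun y _ v => hgrad y v
    have h1 := hw.integral_mul_trace (hg.continuous.locallyIntegrable.locallyIntegrableOn _)
      (hgradc.locallyIntegrable.locallyIntegrableOn _) hX hXc (subset_univ _)
    have hgF : ContDiffOn ℝ ∞ (fun x => g (F x)) Ω := hg.comp_contDiffOn hF
    have hw2 : HasWeakGradient Ω (fun x => g (F x)) (gradient fun x => g (F x)) :=
      hasWeakGradient_of_contDiffOn hΩ (hgF.of_le (by exact_mod_cast le_top)) fun y _ v => by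
        rw [gradient, InnerProductSpace.toDual_symm_apply]
    have h2 := hw2 φ hφ hc hs e
    have h3 : ∫ y, ⟪gradient g y, X y⟫_ℝ =
        ∫ x, ⟪gradient (fun x => g (F x)) x, e⟫_ℝ * φ x := by
      have h4 : ∫ x, ⟪gradient (fun x => g (F x)) x, e⟫_ℝ * φ x =
          ∫ x in Ω, ⟪gradient (fun x => g (F x)) x, e⟫_ℝ * φ x := by
        refine (setIntegral_eq_integral_of_forall_compl_eq_zero fun x hx => ?_).symm
        rw [image_eq_zero_of_notMem_tsupport fun h => hx (hs h), mul_zero]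
      have h5 : ∫ y, ⟪gradient g y, X y⟫_ℝ = ∫ y in Ω', ⟪gradient g y, X y⟫_ℝ := by
        refine (setIntegral_eq_integral_of_forall_compl_eq_zero fun x hx => ?_).symm
        rw [hXdef, indicator_of_notMem hx, inner_zero_right]
      rw [h4, h5, hcv]
      refine setIntegral_congr_fun hΩ'.measurableSet fun y hy => ?_
      have h6 : DifferentiableAt ℝ F (F' y) :=
        (hF.contDiffAt (hΩ.mem_nhds (hm' y hy))).differentiableAt (by simp)
      have h7 : fderiv ℝ (fun x => g (F x)) (F' y) = _ :=
        fderiv_comp (F' y) ((hg.differentiable (by simp)) (F (F' y))) h6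
      rw [hXdef, indicator_of_mem hy, real_inner_smul_right, ← hgrad, gradient,
        InnerProductSpace.toDual_symm_apply, h7, ContinuousLinearMap.comp_apply, hr y hy, smul_eq_mul]
      ring
    have h4 : ∫ x, g (F x) * fderiv ℝ φ x e = ∫ y, g y * T y := by
      have h5 : ∫ x, g (F x) * fderiv ℝ φ x e = ∫ x in Ω, g (F x) * fderiv ℝ φ x e := by
        refine (setIntegral_eq_integral_of_forall_compl_eq_zero fun x hx => ?_).symm
        rw [fderiv_of_notMem_tsupport (𝕜 := ℝ) fun h => hx (hs h)]
        simp
      have h6 : ∫ y, g y * T y = ∫ y in Ω', g y * T y := by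
        refine (setIntegral_eq_integral_of_forall_compl_eq_zero fun x hx => ?_).symm
        rw [hTdef, indicator_of_notMem hx, mul_zero]
      rw [h5, h6, hcv]
      refine setIntegral_congr_fun hΩ'.measurableSet fun y hy => ?_
      rw [hTdef, indicator_of_mem hy, hr y hy, smul_eq_mul]
      ring
    simp only [smul_eq_mul, mul_sub]
    rw [integral_sub, h1, h3, ← h4, h2, sub_self]
    · exact (hg.continuous.mul htrace).integrable_of_hasCompactSupport hgc.mul_right
    · exact (hg.continuous.mul hT.continuous).integrable_of_hasCompactSupport hgc.mul_right
  -- The weak gradient of u is tested with X; the change of variables brings both sides back to Ω.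
  have hmain := h.integral_mul_trace hu hG hX hXc (hXs.trans hKΩ)
  have h1 : ∫ y, u y * LinearMap.trace ℝ E (fderiv ℝ X y : E →ₗ[ℝ] E) =
      ∫ x, u (F x) * fderiv ℝ φ x e := by
    have h5 : ∫ x, u (F x) * fderiv ℝ φ x e = ∫ x in Ω, u (F x) * fderiv ℝ φ x e := by
      refine (setIntegral_eq_integral_of_forall_compl_eq_zero fun x hx => ?_).symm
      rw [fderiv_of_notMem_tsupport (𝕜 := ℝ) fun h => hx (hs h)]
      simp
    have h6 : ∫ y, u y * LinearMap.trace ℝ E (fderiv ℝ X y : E →ₗ[ℝ] E) = ∫ y, u y * T y := by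
      refine integral_congr_ae ?_
      filter_upwards [hdiv] with y hy
      rw [sub_eq_zero.1 hy]
    have h7 : ∫ y, u y * T y = ∫ y in Ω', u y * T y := by
      refine (setIntegral_eq_integral_of_forall_compl_eq_zero fun x hx => ?_).symm
      rw [hTdef, indicator_of_notMem hx, mul_zero]
    rw [h5, h6, h7, hcv]
    refine setIntegral_congr_fun hΩ'.measurableSet fun y hy => ?_
    rw [hTdef, indicator_of_mem hy, hr y hy, smul_eq_mul]
    ring
  rw [← h1, hmain]
  congr 1
  have h4 : ∫ x, ⟪ContinuousLinearMap.adjoint (fderiv ℝ F x) (G (F x)), e⟫_ℝ * φ x =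
      ∫ x in Ω, ⟪ContinuousLinearMap.adjoint (fderiv ℝ F x) (G (F x)), e⟫_ℝ * φ x := by
    refine (setIntegral_eq_integral_of_forall_compl_eq_zero fun x hx => ?_).symm
    rw [image_eq_zero_of_notMem_tsupport fun h => hx (hs h), mul_zero]
  have h5 : ∫ y, ⟪G y, X y⟫_ℝ = ∫ y in Ω', ⟪G y, X y⟫_ℝ := by
    refine (setIntegral_eq_integral_of_forall_compl_eq_zero fun x hx => ?_).symm
    rw [hXdef, indicator_of_notMem hx, inner_zero_right]
  rw [h4, h5, hcv]
  refine setIntegral_congr_fun hΩ'.measurableSet fun y hy => ?_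
  rw [hXdef, indicator_of_mem hy, hr y hy, real_inner_smul_right,
    ContinuousLinearMap.adjoint_inner_left, smul_eq_mul]
  ring

end ChainRule

end SphericalNeumann

namespace SphericalNeumann

/-! ### Comparison of Poincaré constants under homogeneous diffeomorphisms of cones -/

section Comparison

variable {N : ℕ} [NeZero N] {D D' : Set (Sph N)} {F F' : Amb N → Amb N}

namespace IsConeDiffeo

theorem norm_coe (h : IsConeDiffeo D D' F F') {p : Sph N} (hp : p ∈ D) : ‖F p‖ = 1 := by
  rw [h.norm_eq _ (by simpa using smul_mem_cone hp one_pos), norm_coe_sph]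

theorem _root_.SphericalNeumann.coe_mem_cone {p : Sph N} (hp : p ∈ D) : (p : Amb N) ∈ cone D := by
  simpa using smul_mem_cone hp one_pos

theorem coe_dir_apply (h : IsConeDiffeo D D' F F') {p : Sph N} (hp : p ∈ D) :
    (dir (F p) : Amb N) = F p := by
  rw [coe_dir (norm_ne_zero_iff.1 (by rw [h.norm_coe hp]; exact one_ne_zero)), h.norm_coe hp,
    inv_one, one_smul]

theorem apply_eq (h : IsConeDiffeo D D' F F') {x : Amb N} (hx : x ∈ cone D) :
    F x = ‖x‖ • F (dir x) := by
  rw [← h.homogeneous _ (coe_mem_cone hx.2) _ (norm_pos_iff.2 hx.1), norm_smul_dir]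

theorem dir_apply (h : IsConeDiffeo D D' F F') {x : Amb N} (hx : x ∈ cone D) :
    dir (F x) = dir (F (dir x)) := by
  rw [h.apply_eq hx, dir_smul (norm_pos_iff.2 hx.1)]

theorem dir_mem (h : IsConeDiffeo D D' F F') {p : Sph N} (hp : p ∈ D) : dir (F p) ∈ D' :=
  (h.maps _ (coe_mem_cone hp)).2

theorem differentiableAt (h : IsConeDiffeo D D' F F') (hD : IsOpen D) {x : Amb N}
    (hx : x ∈ cone D) : DifferentiableAt ℝ F x :=
  (h.smooth.contDiffAt ((isOpen_cone hD).mem_nhds hx)).differentiableAt (by simp)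

theorem fderiv_smul (h : IsConeDiffeo D D' F F') (hD : IsOpen D) {x : Amb N} (hx : x ∈ cone D)
    {t : ℝ} (ht : 0 < t) : fderiv ℝ F (t • x) = fderiv ℝ F x := by
  have h1 : (fun y => F (t • y)) =ᶠ[𝓝 x] fun y => t • F y := by
    filter_upwards [(isOpen_cone hD).mem_nhds hx] with y hy using h.homogeneous y hy t ht
  have h2 := h1.fderiv_eq (𝕜 := ℝ)
  rw [fderiv_comp_smul, fderiv_fun_const_smul (h.differentiableAt hD hx)] at h2
  exact smul_right_injective _ ht.ne' h2

theorem fderiv_dir (h : IsConeDiffeo D D' F F') (hD : IsOpen D) {x : Amb N} (hx : x ∈ cone D) :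
    fderiv ℝ F x = fderiv ℝ F (dir x : Amb N) := by
  rw [← h.fderiv_smul hD (coe_mem_cone hx.2) (norm_pos_iff.2 hx.1), norm_smul_dir]

/-- Euler's relation for degree one. -/
theorem fderiv_self (h : IsConeDiffeo D D' F F') (hD : IsOpen D) {p : Sph N} (hp : p ∈ D) :
    fderiv ℝ F (p : Amb N) p = F p := by
  have hd : HasFDerivAt F (fderiv ℝ F (p : Amb N)) ((1 : ℝ) • (p : Amb N)) := by
    rw [one_smul]
    exact (h.differentiableAt hD (coe_mem_cone hp)).hasFDerivAt
  have h1 : HasDerivAt (fun t : ℝ => t • (p : Amb N)) (p : Amb N) 1 := by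
    simpa using (hasDerivAt_id (1 : ℝ)).smul_const (p : Amb N)
  have h2 := HasFDerivAt.comp_hasDerivAt (f := fun t : ℝ => t • (p : Amb N)) (1 : ℝ) hd h1
  have h3 : HasDerivAt (fun t : ℝ => t • F p) (F p) 1 := by
    simpa using (hasDerivAt_id (1 : ℝ)).smul_const (F p)
  refine h2.unique (h3.congr_of_eventuallyEq ?_)
  filter_upwards [lt_mem_nhds one_pos] with t ht using h.homogeneous _ (coe_mem_cone hp) t ht

/-- The chord bound concerns points of the sphere, while the line p + t w leaves it. Its norm
deviates from 1 by o(t) only, so the correction disappears in the difference quotients. -/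
theorem norm_fderiv_sq_le (h : IsConeDiffeo D D' F F') (hD : IsOpen D) {A : ℝ}
    (hA : ∀ p ∈ D, ∀ q ∈ D, ‖F p - F q‖ ^ 2 ≤ A * ‖(p : Amb N) - q‖ ^ 2) {p : Sph N} (hp : p ∈ D)
    {w : Amb N} (hw : ⟪(p : Amb N), w⟫_ℝ = 0) :
    ‖fderiv ℝ F (p : Amb N) w‖ ^ 2 ≤ A * ‖w‖ ^ 2 := by
  have hpc := coe_mem_cone hp
  have hline : HasDerivAt (fun t : ℝ => (p : Amb N) + t • w) w 0 := by
    simpa using ((hasDerivAt_id (0 : ℝ)).smul_const w).const_add (p : Amb N)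
  have h0 : (p : Amb N) + (0 : ℝ) • w = p := by simp
  have h1 : HasDerivAt (fun t : ℝ => F ((p : Amb N) + t • w)) (fderiv ℝ F (p : Amb N) w) 0 := by
    refine HasFDerivAt.comp_hasDerivAt (f := fun t : ℝ => (p : Amb N) + t • w) (0 : ℝ) ?_ hline
    rw [h0]
    exact (h.differentiableAt hD hpc).hasFDerivAt
  have h2 : HasDerivAt (fun t : ℝ => ‖(p : Amb N) + t • w‖) 0 0 := by
    have h3 : HasFDerivAt (fun y : Amb N => ‖y‖) (‖(p : Amb N)‖⁻¹ • innerSL ℝ (p : Amb N))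
        ((p : Amb N) + (0 : ℝ) • w) := by
      rw [h0]
      exact hasFDerivAt_norm_of_ne_zero (coe_sph_ne_zero p)
    have h4 := HasFDerivAt.comp_hasDerivAt (f := fun t : ℝ => (p : Amb N) + t • w) (0 : ℝ) h3 hline
    refine h4.congr_deriv ?_
    simp [hw]
  have l1 := ((h1.tendsto_slope_zero).norm.pow 2)
  have l2 := (((h2.tendsto_slope_zero).pow 2).const_mul (1 - A)).const_add (A * ‖w‖ ^ 2)
  simp only [zero_add, h0, norm_coe_sph, smul_eq_mul] at l1 l2
  rw [zero_pow two_ne_zero, mul_zero, add_zero] at l2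
  refine le_of_tendsto_of_tendsto l1 l2 ?_
  have hev : ∀ᶠ t in 𝓝[≠] (0 : ℝ), (p : Amb N) + t • w ∈ cone D := by
    refine Tendsto.eventually_mem (Tendsto.mono_left ?_ nhdsWithin_le_nhds)
      ((isOpen_cone hD).mem_nhds hpc)
    have := hline.continuousAt.tendsto
    rwa [h0] at this
  filter_upwards [hev, self_mem_nhdsWithin] with t ht ht0
  set y := (p : Amb N) + t • w with hy
  set b := ‖y‖ with hb
  have hy1 : y = b • (dir y : Amb N) := (norm_smul_dir y).symm
  -- The chord from b times a unit vector to a unit vector splits into a radial part and b times the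
  -- spherical chord; the same identity holds before and after F.
  have e1 : ‖F y - F p‖ ^ 2 = (b - 1) ^ 2 + b * ‖F (dir y) - F p‖ ^ 2 := by
    rw [h.apply_eq ht, norm_sub_sq_real, norm_sub_sq_real, norm_smul, h.norm_coe hp,
      h.norm_coe ht.2, real_inner_smul_left, norm_norm]
    ring
  have e2 : ‖t • w‖ ^ 2 = (b - 1) ^ 2 + b * ‖(dir y : Amb N) - p‖ ^ 2 := by
    have : t • w = b • (dir y : Amb N) - p := by rw [← hy1, hy, add_sub_cancel_left]
    rw [this, norm_sub_sq_real, norm_sub_sq_real, norm_smul, norm_coe_sph, norm_coe_sph,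
      real_inner_smul_left, norm_norm]
    ring
  have e3 : ‖F y - F p‖ ^ 2 ≤ A * ‖t • w‖ ^ 2 + (1 - A) * (b - 1) ^ 2 := by
    have := mul_le_mul_of_nonneg_left (hA _ ht.2 p hp) (norm_nonneg y)
    rw [e1, e2]
    linarith
  have ht' : t ≠ 0 := ht0
  have ht2 : 0 < t ^ 2 := by positivity
  rw [norm_smul, mul_pow, norm_inv, Real.norm_eq_abs, inv_pow, sq_abs, mul_pow, inv_pow]
  rw [norm_smul, mul_pow, Real.norm_eq_abs, sq_abs] at e3
  rw [inv_mul_le_iff₀ ht2]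
  refine e3.trans (le_of_eq ?_)
  field_simp

/-- With w = A*G one has ‖w‖² = ⟨G, A w⟩, so the bound for A on tangent vectors passes to its
adjoint; w is tangent by Euler's relation. -/
theorem norm_adjoint_fderiv_sq_le (h : IsConeDiffeo D D' F F') (hD : IsOpen D) {A : ℝ} (hA0 : 0 ≤ A)
    (hA : ∀ p ∈ D, ∀ q ∈ D, ‖F p - F q‖ ^ 2 ≤ A * ‖(p : Amb N) - q‖ ^ 2) {p : Sph N} (hp : p ∈ D)
    {G : Amb N} (hG : ⟪F p, G⟫_ℝ = 0) :
    ⟪(p : Amb N), ContinuousLinearMap.adjoint (fderiv ℝ F (p : Amb N)) G⟫_ℝ = 0 ∧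
      ‖ContinuousLinearMap.adjoint (fderiv ℝ F (p : Amb N)) G‖ ^ 2 ≤ A * ‖G‖ ^ 2 := by
  set w := ContinuousLinearMap.adjoint (fderiv ℝ F (p : Amb N)) G with hw
  have h1 : ⟪(p : Amb N), w⟫_ℝ = 0 := by
    rw [hw, ContinuousLinearMap.adjoint_inner_right, h.fderiv_self hD hp, hG]
  refine ⟨h1, ?_⟩
  have h2 := h.norm_fderiv_sq_le hD hA hp h1
  have h3 : ‖w‖ ^ 2 ≤ ‖G‖ * ‖fderiv ℝ F (p : Amb N) w‖ := by
    rw [← real_inner_self_eq_norm_sq]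
    nth_rewrite 1 [hw]
    rw [ContinuousLinearMap.adjoint_inner_left]
    exact real_inner_le_norm _ _
  have h4 : (‖w‖ ^ 2) ^ 2 ≤ (A * ‖G‖ ^ 2) * ‖w‖ ^ 2 := by
    calc (‖w‖ ^ 2) ^ 2 ≤ (‖G‖ * ‖fderiv ℝ F (p : Amb N) w‖) ^ 2 := by gcongr
      _ = ‖G‖ ^ 2 * ‖fderiv ℝ F (p : Amb N) w‖ ^ 2 := by ring
      _ ≤ ‖G‖ ^ 2 * (A * ‖w‖ ^ 2) := by gcongr
      _ = _ := by ring
  rcases (sq_nonneg ‖w‖).eq_or_lt with h5 | h5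
  · rw [← h5]
    positivity
  · rw [sq (‖w‖ ^ 2)] at h4
    exact le_of_mul_le_mul_right h4 h5

/-! #### Change of variables on the sphere -/

/-- The part of the cone over `S` between the spheres of radius `1` and `2`. -/
def _root_.SphericalNeumann.sector (S : Set (Sph N)) : Set (Amb N) :=
  (fun x : Amb N => (dir x, ‖x‖)) ⁻¹' (S ×ˢ Ioo (1 : ℝ) 2)

theorem _root_.SphericalNeumann.volume_sector {S : Set (Sph N)} (hS : MeasurableSet S) :
    volume (sector S) = surf N S * radialMeasure N (Ioo 1 2) := by
  rw [sector, measurePreserving_polar.measure_preimage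
    (hS.prod measurableSet_Ioo).nullMeasurableSet, Measure.prod_prod]

theorem _root_.SphericalNeumann.measurableSet_sector {S : Set (Sph N)} (hS : MeasurableSet S) :
    MeasurableSet (sector S) :=
  measurePreserving_polar.measurable (hS.prod measurableSet_Ioo)

theorem _root_.SphericalNeumann.sector_subset_cone {S : Set (Sph N)} : sector S ⊆ cone S := by
  rintro x ⟨hx1, hx2⟩
  refine ⟨?_, hx1⟩
  rintro rfl
  have : (1 : ℝ) < ‖(0 : Amb N)‖ := hx2.1
  rw [norm_zero] at this
  linarith

theorem _root_.SphericalNeumann.radialMeasure_Ioo_ne : radialMeasure N (Ioo 1 2) ≠ 0 ∧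
    radialMeasure N (Ioo 1 2) ≠ ⊤ := by
  have h := volume_sector (N := N) (S := univ) MeasurableSet.univ
  have hlt : volume (sector (univ : Set (Sph N))) < ⊤ := by
    refine lt_of_le_of_lt (measure_mono fun x hx => ?_)
      (measure_ball_lt_top (x := (0 : Amb N)) (r := 2))
    rw [mem_ball_zero_iff]
    exact hx.2.2
  have hopen : IsOpen (sector (univ : Set (Sph N))) := by
    have : sector (univ : Set (Sph N)) = {x : Amb N | ‖x‖ ∈ Ioo (1 : ℝ) 2} := by
      ext x
      simp [sector]
    rw [this]
    exact isOpen_Ioo.preimage continuous_norm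
  have hne : volume (sector (univ : Set (Sph N))) ≠ 0 := by
    refine (hopen.measure_pos volume ⟨(3 / 2 : ℝ) • (poleSph N : Amb N), trivial, ?_⟩).ne'
    simp only [norm_smul_sph (by norm_num : (0 : ℝ) < 3 / 2)]
    norm_num
  have hs : surf N univ ≠ 0 := surf_pos_of_isOpen isOpen_univ ⟨poleSph N, trivial⟩
  constructor
  · intro h0
    rw [h0, mul_zero] at h
    exact hne h
  · intro h0
    rw [h0, ENNReal.mul_top hs] at h
    exact hlt.ne h

theorem image_sector (h : IsConeDiffeo D D' F F') (S : Set (Sph N)) :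
    F '' sector (D ∩ (fun p : Sph N => dir (F p)) ⁻¹' S) = sector (S ∩ D') := by
  refine Subset.antisymm ?_ ?_
  · rintro _ ⟨x, hx, rfl⟩
    have hxc : x ∈ cone D := ⟨(sector_subset_cone hx).1, hx.1.1⟩
    refine ⟨⟨?_, (h.maps x hxc).2⟩, ?_⟩
    · simp only
      rw [h.dir_apply hxc]
      exact hx.1.2
    · simp only [h.norm_eq x hxc]
      exact hx.2
  · intro y hy
    have hyc : y ∈ cone D' := ⟨(sector_subset_cone hy).1, hy.1.2⟩
    have hxc := h.maps_inv y hyc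
    refine ⟨F' y, ⟨⟨hxc.2, ?_⟩, ?_⟩, h.right_inv y hyc⟩
    · simp only [mem_preimage]
      rw [← h.dir_apply hxc, h.right_inv y hyc]
      exact hy.1.1
    · simp only [h.symm.norm_eq y hyc]
      exact hy.2

theorem continuousOn_dir_apply (h : IsConeDiffeo D D' F F') :
    ContinuousOn (fun p : Sph N => dir (F p)) D := by
  intro p hp
  have h1 : ContinuousWithinAt (fun p : Sph N => F p) D p :=
    (h.smooth.continuousOn.comp continuous_subtype_val.continuousOn
      fun q hq => coe_mem_cone hq) p hp
  exact ContinuousAt.comp_continuousWithinAt (f := fun p : Sph N => F p)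
    (continuousAt_dir (h.maps _ (coe_mem_cone hp)).1) h1

/-- Surface measure is sector volume up to a fixed radial factor, and F maps sectors to sectors. Its
Jacobian is constant along rays, so bounds on the sphere suffice. -/
theorem surf_inter_preimage (h : IsConeDiffeo D D' F F') (hD : IsOpen D) (hD' : IsOpen D')
    {j₀ j₁ : ℝ} (hj : ∀ p ∈ D, |(fderiv ℝ F (p : Amb N)).det| ∈ Icc j₀ j₁) {S : Set (Sph N)}
    (hS : MeasurableSet S) :
    ENNReal.ofReal j₀ * surf N (D ∩ (fun p : Sph N => dir (F p)) ⁻¹' S) ≤ surf N (S ∩ D') ∧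
      surf N (S ∩ D') ≤ ENNReal.ofReal j₁ * surf N (D ∩ (fun p : Sph N => dir (F p)) ⁻¹' S) := by
  set T := D ∩ (fun p : Sph N => dir (F p)) ⁻¹' S with hT
  have hTm : MeasurableSet T := by
    have h1 := (continuousOn_iff_continuous_domRestrict.1 h.continuousOn_dir_apply).measurable hS
    have h2 := hD.measurableSet.subtype_image h1
    convert h2 using 1
    ext p
    simp [hT, and_comm]
  have hsub : sector T ⊆ cone D := fun x hx => ⟨(sector_subset_cone hx).1, hx.1.1⟩
  have hvol := lintegral_abs_det_fderiv_eq_addHaar_image volume (measurableSet_sector hTm)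
    (fun x hx => (h.differentiableAt hD (hsub hx)).hasFDerivAt.hasFDerivWithinAt)
    (f := F) (fun x hx y hy hxy => by
      rw [← h.left_inv x (hsub hx), hxy, h.left_inv y (hsub hy)])
  rw [h.image_sector S, volume_sector (hS.inter hD'.measurableSet)] at hvol
  obtain ⟨ha0, hat⟩ := radialMeasure_Ioo_ne (N := N)
  have hb : ∀ x ∈ sector T, |(fderiv ℝ F x).det| ∈ Icc j₀ j₁ := fun x hx => by
    rw [h.fderiv_dir hD (hsub hx)]
    exact hj _ hx.1.1
  have h1 : ENNReal.ofReal j₀ * volume (sector T) ≤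
      ∫⁻ x in sector T, ENNReal.ofReal |(fderiv ℝ F x).det| := by
    rw [← setLIntegral_const]
    exact setLIntegral_mono' (measurableSet_sector hTm) fun x hx =>
      ENNReal.ofReal_le_ofReal (hb x hx).1
  have h2 : ∫⁻ x in sector T, ENNReal.ofReal |(fderiv ℝ F x).det| ≤
      ENNReal.ofReal j₁ * volume (sector T) := by
    rw [← setLIntegral_const]
    exact setLIntegral_mono' (measurableSet_sector hTm) fun x hx =>
      ENNReal.ofReal_le_ofReal (hb x hx).2
  rw [hvol, volume_sector hTm, ← mul_assoc] at h1 h2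
  exact ⟨(ENNReal.mul_le_mul_iff_left ha0 hat).1 h1, (ENNReal.mul_le_mul_iff_left ha0 hat).1 h2⟩

theorem aemeasurable_dir_apply (h : IsConeDiffeo D D' F F') (hD : IsOpen D) :
    AEMeasurable (fun p : Sph N => dir (F p)) ((surf N).restrict D) :=
  h.continuousOn_dir_apply.aemeasurable hD.measurableSet

/-- Two-sided measure inequalities replace an exact change of variables on the sphere. -/
theorem map_restrict_le (h : IsConeDiffeo D D' F F') (hD : IsOpen D) (hD' : IsOpen D')
    {j₀ j₁ : ℝ} (hj0 : 0 < j₀) (hj : ∀ p ∈ D, |(fderiv ℝ F (p : Amb N)).det| ∈ Icc j₀ j₁) :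
    ((surf N).restrict D).map (fun p : Sph N => dir (F p)) ≤
      ENNReal.ofReal j₀⁻¹ • (surf N).restrict D' := by
  refine Measure.le_iff.2 fun S hS => ?_
  have h1 := (h.surf_inter_preimage hD hD' hj hS).1
  rw [Measure.map_apply_of_aemeasurable (h.aemeasurable_dir_apply hD) hS, Measure.smul_apply,
    Measure.restrict_apply hS, Measure.restrict_apply₀' hD.measurableSet.nullMeasurableSet,
    inter_comm, smul_eq_mul, ENNReal.ofReal_inv_of_pos hj0, ← ENNReal.div_eq_inv_mul,
    ENNReal.le_div_iff_mul_le (Or.inl (by simpa using hj0)) (Or.inl ENNReal.ofReal_ne_top), mul_comm]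
  exact h1

theorem restrict_le_map (h : IsConeDiffeo D D' F F') (hD : IsOpen D) (hD' : IsOpen D')
    {j₀ j₁ : ℝ} (hj : ∀ p ∈ D, |(fderiv ℝ F (p : Amb N)).det| ∈ Icc j₀ j₁) :
    (surf N).restrict D' ≤
      ENNReal.ofReal j₁ • ((surf N).restrict D).map (fun p : Sph N => dir (F p)) := by
  refine Measure.le_iff.2 fun S hS => ?_
  have h1 := (h.surf_inter_preimage hD hD' hj hS).2
  rw [Measure.smul_apply, Measure.map_apply_of_aemeasurable (h.aemeasurable_dir_apply hD) hS,
    Measure.restrict_apply hS, Measure.restrict_apply₀' hD.measurableSet.nullMeasurableSet,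
    inter_comm _ D, smul_eq_mul]
  exact h1

/-- The chain rule is applied to homogeneous extensions on the cones and then brought back to the
sphere. -/
theorem hasSobolevGradient_comp (hN : 2 ≤ N) (h : IsConeDiffeo D D' F F') (hD : IsOpen D)
    (hD' : IsOpen D') {A j₀ j₁ : ℝ} (hA0 : 0 ≤ A)
    (hA : ∀ p ∈ D, ∀ q ∈ D, ‖F p - F q‖ ^ 2 ≤ A * ‖(p : Amb N) - q‖ ^ 2) (hj0 : 0 < j₀)
    (hj : ∀ p ∈ D, |(fderiv ℝ F (p : Amb N)).det| ∈ Icc j₀ j₁) {u : Sph N → ℝ}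
    {G : Sph N → Amb N} (hu : HasSobolevGradient D' u G) :
    HasSobolevGradient D (fun p => u (dir (F p)))
        (fun p => ContinuousLinearMap.adjoint (fderiv ℝ F (p : Amb N)) (G (dir (F p)))) ∧
      MemLp (fun p : Sph N => G (dir (F p))) 2 ((surf N).restrict D) ∧
      ∀ᵐ p : Sph N ∂(surf N).restrict D,
        ‖ContinuousLinearMap.adjoint (fderiv ℝ F (p : Amb N)) (G (dir (F p)))‖ ^ 2 ≤
          A * ‖G (dir (F p))‖ ^ 2 := by
  have hmap := h.map_restrict_le hD hD' hj0 hj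
  have hae := h.aemeasurable_dir_apply hD
  have hut : MemLp (fun p : Sph N => u (dir (F p))) 2 ((surf N).restrict D) :=
    (hu.memLp.of_measure_le_smul ENNReal.ofReal_ne_top hmap).comp_of_map hae
  have hGt : MemLp (fun p : Sph N => G (dir (F p))) 2 ((surf N).restrict D) :=
    (hu.memLp_grad.of_measure_le_smul ENNReal.ofReal_ne_top hmap).comp_of_map hae
  have htan : ∀ᵐ p : Sph N ∂(surf N).restrict D, ⟪(dir (F p) : Amb N), G (dir (F p))⟫_ℝ = 0 :=
    ae_of_ae_map hae ((Measure.absolutelyContinuous_of_le_smul hmap).ae_le hu.tangent)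
  have hkey : ∀ᵐ p : Sph N ∂(surf N).restrict D,
      ⟪(p : Amb N), ContinuousLinearMap.adjoint (fderiv ℝ F (p : Amb N)) (G (dir (F p)))⟫_ℝ = 0 ∧
      ‖ContinuousLinearMap.adjoint (fderiv ℝ F (p : Amb N)) (G (dir (F p)))‖ ^ 2 ≤
        A * ‖G (dir (F p))‖ ^ 2 := by
    filter_upwards [htan, ae_restrict_mem hD.measurableSet] with p hp hpD
    rw [h.coe_dir_apply hpD] at hp
    exact h.norm_adjoint_fderiv_sq_le hD hA0 hA hpD hp
  refine ⟨hasSobolevGradient_of_hasWeakGradient hD.measurableSet hut ?_ (hkey.mono fun p hp => hp.1) ?_,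
    hGt, hkey.mono fun p hp => hp.2⟩
  · refine hGt.of_le_mul (c := √A) ?_ ?_
    · have hc : ContinuousOn (fun p : Sph N =>
          ContinuousLinearMap.adjoint (fderiv ℝ F (p : Amb N))) D := by
        refine ContinuousLinearMap.adjoint.continuous.comp_continuousOn ?_
        exact (h.smooth.continuousOn_fderiv_of_isOpen (isOpen_cone hD) (by simp)).comp
          continuous_subtype_val.continuousOn fun q hq => coe_mem_cone hq
      have hc' := hc.aestronglyMeasurable (μ := surf N) hD.measurableSet
      exact isBoundedBilinearMap_apply.continuous.comp_aestronglyMeasurable (hc'.prodMk hGt.1)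
    · filter_upwards [hkey] with p hp
      have := Real.sqrt_le_sqrt hp.2
      rwa [Real.sqrt_sq (norm_nonneg _), Real.sqrt_mul hA0, Real.sqrt_sq (norm_nonneg _)] at this
  · have hul : LocallyIntegrableOn (fun x => u (dir x)) (cone D') := by
      simpa using locallyIntegrableOn_cone hD'.measurableSet
        (show IntegrableOn u D' (surf N) from hu.memLp.integrable (by norm_num)) (k := fun _ => 1)
        continuousOn_const
    have hGl : LocallyIntegrableOn (fun x => ‖x‖⁻¹ • G (dir x)) (cone D') :=
      locallyIntegrableOn_cone hD'.measurableSet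
        (show IntegrableOn G D' (surf N) from hu.memLp_grad.integrable (by norm_num))
        (k := fun t => t⁻¹) (continuousOn_inv₀.mono fun t ht => ne_of_gt ht)
    refine ((hu.hasWeakGradient hN hD'.measurableSet).comp_diffeo (isOpen_cone hD)
      (isOpen_cone hD') h.smooth h.smooth_inv h.maps h.maps_inv h.left_inv h.right_inv hul
      hGl).congr ?_ ?_
    · intro x hx
      rw [h.dir_apply hx]
    · intro x hx
      rw [h.dir_apply hx, h.norm_eq x hx, h.fderiv_dir hD hx, map_smul]

/-- Pulling u back costs the factor A in the gradient, while the comparison of measures costs j₁ in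
the L² norm and j₀ in the energy. -/
theorem poincareBound (hN : 2 ≤ N) (h : IsConeDiffeo D D' F F') (hD : IsOpen D)
    (hD' : IsOpen D') {A j₀ j₁ l : ℝ} (hA0 : 0 < A)
    (hA : ∀ p ∈ D, ∀ q ∈ D, ‖F p - F q‖ ^ 2 ≤ A * ‖(p : Amb N) - q‖ ^ 2) (hj0 : 0 < j₀)
    (hj1 : 0 < j₁) (hj : ∀ p ∈ D, |(fderiv ℝ F (p : Amb N)).det| ∈ Icc j₀ j₁) (hl : 0 ≤ l)
    (hP : PoincareBound D l) : PoincareBound D' (l * j₀ / (A * j₁)) := by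
  intro u G hu
  obtain ⟨h1, h2, h3⟩ := h.hasSobolevGradient_comp hN hD hD' hA0.le hA hj0 hj hu
  obtain ⟨c, hc⟩ := hP _ _ h1
  have hmap := h.map_restrict_le hD hD' hj0 hj
  have hae := h.aemeasurable_dir_apply hD
  have i1 : Integrable (fun q => (u q - c) ^ 2) ((surf N).restrict D') :=
    (hu.memLp.sub (memLp_const c)).integrable_sq
  have i2 : Integrable (fun q => ‖G q‖ ^ 2) ((surf N).restrict D') :=
    (memLp_two_iff_integrable_sq_norm hu.memLp_grad.1).1 hu.memLp_grad
  have i1' := i1.of_measure_le_smul ENNReal.ofReal_ne_top hmap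
  have i2' := i2.of_measure_le_smul ENNReal.ofReal_ne_top hmap
  have e1 : ∫ q in D', (u q - c) ^ 2 ∂surf N ≤
      j₁ * ∫ p in D, (u (dir (F p)) - c) ^ 2 ∂surf N := by
    have := integral_mono_measure (h.restrict_le_map hD hD' hj)
      (ae_of_all _ fun q => sq_nonneg (u q - c)) (i1'.smul_measure ENNReal.ofReal_ne_top)
    rwa [integral_smul_measure, integral_map hae i1'.1, ENNReal.toReal_ofReal hj1.le,
      smul_eq_mul] at this
  have e2 : j₀ * ∫ p in D, ‖G (dir (F p))‖ ^ 2 ∂surf N ≤ ∫ q in D', ‖G q‖ ^ 2 ∂surf N := by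
    have := integral_mono_measure hmap
      (ae_of_all _ fun q => sq_nonneg ‖G q‖) (i2.smul_measure ENNReal.ofReal_ne_top)
    rw [integral_smul_measure, integral_map hae i2'.1, ENNReal.toReal_ofReal (by positivity),
      smul_eq_mul] at this
    rwa [← le_inv_mul_iff₀ hj0]
  have e3 : ∫ p in D, ‖ContinuousLinearMap.adjoint (fderiv ℝ F (p : Amb N)) (G (dir (F p)))‖ ^ 2
      ∂surf N ≤ A * ∫ p in D, ‖G (dir (F p))‖ ^ 2 ∂surf N := by
    rw [← integral_const_mul]
    exact integral_mono_ae ((memLp_two_iff_integrable_sq_norm h1.memLp_grad.1).1 h1.memLp_grad)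
      (((memLp_two_iff_integrable_sq_norm h2.1).1 h2).const_mul A) h3
  refine ⟨c, ?_⟩
  set I := ∫ q in D', (u q - c) ^ 2 ∂surf N
  set I' := ∫ p in D, (u (dir (F p)) - c) ^ 2 ∂surf N
  set K := ∫ q in D', ‖G q‖ ^ 2 ∂surf N
  set K' := ∫ p in D, ‖G (dir (F p))‖ ^ 2 ∂surf N
  have e4 : l * I' ≤ A * K' := hc.trans e3
  rw [div_mul_eq_mul_div, div_le_iff₀ (by positivity)]
  calc l * j₀ * I ≤ l * j₀ * (j₁ * I') := by gcongr
    _ = j₀ * j₁ * (l * I') := by ring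
    _ ≤ j₀ * j₁ * (A * K') := by gcongr
    _ = A * j₁ * (j₀ * K') := by ring
    _ ≤ A * j₁ * K := by gcongr
    _ = K * (A * j₁) := by ring

end IsConeDiffeo

end Comparison

end SphericalNeumann

namespace SphericalNeumann

/-! ### The first eigenvalue of the dilated domains -/

section Final

variable {N : ℕ} [NeZero N] {D D' : Set (Sph N)} {F F' : Amb N → Amb N} {γ : ℝ}

/-- The absolute determinant is the volume ratio of the image of the unit ball, which lies in the
ball of radius b. -/
theorem abs_det_le_pow {L : Amb N →L[ℝ] Amb N} {b : ℝ} (hb : 0 ≤ b)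
    (hL : ∀ v, ‖L v‖ ≤ b * ‖v‖) : |L.det| ≤ b ^ N := by
  have h1 := Measure.addHaar_image_continuousLinearMap (volume : Measure (Amb N)) L
    (Metric.closedBall 0 1)
  have h2 : L '' Metric.closedBall 0 1 ⊆ Metric.closedBall 0 b := by
    rintro _ ⟨v, hv, rfl⟩
    rw [mem_closedBall_zero_iff] at hv ⊢
    exact (hL v).trans (mul_le_of_le_one_right hb hv)
  have h3 := measure_mono (μ := (volume : Measure (Amb N))) h2
  have hpos : (volume : Measure (Amb N)) (Metric.closedBall 0 1) ≠ 0 :=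
    (Metric.measure_closedBall_pos volume 0 one_pos).ne'
  have hfin : (volume : Measure (Amb N)) (Metric.closedBall 0 1) ≠ ⊤ :=
    measure_closedBall_lt_top.ne
  rw [h1, Measure.addHaar_closedBall' volume 0 hb, finrank_euclideanSpace_fin,
    ENNReal.mul_le_mul_iff_left hpos hfin, ENNReal.ofReal_le_ofReal_iff (by positivity)] at h3
  exact h3

namespace IsConeDiffeo

theorem inner_fderiv (h : IsConeDiffeo D D' F F') (hD : IsOpen D) {x : Amb N} (hx : x ∈ cone D)
    (v : Amb N) : ⟪F x, fderiv ℝ F x v⟫_ℝ = ⟪x, v⟫_ℝ := by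
  have h1 := (h.differentiableAt hD hx).hasFDerivAt.norm_sq
  have h2 : HasFDerivAt (fun y : Amb N => ‖y‖ ^ 2) (2 • innerSL ℝ x) x :=
    (hasStrictFDerivAt_norm_sq x).hasFDerivAt
  have h3 : (fun y : Amb N => ‖y‖ ^ 2) =ᶠ[𝓝 x] fun y => ‖F y‖ ^ 2 := by
    filter_upwards [(isOpen_cone hD).mem_nhds hx] with y hy
    rw [h.norm_eq y hy]
  have h4 := congrArg (fun L => L v) ((h1.congr_of_eventuallyEq h3).unique h2)
  simpa using h4

/-- Radial and tangential parts have orthogonal images and the radial part keeps its length; this is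
where b ≥ 1 is needed. -/
theorem norm_fderiv_le (h : IsConeDiffeo D D' F F') (hD : IsOpen D) {b : ℝ} (hb : 1 ≤ b)
    (hA : ∀ p ∈ D, ∀ q ∈ D, ‖F p - F q‖ ^ 2 ≤ b ^ 2 * ‖(p : Amb N) - q‖ ^ 2) {p : Sph N}
    (hp : p ∈ D) (v : Amb N) : ‖fderiv ℝ F (p : Amb N) v‖ ≤ b * ‖v‖ := by
  set w := v - ⟪(p : Amb N), v⟫_ℝ • (p : Amb N) with hw
  have hpw : ⟪(p : Amb N), w⟫_ℝ = 0 := by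
    rw [hw, inner_sub_right, real_inner_smul_right, inner_self_sph, mul_one, sub_self]
  have h1 := h.norm_fderiv_sq_le hD hA hp hpw
  have h2 := h.inner_fderiv hD (coe_mem_cone hp) w
  rw [hpw] at h2
  have hv : v = ⟪(p : Amb N), v⟫_ℝ • (p : Amb N) + w := by rw [hw, add_sub_cancel]
  have h3 : ‖fderiv ℝ F (p : Amb N) v‖ ^ 2 =
      ⟪(p : Amb N), v⟫_ℝ ^ 2 + ‖fderiv ℝ F (p : Amb N) w‖ ^ 2 := by
    conv_lhs => rw [hv]
    rw [map_add, map_smul, h.fderiv_self hD hp, norm_add_sq_real, real_inner_smul_left, h2,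
      norm_smul, h.norm_coe hp, mul_one, Real.norm_eq_abs, sq_abs]
    ring
  have h4 : ‖v‖ ^ 2 = ⟪(p : Amb N), v⟫_ℝ ^ 2 + ‖w‖ ^ 2 := by
    conv_lhs => rw [hv]
    rw [norm_add_sq_real, real_inner_smul_left, hpw, norm_smul, norm_coe_sph, mul_one,
      Real.norm_eq_abs, sq_abs]
    ring
  refine le_of_abs_le (abs_le_of_sq_le_sq ?_ (by positivity))
  rw [h3, mul_pow, h4]
  nlinarith [mul_nonneg (sub_nonneg.2 (one_le_pow₀ hb (n := 2))) (sq_nonneg ⟪(p : Amb N), v⟫_ℝ)]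

theorem abs_det_fderiv_le (h : IsConeDiffeo D D' F F') (hD : IsOpen D) {b : ℝ} (hb : 1 ≤ b)
    (hA : ∀ p ∈ D, ∀ q ∈ D, ‖F p - F q‖ ^ 2 ≤ b ^ 2 * ‖(p : Amb N) - q‖ ^ 2) {p : Sph N}
    (hp : p ∈ D) : |(fderiv ℝ F (p : Amb N)).det| ≤ b ^ N :=
  abs_det_le_pow (zero_le_one.trans hb) (h.norm_fderiv_le hD hb hA hp)

theorem abs_det_mul_abs_det (h : IsConeDiffeo D D' F F') (hD : IsOpen D) (hD' : IsOpen D')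
    {p : Sph N} (hp : p ∈ D) :
    |(fderiv ℝ F (p : Amb N)).det| * |(fderiv ℝ F' (dir (F p) : Amb N)).det| = 1 := by
  have h1 := fderiv_comp_fderiv_of_inverse (isOpen_cone hD) (isOpen_cone hD') h.smooth h.smooth_inv
    h.maps_inv h.right_inv (h.maps _ (coe_mem_cone hp))
  rw [h.left_inv _ (coe_mem_cone hp)] at h1
  rw [← abs_mul, h.coe_dir_apply hp, det_mul_det_of_comp_eq_id h1, abs_one]

theorem lambdaOne_le (hN : 2 ≤ N) (h : IsConeDiffeo D D' F F') (hD : IsSmoothDomain D)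
    (hD' : IsSmoothDomain D') {A j₀ j₁ : ℝ} (hA0 : 0 < A)
    (hA : ∀ p ∈ D, ∀ q ∈ D, ‖F p - F q‖ ^ 2 ≤ A * ‖(p : Amb N) - q‖ ^ 2) (hj0 : 0 < j₀)
    (hj1 : 0 < j₁) (hj : ∀ p ∈ D, |(fderiv ℝ F (p : Amb N)).det| ∈ Icc j₀ j₁) :
    lambdaOne D * j₀ / (A * j₁) ≤ lambdaOne D' := by
  obtain ⟨hl, -, hP, -⟩ := hD.spectral_gap hN
  exact (hD'.spectral_gap hN).2.2.2 _
    (h.poincareBound hN hD.isOpen hD'.isOpen hA0 hA hj0 hj1 hj hl.le hP)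

end IsConeDiffeo

/-! ### Distortion and eigenvalue bounds for dilations of domains in the hemisphere. -/

theorem polarRadius_lt_pi_div_two_of_subset (hDH : D ⊆ upperHemisphere N) {p : Sph N} (hp : p ∈ D) :
    polarRadius p < π / 2 :=
  polarRadius_lt_pi_div_two_iff.2 (hDH hp)

theorem isConeDiffeo_of_subset_upperHemisphere (hDH : D ⊆ upperHemisphere N)
    (hγ : γ ∈ Ioo (0 : ℝ) 2) :
    IsConeDiffeo D (dilatedDomain γ D) (coneDilation γ) (coneDilation γ⁻¹) := by
  have hπ := pi_pos
  have hr := fun p (hp : p ∈ D) => polarRadius_lt_pi_div_two_of_subset hDH hp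
  exact isConeDiffeo_coneDilation (fun p hp => by linarith [hr p hp]) hγ.1
    fun p hp => by nlinarith [hr p hp, polarRadius_nonneg p, hγ.1, hγ.2]

theorem norm_coneDilation_sub_sq_le (hDH : D ⊆ upperHemisphere N) (hγ : γ ∈ Ioc (0 : ℝ) 1) :
    ∀ p ∈ D, ∀ q ∈ D, ‖coneDilation γ (p : Amb N) - coneDilation γ (q : Amb N)‖ ^ 2 ≤
      1 ^ 2 * ‖(p : Amb N) - q‖ ^ 2 := by
  intro p hp q hq
  rw [coneDilation_coe, coneDilation_coe, one_pow, one_mul]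
  exact norm_dilation_sub_sq_le hγ.2 hγ.1.le (polarRadius_lt_pi_div_two_of_subset hDH hp).le
    (polarRadius_lt_pi_div_two_of_subset hDH hq).le

theorem norm_coneDilation_inv_sub_sq_le (hDH : D ⊆ upperHemisphere N) (hγ : γ ∈ Ioc (0 : ℝ) 1) :
    ∀ p ∈ dilatedDomain γ D, ∀ q ∈ dilatedDomain γ D,
      ‖coneDilation γ⁻¹ (p : Amb N) - coneDilation γ⁻¹ (q : Amb N)‖ ^ 2 ≤
        γ⁻¹ ^ 2 * ‖(p : Amb N) - q‖ ^ 2 := by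
  rintro p' ⟨p, hp, hpp⟩ q' ⟨q, hq, hqq⟩
  have hπ := pi_pos
  have h := isConeDiffeo_of_subset_upperHemisphere hDH ⟨hγ.1, by linarith [hγ.2]⟩
  have h1 := h.left_inv _ (coe_mem_cone hp)
  have h2 := h.left_inv _ (coe_mem_cone hq)
  rw [coneDilation_coe] at h1 h2
  rw [hpp, hqq, h1, h2]
  have h3 := le_norm_dilation_sub_sq hγ.2 hγ.1.le
    ((polarRadius_lt_pi_div_two_of_subset hDH hp).trans (by linarith))
    ((polarRadius_lt_pi_div_two_of_subset hDH hq).trans (by linarith))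
  have h4 := hγ.1
  rw [inv_pow, ← div_eq_inv_mul, le_div_iff₀ (by positivity)]
  linarith

/-- The upper bound uses that distances do not increase; the lower one is the determinant bound for
the γ⁻¹-Lipschitz inverse. -/
theorem abs_det_coneDilation_mem (hD : IsSmoothDomain D) (hDH : D ⊆ upperHemisphere N)
    (hγ : γ ∈ Ioc (0 : ℝ) 1) {p : Sph N} (hp : p ∈ D) :
    |(fderiv ℝ (coneDilation γ) (p : Amb N)).det| ∈ Icc (γ ^ N) 1 := by
  have hγ2 : γ ∈ Ioo (0 : ℝ) 2 := ⟨hγ.1, by linarith [hγ.2]⟩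
  have h := isConeDiffeo_of_subset_upperHemisphere hDH hγ2
  have hD' := hD.dilatedDomain hDH hγ2
  have h1 := h.abs_det_fderiv_le hD.isOpen le_rfl (norm_coneDilation_sub_sq_le hDH hγ) hp
  have h2 := h.symm.abs_det_fderiv_le hD'.isOpen ((one_le_inv₀ hγ.1).2 hγ.2)
    (norm_coneDilation_inv_sub_sq_le hDH hγ) (h.dir_mem hp)
  have h3 := h.abs_det_mul_abs_det hD.isOpen hD'.isOpen hp
  rw [one_pow] at h1
  have h4 : 0 < γ ^ N := pow_pos hγ.1 N
  rw [inv_pow] at h2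
  refine ⟨?_, h1⟩
  have h5 := mul_le_mul_of_nonneg_left h2
    (abs_nonneg (fderiv ℝ (coneDilation γ) (p : Amb N)).det)
  rw [h3, ← div_eq_mul_inv, le_div_iff₀ h4, one_mul] at h5
  exact h5

theorem abs_det_coneDilation_inv_mem (hD : IsSmoothDomain D) (hDH : D ⊆ upperHemisphere N)
    (hγ : γ ∈ Ioc (0 : ℝ) 1) {p : Sph N} (hp : p ∈ dilatedDomain γ D) :
    |(fderiv ℝ (coneDilation γ⁻¹) (p : Amb N)).det| ∈ Icc 1 (γ⁻¹ ^ N) := by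
  have hγ2 : γ ∈ Ioo (0 : ℝ) 2 := ⟨hγ.1, by linarith [hγ.2]⟩
  have h := isConeDiffeo_of_subset_upperHemisphere hDH hγ2
  have hD' := hD.dilatedDomain hDH hγ2
  have h2 := h.symm.abs_det_fderiv_le hD'.isOpen ((one_le_inv₀ hγ.1).2 hγ.2)
    (norm_coneDilation_inv_sub_sq_le hDH hγ) hp
  have h3 := h.symm.abs_det_mul_abs_det hD'.isOpen hD.isOpen hp
  have h4 := (abs_det_coneDilation_mem hD hDH hγ (h.symm.dir_mem hp)).2
  refine ⟨?_, h2⟩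
  exact h3.symm.le.trans (mul_le_of_le_one_right (abs_nonneg _) h4)

/-- Here A = 1, j₀ = γ^N and j₁ = 1. The bound is crude, but its factor tends to 1 as γ → 1, which
is what continuity requires. -/
theorem lambdaOne_mul_pow_le_lambdaOne_dilatedDomain (hN : 2 ≤ N) (hD : IsSmoothDomain D)
    (hDH : D ⊆ upperHemisphere N) (hγ : γ ∈ Ioc (0 : ℝ) 1) :
    lambdaOne D * γ ^ N ≤ lambdaOne (dilatedDomain γ D) := by
  have hγ2 : γ ∈ Ioo (0 : ℝ) 2 := ⟨hγ.1, by linarith [hγ.2]⟩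
  have h := (isConeDiffeo_of_subset_upperHemisphere hDH hγ2).lambdaOne_le hN hD
    (hD.dilatedDomain hDH hγ2) one_pos
    (by simpa using norm_coneDilation_sub_sq_le hDH hγ) (pow_pos hγ.1 N) one_pos
    fun p hp => abs_det_coneDilation_mem hD hDH hγ hp
  simpa using h

/-- The inverse map with A = γ⁻², j₀ = 1 and j₁ = γ^{-N}, whence the exponent N + 2. -/
theorem lambdaOne_dilatedDomain_mul_pow_le_lambdaOne (hN : 2 ≤ N) (hD : IsSmoothDomain D)
    (hDH : D ⊆ upperHemisphere N) (hγ : γ ∈ Ioc (0 : ℝ) 1) :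
    lambdaOne (dilatedDomain γ D) * γ ^ (N + 2) ≤ lambdaOne D := by
  have hγ2 : γ ∈ Ioo (0 : ℝ) 2 := ⟨hγ.1, by linarith [hγ.2]⟩
  have hγ0 := hγ.1
  have h := (isConeDiffeo_of_subset_upperHemisphere hDH hγ2).symm.lambdaOne_le hN
    (hD.dilatedDomain hDH hγ2) hD (by positivity) (norm_coneDilation_inv_sub_sq_le hDH hγ)
    one_pos (by positivity) fun p hp => abs_det_coneDilation_inv_mem hD hDH hγ hp
  rwa [mul_one, ← pow_add, inv_pow, div_inv_eq_mul, add_comm 2] at h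

/-! ### Small domains near the pole -/

/-- Only the ratio j₀ / j₁ enters the comparison, and by continuity the Jacobian is nearly constant
close to the pole. With A = 1/2 and Jacobian between 6J/7 and 8J/7 the factor is exactly 3/2. The
radius ρ does not depend on D, which permits iteration. -/
theorem exists_lambdaOne_dilatedDomain_half_ge (hN : 2 ≤ N) :
    ∃ ρ > 0, ∀ D : Set (Sph N), IsSmoothDomain D → D ⊆ upperHemisphere N →
      (∀ p ∈ D, polarRadius p < ρ) →
        3 / 2 * lambdaOne D ≤ lambdaOne (dilatedDomain (1 / 2) D) := by
  have hhalf : (1 / 2 : ℝ) ∈ Ioo (0 : ℝ) 2 := by norm_num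
  set e : Sph N := poleSph N with he
  have heH : e ∈ upperHemisphere N := by
    show 0 < ⟪northPole N, northPole N⟫_ℝ
    rw [inner_northPole_self]
    exact one_pos
  have h := isConeDiffeo_of_subset_upperHemisphere (N := N) Subset.rfl hhalf
  have hHo : IsOpen (upperHemisphere N) :=
    isOpen_lt continuous_const (continuous_const.inner continuous_subtype_val)
  have hcone := isOpen_cone hHo
  have hcont : ContinuousAt (fun x => |(fderiv ℝ (coneDilation (N := N) (1 / 2)) x).det|)
      (e : Amb N) := by
    have h1 : ContinuousAt (fderiv ℝ (coneDilation (N := N) (1 / 2))) (e : Amb N) :=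
      (h.smooth.continuousOn_fderiv_of_isOpen hcone (by simp)).continuousAt
        (hcone.mem_nhds (coe_mem_cone heH))
    exact (contDiff_det.continuous.continuousAt.comp h1).abs
  set J := |(fderiv ℝ (coneDilation (N := N) (1 / 2)) (e : Amb N)).det| with hJ
  have hJ0 : 0 < J := by
    have hes : (e : Amb N) ∈ slitSpace N := by
      rw [mem_slitSpace_iff (coe_mem_cone heH).1, dir_coe]
      linarith [polarRadius_lt_pi_div_two_iff.2 heH, pi_pos]
    have hes' : coneDilation (1 / 2) (e : Amb N) ∈ slitSpace N := by
      rw [mem_slitSpace_iff (h.maps _ (coe_mem_cone heH)).1, dir_coneDilation _ hes, dir_coe]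
      have h1 := polarRadius_lt_pi_div_two_iff.2 heH
      have h2 := polarRadius_nonneg e
      rw [polarRadius_dilSph] <;> linarith [pi_pos]
    have h1 := ((contDiffAt_coneDilation (1 / 2)⁻¹ hes').differentiableAt (by simp)).hasFDerivAt.comp
      (e : Amb N) (h.differentiableAt hHo (coe_mem_cone heH)).hasFDerivAt
    have h2 : coneDilation (1 / 2)⁻¹ ∘ coneDilation (1 / 2) =ᶠ[𝓝 (e : Amb N)] id := by
      filter_upwards [hcone.mem_nhds (coe_mem_cone heH)] with x hx using h.left_inv x hx
    have h3 := det_mul_det_of_comp_eq_id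
      (h1.unique ((hasFDerivAt_id (e : Amb N)).congr_of_eventuallyEq h2))
    exact abs_pos.2 (right_ne_zero_of_mul_eq_one h3)
  have hev : ∀ᶠ x in 𝓝 (e : Amb N), |(fderiv ℝ (coneDilation (N := N) (1 / 2)) x).det| ∈
      Icc (6 / 7 * J) (8 / 7 * J) :=
    hcont (Icc_mem_nhds (by linarith) (by linarith))
  obtain ⟨ρ, hρ, hball⟩ := Metric.eventually_nhds_iff.1 hev
  refine ⟨ρ, hρ, fun D hD hDH hDρ => ?_⟩
  have hle := (isConeDiffeo_of_subset_upperHemisphere hDH hhalf).lambdaOne_le hN hD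
    (hD.dilatedDomain hDH hhalf) (A := 1 / 2) (by norm_num) (fun p hp q hq => by
      rw [coneDilation_coe, coneDilation_coe]
      exact norm_dilation_half_sub_sq_le (polarRadius_lt_pi_div_two_of_subset hDH hp).le
        (polarRadius_lt_pi_div_two_of_subset hDH hq).le)
    (j₀ := 6 / 7 * J) (j₁ := 8 / 7 * J) (by positivity) (by positivity) fun p hp => hball (by
      refine lt_of_le_of_lt ?_ (hDρ p hp)
      rw [dist_eq_norm]
      refine le_of_abs_le (abs_le_of_sq_le_sq ?_ (polarRadius_nonneg p))
      have h1 := Real.one_sub_sq_div_two_le_cos (x := polarRadius p)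
      rw [cos_polarRadius] at h1
      rw [norm_sub_sq_real, norm_coe_sph, norm_coe_sph, real_inner_comm]
      change ⟪northPole N, (p : Amb N)⟫_ℝ ≥ _ at h1
      change 1 ^ 2 - 2 * ⟪northPole N, (p : Amb N)⟫_ℝ + 1 ^ 2 ≤ _
      linarith)
  have h2 : lambdaOne D * (6 / 7 * J) / (1 / 2 * (8 / 7 * J)) = 3 / 2 * lambdaOne D := by
    field_simp
    ring
  rwa [h2] at hle

/-! ### Continuity of the first eigenvalue along the dilations -/

theorem continuousOn_of_mul_pow_le {f : ℝ → ℝ} {m n : ℕ} (hmn : m ≤ n)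
    (hf : ∀ t ∈ Ioc (0 : ℝ) 1, 0 < f t)
    (h1 : ∀ t ∈ Ioc (0 : ℝ) 1, ∀ s ∈ Ioc 0 t, f t * (s / t) ^ m ≤ f s)
    (h2 : ∀ t ∈ Ioc (0 : ℝ) 1, ∀ s ∈ Ioc 0 t, f s * (s / t) ^ n ≤ f t) :
    ContinuousOn f (Ioc 0 1) := by
  intro t ht
  set q : ℝ → ℝ := fun s => min s t / max s t
  have ht0 := ht.1
  have hq : Tendsto q (𝓝[Ioc 0 1] t) (𝓝 1) := by
    have h : ContinuousAt q t := by
      refine ContinuousAt.div ?_ ?_ (by simpa using ht0.ne')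
      · exact (continuous_id.min continuous_const).continuousAt
      · exact (continuous_id.max continuous_const).continuousAt
    have hqt : q t = 1 := by simp [q, ht0.ne']
    have := h.tendsto.mono_left (nhdsWithin_le_nhds (s := Ioc 0 1))
    rwa [hqt] at this
  have hb : ∀ s ∈ Ioc (0 : ℝ) 1, 0 < q s ∧ f t * q s ^ n ≤ f s ∧ f s * q s ^ n ≤ f t := by
    intro s hs
    have hs0 := hs.1
    have key : ∀ a ∈ Ioc (0 : ℝ) 1, ∀ b ∈ Ioc 0 a,
        0 < b / a ∧ f a * (b / a) ^ n ≤ f b ∧ f b * (b / a) ^ n ≤ f a := by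
      intro a ha b hb
      refine ⟨div_pos hb.1 ha.1, le_trans ?_ (h1 a ha b hb), h2 a ha b hb⟩
      exact mul_le_mul_of_nonneg_left (pow_le_pow_of_le_one (div_pos hb.1 ha.1).le
        ((div_le_one ha.1).2 hb.2) hmn) (hf a ha).le
    rcases le_total s t with hst | hst
    · have := key t ht s ⟨hs0, hst⟩
      simpa only [q, min_eq_left hst, max_eq_right hst] using this
    · obtain ⟨k1, k2, k3⟩ := key s hs t ⟨ht0, hst⟩
      simp only [q, min_eq_right hst, max_eq_left hst]
      exact ⟨k1, k3, k2⟩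
  have hlo : Tendsto (fun s => f t * q s ^ n) (𝓝[Ioc 0 1] t) (𝓝 (f t)) := by
    simpa using (hq.pow n).const_mul (f t)
  have hhi : Tendsto (fun s => f t / q s ^ n) (𝓝[Ioc 0 1] t) (𝓝 (f t)) := by
    have h := (tendsto_const_nhds (x := f t)).div (hq.pow n) (by simp)
    rwa [one_pow, div_one] at h
  refine tendsto_of_tendsto_of_tendsto_of_le_of_le' hlo hhi ?_ ?_ <;>
    filter_upwards [self_mem_nhdsWithin] with s hs
  · exact (hb s hs).2.1
  · rw [le_div_iff₀ (pow_pos (hb s hs).1 n)]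
    exact (hb s hs).2.2

theorem polarRadius_le_of_mem_dilatedDomain (hDH : D ⊆ upperHemisphere N) (hγ : γ ∈ Ioo (0 : ℝ) 2)
    {p : Sph N} (hp : p ∈ dilatedDomain γ D) : polarRadius p ≤ γ * (π / 2) := by
  have hπ := pi_pos
  have hr := fun p (hp : p ∈ D) => polarRadius_lt_pi_div_two_of_subset hDH hp
  rw [dilatedDomain_eq_image fun p hp => (hr p hp).trans (by linarith)] at hp
  obtain ⟨p, hp, rfl⟩ := hp
  have h1 := mul_le_mul_of_nonneg_left (hr p hp).le hγ.1.le
  rw [polarRadius_dilSph ((hr p hp).trans (by linarith)) hγ.1.le (by nlinarith [hγ.2])]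
  exact h1

theorem dilatedDomain_subset_upperHemisphere (hDH : D ⊆ upperHemisphere N)
    (hγ : γ ∈ Ioc (0 : ℝ) 1) : dilatedDomain γ D ⊆ upperHemisphere N := by
  have hπ := pi_pos
  intro q hq
  have hr := fun p (hp : p ∈ D) => polarRadius_lt_pi_div_two_of_subset hDH hp
  rw [dilatedDomain_eq_image fun p hp => (hr p hp).trans (by linarith)] at hq
  obtain ⟨p, hp, rfl⟩ := hq
  have h1 := mul_le_mul_of_nonneg_right hγ.2 (polarRadius_nonneg p)
  have h2 := hr p hp
  rw [← polarRadius_lt_pi_div_two_iff,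
    polarRadius_dilSph ((hr p hp).trans (by linarith)) hγ.1.le (by linarith)]
  linarith

theorem dilatedDomain_one (D : Set (Sph N)) : dilatedDomain 1 D = D := by
  ext q
  simp [dilatedDomain, dilation_one]

theorem dilatedDomain_mul (hDH : D ⊆ upperHemisphere N) (hγ : γ ∈ Ioo (0 : ℝ) 2) (δ : ℝ) :
    dilatedDomain δ (dilatedDomain γ D) = dilatedDomain (γ * δ) D := by
  have hπ := pi_pos
  have hr := fun p (hp : p ∈ D) => polarRadius_lt_pi_div_two_of_subset hDH hp
  exact dilatedDomain_dilatedDomain (fun p hp => (hr p hp).trans (by linarith)) hγ.1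
    (fun p hp => by nlinarith [hr p hp, polarRadius_nonneg p, hγ.1, hγ.2]) δ

theorem continuousOn_lambdaOne_dilatedDomain (hN : 2 ≤ N) (hD : IsSmoothDomain D)
    (hDH : D ⊆ upperHemisphere N) :
    ContinuousOn (fun t => lambdaOne (dilatedDomain t D)) (Ioc 0 1) := by
  have h2 : ∀ t ∈ Ioc (0 : ℝ) 1, t ∈ Ioo (0 : ℝ) 2 := fun t ht => ⟨ht.1, by linarith [ht.2]⟩
  have hmul : ∀ t ∈ Ioc (0 : ℝ) 1, ∀ s ∈ Ioc 0 t,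
      s / t ∈ Ioc (0 : ℝ) 1 ∧ dilatedDomain (s / t) (dilatedDomain t D) = dilatedDomain s D := by
    intro t ht s hs
    refine ⟨⟨div_pos hs.1 ht.1, (div_le_one ht.1).2 hs.2⟩, ?_⟩
    rw [dilatedDomain_mul hDH (h2 t ht), mul_div_cancel₀ _ ht.1.ne']
  refine continuousOn_of_mul_pow_le (m := N) (n := N + 2) (by omega)
    (fun t ht => ((hD.dilatedDomain hDH (h2 t ht)).spectral_gap hN).1) ?_ ?_ <;>
    intro t ht s hs <;> obtain ⟨h3, h4⟩ := hmul t ht s hs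
  · simpa only [h4] using lambdaOne_mul_pow_le_lambdaOne_dilatedDomain hN
      (hD.dilatedDomain hDH (h2 t ht)) (dilatedDomain_subset_upperHemisphere hDH ht) h3
  · simpa only [h4] using lambdaOne_dilatedDomain_mul_pow_le_lambdaOne hN
      (hD.dilatedDomain hDH (h2 t ht)) (dilatedDomain_subset_upperHemisphere hDH ht) h3

theorem exists_lt_lambdaOne_dilatedDomain (hN : 2 ≤ N) (hD : IsSmoothDomain D)
    (hDH : D ⊆ upperHemisphere N) (C : ℝ) :
    ∃ t ∈ Ioc (0 : ℝ) 1, C < lambdaOne (dilatedDomain t D) := by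
  obtain ⟨ρ, hρ, hhalf⟩ := exists_lambdaOne_dilatedDomain_half_ge hN
  set t₀ := min 1 (ρ / π) / 2 with ht₀
  have hπ := pi_pos
  have hm : 0 < min 1 (ρ / π) := lt_min one_pos (by positivity)
  have ht0 : 0 < t₀ := by positivity
  have ht1 : t₀ ≤ 1 := by linarith [min_le_left 1 (ρ / π)]
  have htρ : t₀ * (π / 2) < ρ := by
    have h1 := min_le_right 1 (ρ / π)
    rw [le_div_iff₀ hπ] at h1
    nlinarith
  have htk : ∀ k : ℕ, t₀ / 2 ^ k ∈ Ioc 0 t₀ := fun k =>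
    ⟨by positivity, div_le_self ht0.le (one_le_pow₀ (by norm_num))⟩
  have hgrow : ∀ k : ℕ, (3 / 2) ^ k * lambdaOne (dilatedDomain t₀ D) ≤
      lambdaOne (dilatedDomain (t₀ / 2 ^ k) D) := by
    intro k
    induction k with
    | zero => simp
    | succ k ih =>
      obtain ⟨h1, h2⟩ := htk k
      have h3 : t₀ / 2 ^ k ∈ Ioo (0 : ℝ) 2 := ⟨h1, by linarith⟩
      have h4 := hhalf _ (hD.dilatedDomain hDH h3)
        (dilatedDomain_subset_upperHemisphere hDH ⟨h1, h2.trans ht1⟩) fun p hp =>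
          (polarRadius_le_of_mem_dilatedDomain hDH h3 hp).trans_lt (by nlinarith)
      rw [dilatedDomain_mul hDH h3, div_mul_div_comm, mul_one, ← pow_succ] at h4
      rw [pow_succ]
      linarith
  have hpos := ((hD.dilatedDomain hDH ⟨ht0, by linarith⟩).spectral_gap hN).1
  obtain ⟨k, hk⟩ := pow_unbounded_of_one_lt (C / lambdaOne (dilatedDomain t₀ D))
    (by norm_num : (1 : ℝ) < 3 / 2)
  rw [div_lt_iff₀ hpos] at hk
  exact ⟨_, ⟨(htk k).1, (htk k).2.trans ht1⟩, hk.trans_le (hgrow k)⟩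

theorem exists_lambdaOne_dilatedDomain_eq (hN : 2 ≤ N) (hD : IsSmoothDomain D)
    (hDH : D ⊆ upperHemisphere N) {C : ℝ} (hC : lambdaOne D < C) :
    ∃ t ∈ Ioo (0 : ℝ) 1, lambdaOne (dilatedDomain t D) = C := by
  obtain ⟨s, hs, hsC⟩ := exists_lt_lambdaOne_dilatedDomain hN hD hDH C
  have hcont := (continuousOn_lambdaOne_dilatedDomain hN hD hDH).mono
    (fun t (ht : t ∈ Icc s 1) => ⟨hs.1.trans_le ht.1, ht.2⟩)
  obtain ⟨t, ht, htC⟩ := intermediate_value_Icc' hs.2 hcont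
    (show C ∈ Icc _ _ from ⟨by simpa only [dilatedDomain_one] using hC.le, hsC.le⟩)
  refine ⟨t, ⟨hs.1.trans_le ht.1, lt_of_le_of_ne ht.2 ?_⟩, htC⟩
  rintro rfl
  simp only [dilatedDomain_one] at htC
  exact hC.ne htC

end Final

end SphericalNeumann

/-- The equality `lambdaOne = N - 1` is accompanied by the assertion that `N - 1` is attained as an
eigenvalue. The last three conjuncts express that one may reparametrize so that `β = 1`: the
domain `D_β` is again admissible, and the family it generates is `γ ↦ D_{βγ}`. -/
theorem corollary2p2 (N : ℕ) (hN : 3 ≤ N) (D : Set (Sph N)) (hD : IsSmoothDomain D)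
    (hDplus : D ⊆ upperHemisphere N) (α : ℝ) (hα : α ∈ Set.Ioo (0 : ℝ) 2)
    (hDα : dilatedDomain α D ⊆ upperHemisphere N)
    (hlam : lambdaOne (dilatedDomain α D) < (N : ℝ) - 1) :
    ∃ β ∈ Set.Ioo (0 : ℝ) α,
      (lambdaOne (dilatedDomain β D) = (N : ℝ) - 1 ∧
        IsNeumannEigenvalue (dilatedDomain β D) ((N : ℝ) - 1)) ∧
      IsSmoothDomain (dilatedDomain β D) ∧
      dilatedDomain β D ⊆ upperHemisphere N ∧
      ∀ γ ∈ Set.Ioo (0 : ℝ) 2, β * γ < 2 →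
        dilatedDomain γ (dilatedDomain β D) = dilatedDomain (β * γ) D := by
  have : NeZero N := ⟨by omega⟩
  have hN2 : 2 ≤ N := by omega
  have hDs := hD.dilatedDomain hDplus hα
  obtain ⟨t, ht, htN⟩ := exists_lambdaOne_dilatedDomain_eq hN2 hDs hDα hlam
  have ht2 : t ∈ Set.Ioo (0 : ℝ) 2 := ⟨ht.1, by linarith [ht.2]⟩
  have htβ := dilatedDomain_mul hDplus hα t
  have hβ : α * t ∈ Set.Ioo (0 : ℝ) α := ⟨mul_pos hα.1 ht.1, mul_lt_of_lt_one_right hα.1 ht.2⟩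
  have hsmooth := hDs.dilatedDomain hDα ht2
  have hsub := dilatedDomain_subset_upperHemisphere hDα ⟨ht.1, ht.2.le⟩
  have heig := (hsmooth.spectral_gap hN2).2.1
  rw [htN] at heig
  rw [htβ] at htN heig hsmooth hsub
  exact ⟨α * t, hβ, ⟨htN, heig⟩, hsmooth, hsub, fun γ _ _ =>
    dilatedDomain_mul hDplus ⟨hβ.1, hβ.2.trans hα.2⟩ γ⟩
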